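/- Let $\kappa$ be an infinite regular cardinal, regarded as an ordinal. *Conventions.* Let $\mathcal M$ be a class of maps of a category $\mathcal E$. For a limit ordinal $\alpha$, an *$\alpha$-chain in $\mathcal M$* is a functor $\alpha\to\mathcal E$ that is cocontinuous at limit ordinals $<\alpha$ and whose successor maps are in $\mathcal M$. $(\mathcal E,\mathcal M)$ *has $\kappa$-compositions* if $\mathcal M$ contains identities and is closed under composition and, for every limit ordinal $\alpha\le\kappa$, every $\alpha$-chain in $\mathcal M$ has a colimit, its coprojections are in $\mathcal M$, and the map out of the colimit induced by any cocone of maps in $\mathcal M$ is in $\mathcal M$. $(\mathcal E,\mathcal M)$ *has pushouts* (resp. *pullbacks*) if pushouts (resp. pullbacks) along maps in $\mathcal M$ exist and $\mathcal M$ is stable under pushout (resp. pullback); it has *van Kampen pushouts* if moreover the pushouts along maps in $\mathcal M$ are van Kampen colimits. *The category $\mathrm{ConfMnd}_{\mathrm p}^{\kappa}$.* An object is a triple $(\mathcal E,\mathcal M,F)$ of a category $\mathcal E$, a class of maps $\mathcal M$ and a pointed endofunctor $(F,\eta^F)$ such that: $(\mathcal E,\mathcal M)$ has $\kappa$-compositions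 and pushouts; the components of $\eta^F$ are in $\mathcal M$; for each $f\colon X\to Y$ in $\mathcal M$ the induced map $FX\sqcup_X Y\to FY$ is in $\mathcal M$; $F$ maps $\mathcal M$ to $\mathcal M$; and $F$ preserves colimits of $\kappa$-chains in $\mathcal M$. A morphism $(\mathcal E_1,\mathcal M_1,F_1)\to(\mathcal E_2,\mathcal M_2,F_2)$ is a functor $P\colon\mathcal E_1\to\mathcal E_2$ that maps $\mathcal M_1$ to $\mathcal M_2$, preserves colimits of $\alpha$-chains in $\mathcal M_1$ for all limit $\alpha\le\kappa$ and pushouts along maps in $\mathcal M_1$, together with an isomorphism $\varphi\colon PF_1\cong F_2P$ with $\varphi\cdot P\eta^{F_1}=\eta^{F_2}P$. *The category $\mathrm{Mnd}_s$.* An object is a category with a monad on it. A morphism $(\mathcal C,T,\eta,\mu)\to(\mathcal C',T',\eta',\mu')$ is a functor $U\colon\mathcal C\to\mathcal C'$ with an isomorphism $\gamma\colon UT\cong T'U$ such that $\gamma\cdot U\eta=\eta'U$ and $\gamma\cdot U\mu=\mu'U\cdot T'\gamma\cdot\gamma T$. **Theorem.** The functor $\mathrm{ConfMnd}_{\mathrm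 p}^{\kappa}\to\mathrm{Cat}$, $(\mathcal E,\mathcal M,F)\mapsto\mathcal E$, lifts to a functor $\mathrm{ConfMnd}_{\mathrm p}^{\kappa}\to\mathrm{Mnd}_s$ sending $(\mathcal E,\mathcal M,F)$ to the free and algebraically-free monad $(T,\eta^T,\mu^T)$ on $F$. That is, there is a map of pointed endofunctors $\iota\colon F\to T$ along which every map of pointed endofunctors from $F$ to a monad extends uniquely to a monad morphism, and restriction along $\iota$ is an isomorphism from the category of algebras of the monad $T$ to the category of algebras of the pointed endofunctor $F$ (objects $A$ with $a\colon FA\to A$ such that $a\cdot\eta^F_A=\mathrm{id}$). For a morphism $(P,\varphi)$ with image $(P,\gamma)$ one has $\gamma\cdot P\iota_1=\iota_2P\cdot\varphi$. Moreover, for each $(\mathcal E,\mathcal M,F)$: 1. Let $\Xi$ be a class of diagrams in $\mathcal E$ closed under postcomposition with endofunctors of $\mathcal E$ (for example, all diagrams whose shape belongs to a given class). If $F$ preserves colimits of all diagrams in $\Xi$, then so does $T$. 2. The components of $\eta^T$ are in $\mathcal M$. 3. $T$ maps $\mathcal M$ to $\mathcal M$. 4. Assume that $(\mathcal E,\mathcal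 M)$ has pullbacks and van Kampen pushouts and that all maps in $\mathcal M$ are monomorphisms. If $\eta^F$ is cartesian (all its naturality squares are pullbacks), then so is $\eta^T$. -/

import Mathlib

open CategoryTheory Limits

universe w w₁ w₂ v u

namespace FreeMonadSequence

/-! ### Categories with a class of maps -/

section ClassOfMaps

variable {E : Type u} [Category.{v} E]

/-- A diagram indexed by a well-order `J` whose colimit is a transfinite composition of maps in
`M`: it is cocontinuous (the value at each limit element is the colimit of the preceding values)
and its successor maps are in `M`. -/
structure IsChain (M : MorphismProperty E) {J : Type w} [LinearOrder J] (D : J ⥤ E) : Prop where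
  continuous : D.IsWellOrderContinuous
  succ_mem : ∀ (i j : J) (h : i ⋖ j), M (D.map (homOfLE h.le))

/-- `(E, M)` has `κ`-compositions: `M` is closed under finitary composition, and, for each limit
ordinal `α ≤ κ`, each `α`-chain of maps in `M` has a colimit, its coprojections are in `M`, and the
map out of the colimit induced by a cocone of maps in `M` is in `M`. A limit ordinal is
represented by a nonempty well-order without greatest element. -/
structure HasCompositions (M : MorphismProperty E) (κ : Cardinal.{w}) : Prop where
  isMultiplicative : M.IsMultiplicative
  hasColimit : ∀ (J : Type w) [LinearOrder J] [WellFoundedLT J] [Nonempty J] [NoMaxOrder J],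
    Ordinal.type (α := J) (· < ·) ≤ κ.ord → ∀ D : J ⥤ E, IsChain M D → HasColimit D
  coprojection_mem : ∀ (J : Type w) [LinearOrder J] [WellFoundedLT J] [Nonempty J] [NoMaxOrder J],
    Ordinal.type (α := J) (· < ·) ≤ κ.ord → ∀ D : J ⥤ E, IsChain M D →
      ∀ (c : Cocone D), IsColimit c → ∀ j, M (c.ι.app j)
  desc_mem : ∀ (J : Type w) [LinearOrder J] [WellFoundedLT J] [Nonempty J] [NoMaxOrder J],
    Ordinal.type (α := J) (· < ·) ≤ κ.ord → ∀ D : J ⥤ E, IsChain M D →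
      ∀ (c : Cocone D) (hc : IsColimit c) (s : Cocone D), (∀ j, M (s.ι.app j)) → M (hc.desc s)

/-- `P` preserves the `κ`-compositions in `(E, M)`, that is, the colimits of `α`-chains of maps
in `M` for all limit ordinals `α ≤ κ`. -/
def PreservesCompositions (M : MorphismProperty E) (κ : Cardinal.{w})
    {E' : Type u} [Category.{v} E'] (P : E ⥤ E') : Prop :=
  ∀ (J : Type w) [LinearOrder J] [WellFoundedLT J] [Nonempty J] [NoMaxOrder J],
    Ordinal.type (α := J) (· < ·) ≤ κ.ord → ∀ D : J ⥤ E, IsChain M D → PreservesColimit D P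

/-- `P` preserves `κ`-transfinite compositions of maps in `M` (chains of length exactly `κ`). -/
def PreservesTransfiniteComposition (M : MorphismProperty E) (κ : Cardinal.{w})
    {E' : Type u} [Category.{v} E'] (P : E ⥤ E') : Prop :=
  ∀ (J : Type w) [LinearOrder J] [WellFoundedLT J],
    Ordinal.type (α := J) (· < ·) = κ.ord → ∀ D : J ⥤ E, IsChain M D → PreservesColimit D P

/-- `(E, M)` has pushouts: pushouts along maps in `M` exist, and `M` is stable under pushout. -/
structure HasPushoutsAlong (M : MorphismProperty E) : Prop where
  hasPushout : ∀ {A B C : E} (f : A ⟶ C) (g : A ⟶ B), M f → HasPushout f g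
  stable : M.IsStableUnderCobaseChange

/-- `P` preserves the pushouts in `(E, M)`, that is, pushouts along maps in `M`. -/
def PreservesPushoutsAlong (M : MorphismProperty E)
    {E' : Type u} [Category.{v} E'] (P : E ⥤ E') : Prop :=
  ∀ ⦃A B C : E⦄ (f : A ⟶ C) (g : A ⟶ B), M f → PreservesColimit (span f g) P

/-- `(E, M)` has pullbacks: pullbacks along maps in `M` exist, and `M` is stable under pullback. -/
structure HasPullbacksAlong (M : MorphismProperty E) : Prop where
  hasPullback : ∀ {A B C : E} (f : A ⟶ C) (g : B ⟶ C), M f → HasPullback f g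
  stable : M.IsStableUnderBaseChange

/-- `(E, M)` has van Kampen pushouts: it has pushouts, and the pushouts along maps in `M` are
van Kampen colimits. -/
structure HasVanKampenPushoutsAlong (M : MorphismProperty E) : Prop
    extends HasPushoutsAlong M where
  isVanKampen : ∀ {A B C : E} (f : A ⟶ C) (g : A ⟶ B), M f →
    ∀ c : Cocone (span f g), IsColimit c → IsVanKampenColimit c

/-- `M` is closed under Leibniz application of `η : Id ⟶ F`: for `f : X ⟶ Y` in `M`, the map from
the pushout of `Y ⟵ X ⟶ F X` to `F Y` induced by the naturality square of `η` on `f` is in `M`. -/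
def LeibnizClosed (M : MorphismProperty E) {F : E ⥤ E} (η : 𝟭 E ⟶ F) : Prop :=
  ∀ ⦃X Y D : E⦄ (f : X ⟶ Y), M f → ∀ (l : Y ⟶ D) (r : F.obj X ⟶ D)
    (h : IsPushout f (η.app X) l r), M (h.desc (η.app Y) (F.map f) (η.naturality f))

/-! Preservation of `κ`-compositions and of pushouts is stable under composition of functors. -/

theorem IsChain.map {E' : Type u} [Category.{v} E'] {M : MorphismProperty E}
    {M' : MorphismProperty E'} {κ : Cardinal.{w}} {P : E ⥤ E'}
    (hM : ∀ {X Y : E} (f : X ⟶ Y), M f → M' (P.map f)) (hP : PreservesCompositions M κ P)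
    {J : Type w} [LinearOrder J] [WellFoundedLT J] (hJ : Ordinal.type (α := J) (· < ·) ≤ κ.ord)
    {D : J ⥤ E} (hD : IsChain M D) : IsChain M' (D ⋙ P) where
  succ_mem i j h := hM _ (hD.succ_mem i j h)
  continuous := ⟨fun m hm => by
    have := hD.continuous
    have hne : Nonempty (Set.Iio m) := by
      obtain ⟨a, ha⟩ := not_isMin_iff.1 hm.1
      exact ⟨⟨a, ha⟩⟩
    have hmax : NoMaxOrder (Set.Iio m) := hm.2.noMaxOrder_Iio
    let i : Set.Iio m ≤i J := (Set.principalSegIio m : Set.Iio m <i J)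
    have hle : Ordinal.type (α := Set.Iio m) (· < ·) ≤ κ.ord :=
      (Ordinal.type_le_iff.2 ⟨i⟩).trans hJ
    let D₀ : Set.Iio m ⥤ E := i.monotone.functor ⋙ D
    have hch : IsChain M D₀ :=
      { continuous := inferInstanceAs (i.monotone.functor ⋙ D).IsWellOrderContinuous
        succ_mem := fun a b h => hD.succ_mem (i a) (i b) (i.apply_covBy_apply_iff.2 h) }
    have := hP (Set.Iio m) hle D₀ hch
    exact ⟨isColimitOfPreserves P (D.isColimitOfIsWellOrderContinuous m hm)⟩⟩

theorem PreservesCompositions.comp {E₂ E₃ : Type u} [Category.{v} E₂] [Category.{v} E₃]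
    {M : MorphismProperty E} {M₂ : MorphismProperty E₂} {κ : Cardinal.{w}}
    {P : E ⥤ E₂} {Q : E₂ ⥤ E₃} (hM : ∀ {X Y : E} (f : X ⟶ Y), M f → M₂ (P.map f))
    (hP : PreservesCompositions M κ P) (hQ : PreservesCompositions M₂ κ Q) :
    PreservesCompositions M κ (P ⋙ Q) := by
  intro J _ _ _ _ hJ D hD
  have := hP J hJ D hD
  have := hQ J hJ (D ⋙ P) (hD.map hM hP hJ)
  infer_instance

theorem PreservesPushoutsAlong.comp {E₂ E₃ : Type u} [Category.{v} E₂] [Category.{v} E₃]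
    {M : MorphismProperty E} {M₂ : MorphismProperty E₂}
    {P : E ⥤ E₂} {Q : E₂ ⥤ E₃} (hM : ∀ {X Y : E} (f : X ⟶ Y), M f → M₂ (P.map f))
    (hP : PreservesPushoutsAlong M P) (hQ : PreservesPushoutsAlong M₂ Q) :
    PreservesPushoutsAlong M (P ⋙ Q) := by
  intro A B C f g hf
  have := hP f g hf
  have := hQ (P.map f) (P.map g) (hM f hf)
  have : PreservesColimit (span f g ⋙ P) Q :=
    preservesColimit_of_iso_diagram Q (spanCompIso P f g).symm
  infer_instance

end ClassOfMaps

/-! ### The category of configurations -/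

/-- A configuration `(E, M, F)` for the free monad sequence on a pointed endofunctor `(F, η)`. -/
structure ConfMnd (κ : Cardinal.{w}) where
  E : Type u
  [category : Category.{v} E]
  M : MorphismProperty E
  F : E ⥤ E
  η : 𝟭 E ⟶ F
  hasCompositions : HasCompositions M κ
  hasPushouts : HasPushoutsAlong M
  unit_mem : ∀ X, M (η.app X)
  leibnizClosed : LeibnizClosed M η
  map_mem : ∀ {X Y : E} (f : X ⟶ Y), M f → M (F.map f)
  preservesTransfiniteComposition : PreservesTransfiniteComposition M κ F

attribute [instance] ConfMnd.category

namespace ConfMnd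

variable {κ : Cardinal.{w}}

/-- A morphism of configurations: a functor `P` that preserves the classes of maps, the
`κ`-compositions and the pushouts along maps in the class, together with an isomorphism
`φ : P F₁ ≅ F₂ P` making it a map of pointed endofunctors. -/
@[ext]
structure Hom (c d : ConfMnd.{w, v, u} κ) where
  P : c.E ⥤ d.E
  φ : c.F ⋙ P ≅ P ⋙ d.F
  unit : ∀ X, P.map (c.η.app X) ≫ φ.hom.app X = d.η.app (P.obj X)
  map_mem : ∀ {X Y : c.E} (f : X ⟶ Y), c.M f → d.M (P.map f)
  preservesCompositions : PreservesCompositions c.M κ P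
  preservesPushouts : PreservesPushoutsAlong c.M P

/-- The identity morphism. -/
def Hom.id (c : ConfMnd.{w, v, u} κ) : Hom c c where
  P := 𝟭 c.E
  φ := Iso.refl c.F
  unit _ := Category.comp_id _
  map_mem _ hf := hf
  preservesCompositions _ _ _ _ _ _ _ _ := inferInstance
  preservesPushouts _ _ _ _ _ _ := inferInstance

/-- Composition: the isomorphism `Q P F₁ ≅ Q F₂ P ≅ F₃ Q P` is the pasting of the given ones. -/
def Hom.comp {c d e : ConfMnd.{w, v, u} κ} (P : Hom c d) (Q : Hom d e) : Hom c e where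
  P := P.P ⋙ Q.P
  φ := Functor.isoWhiskerRight P.φ Q.P ≪≫ Functor.isoWhiskerLeft P.P Q.φ
  unit X := by
    have h := congrArg Q.P.map (P.unit X)
    have h' := Q.unit (P.P.obj X)
    simp only [Functor.map_comp] at h
    simp [← h', ← h]
  map_mem f hf := Q.map_mem _ (P.map_mem f hf)
  preservesCompositions := P.preservesCompositions.comp P.map_mem Q.preservesCompositions
  preservesPushouts := P.preservesPushouts.comp P.map_mem Q.preservesPushouts

theorem Hom.id_comp {c d : ConfMnd.{w, v, u} κ} (P : Hom c d) : (Hom.id c).comp P = P := by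
  refine Hom.ext rfl (heq_of_eq (Iso.ext (NatTrans.ext (funext fun X => ?_))))
  simp [Hom.comp, Hom.id]

theorem Hom.comp_id {c d : ConfMnd.{w, v, u} κ} (P : Hom c d) : P.comp (Hom.id d) = P := by
  refine Hom.ext rfl (heq_of_eq (Iso.ext (NatTrans.ext (funext fun X => ?_))))
  simp [Hom.comp, Hom.id]

theorem Hom.assoc {b c d e : ConfMnd.{w, v, u} κ} (P : Hom b c) (Q : Hom c d) (R : Hom d e) :
    (P.comp Q).comp R = P.comp (Q.comp R) := by
  refine Hom.ext rfl (heq_of_eq (Iso.ext (NatTrans.ext (funext fun X => ?_))))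
  simp [Hom.comp]

instance : Category (ConfMnd.{w, v, u} κ) where
  Hom := Hom
  id := Hom.id
  comp := Hom.comp
  id_comp := Hom.id_comp
  comp_id := Hom.comp_id
  assoc := Hom.assoc

end ConfMnd

/-! ### Monads with strong morphisms -/

/-- The structure of a strong monad morphism from `T` to `T'` on a functor `U`: an isomorphism
`γ : U T ≅ T' U` compatible with units and multiplications. -/
@[ext]
structure StrongMonadMap {C : Type u} [Category.{v} C] {C' : Type u} [Category.{v} C']
    (T : Monad C) (T' : Monad C') (U : C ⥤ C') where
  γ : T.toFunctor ⋙ U ≅ U ⋙ T'.toFunctor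
  unit : ∀ X, U.map (T.η.app X) ≫ γ.hom.app X = T'.η.app (U.obj X)
  mul : ∀ X, U.map (T.μ.app X) ≫ γ.hom.app X =
    γ.hom.app (T.obj X) ≫ T'.map (γ.hom.app X) ≫ T'.μ.app (U.obj X)

/-- An object of the category of monads: a monad on some category. -/
structure MndS where
  C : Type u
  [category : Category.{v} C]
  T : Monad C

attribute [instance] MndS.category

namespace MndS

/-- A morphism of monads: a functor with the structure of a strong monad morphism. -/
@[ext]
structure Hom (A B : MndS.{v, u}) where
  U : A.C ⥤ B.C
  str : StrongMonadMap A.T B.T U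

/-- The identity morphism. -/
def Hom.id (A : MndS.{v, u}) : Hom A A where
  U := 𝟭 A.C
  str :=
    { γ := Iso.refl A.T.toFunctor
      unit := fun _ => Category.comp_id _
      mul := fun X => by simp }

/-- Composition: the isomorphism `V U T ≅ V T' U ≅ T'' V U` is the pasting of the given ones. -/
def Hom.comp {A B D : MndS.{v, u}} (f : Hom A B) (g : Hom B D) : Hom A D where
  U := f.U ⋙ g.U
  str :=
    { γ := Functor.isoWhiskerRight f.str.γ g.U ≪≫ Functor.isoWhiskerLeft f.U g.str.γ
      unit := fun X => by
        have h := congrArg g.U.map (f.str.unit X)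
        have h' := g.str.unit (f.U.obj X)
        simp only [Functor.map_comp] at h
        simp [← h', ← h]
      mul := fun X => by
        have h := congrArg g.U.map (f.str.mul X)
        have h' := g.str.mul (f.U.obj X)
        have n := g.str.γ.hom.naturality (f.str.γ.hom.app X)
        simp only [Functor.map_comp] at h
        simp only [Functor.comp_map, Functor.comp_obj] at n
        simp only [Functor.comp_obj, Functor.comp_map, Iso.trans_hom, NatTrans.comp_app,
          Functor.isoWhiskerRight_hom, Functor.isoWhiskerLeft_hom, Functor.whiskerRight_app,
          Functor.whiskerLeft_app, Functor.map_comp, Category.assoc]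
        rw [reassoc_of% h, h', reassoc_of% n] }

theorem Hom.id_comp {A B : MndS.{v, u}} (f : Hom A B) : (Hom.id A).comp f = f := by
  refine Hom.ext rfl (heq_of_eq (StrongMonadMap.ext
    (Iso.ext (NatTrans.ext (funext fun X => ?_)))))
  simp [Hom.comp, Hom.id]

theorem Hom.comp_id {A B : MndS.{v, u}} (f : Hom A B) : f.comp (Hom.id B) = f := by
  refine Hom.ext rfl (heq_of_eq (StrongMonadMap.ext
    (Iso.ext (NatTrans.ext (funext fun X => ?_)))))
  simp [Hom.comp, Hom.id]

theorem Hom.assoc {A B C D : MndS.{v, u}} (f : Hom A B) (g : Hom B C) (h : Hom C D) :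
    (f.comp g).comp h = f.comp (g.comp h) := by
  refine Hom.ext rfl (heq_of_eq (StrongMonadMap.ext
    (Iso.ext (NatTrans.ext (funext fun X => ?_)))))
  simp [Hom.comp]

instance : Category MndS.{v, u} where
  Hom := Hom
  id := Hom.id
  comp := Hom.comp
  id_comp := Hom.id_comp
  comp_id := Hom.comp_id
  assoc := Hom.assoc

/-- The functor sending a monad to its underlying category. -/
def forget : MndS.{v, u} ⥤ Cat.{v, u} where
  obj A := Cat.of A.C
  map f := f.U.toCatHom

end MndS

/-- The canonical functor sending `(E, M, F)` to `E`. -/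
def ConfMnd.forget (κ : Cardinal.{w}) : ConfMnd.{w, v, u} κ ⥤ Cat.{v, u} where
  obj c := Cat.of c.E
  map P := P.P.toCatHom

/-- A lift of the functor `ConfMnd.forget κ` to the category of monads with strong morphisms: a
monad on the underlying category of each configuration and the structure of a strong monad morphism
on the underlying functor of each morphism of configurations, functorially. -/
structure MonadLift (κ : Cardinal.{w}) where
  T : ∀ c : ConfMnd.{w, v, u} κ, Monad c.E
  str : ∀ {c d : ConfMnd.{w, v, u} κ} (P : c ⟶ d), StrongMonadMap (T c) (T d) P.P
  map_id : ∀ c : ConfMnd.{w, v, u} κ,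
    (MndS.Hom.mk (A := ⟨c.E, T c⟩) (B := ⟨c.E, T c⟩) _ (str (𝟙 c))) = 𝟙 (MndS.mk c.E (T c))
  map_comp : ∀ {c d e : ConfMnd.{w, v, u} κ} (P : c ⟶ d) (Q : d ⟶ e),
    (MndS.Hom.mk (A := ⟨c.E, T c⟩) (B := ⟨e.E, T e⟩) _ (str (P ≫ Q))) =
      MndS.Hom.comp (MndS.Hom.mk (A := ⟨c.E, T c⟩) (B := ⟨d.E, T d⟩) _ (str P))
        (MndS.Hom.mk (A := ⟨d.E, T d⟩) (B := ⟨e.E, T e⟩) _ (str Q))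

/-- The functor to the category of monads given by a lift. -/
def MonadLift.toFunctor {κ : Cardinal.{w}} (L : MonadLift.{w, v, u} κ) :
    ConfMnd.{w, v, u} κ ⥤ MndS.{v, u} where
  obj c := ⟨c.E, L.T c⟩
  map P := MndS.Hom.mk P.P (L.str P)
  map_id := L.map_id
  map_comp := L.map_comp

/-! ### Free and algebraically-free monads -/

section Free

variable {E : Type u} [Category.{v} E]

/-- The category of algebras of a pointed endofunctor `(F, η)`: pairs of an object `A` and a map
`a : F A ⟶ A` with `a ∘ η = id`. -/
abbrev PointedAlgebra {F : E ⥤ E} (η : 𝟭 E ⟶ F) :=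
  ObjectProperty.FullSubcategory
    (fun A : Endofunctor.Algebra F => η.app A.a ≫ A.str = 𝟙 A.a)

/-- Restriction of algebras of a monad `T` along a map `ι : F ⟶ T` of pointed endofunctors; it
sends `(A, a)` to `(A, a ∘ ι)` and is the identity on underlying maps. -/
def restrictAlgebra {F : E ⥤ E} {η : 𝟭 E ⟶ F} {T : Monad E} (ι : F ⟶ T.toFunctor)
    (hι : η ≫ ι = T.η) : T.Algebra ⥤ PointedAlgebra η where
  obj A := ⟨⟨A.A, ι.app A.A ≫ A.a⟩, by
    have h := A.unit
    rw [← hι] at h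
    simpa using h⟩
  map f := ObjectProperty.homMk ⟨f.f, by simp⟩

/-- `T` is the free and algebraically-free monad on the pointed endofunctor `(F, η)`, with
universal map `ι : F ⟶ T`. -/
structure IsFreeAndAlgebraicallyFree {F : E ⥤ E} (η : 𝟭 E ⟶ F) (T : Monad E)
    (ι : F ⟶ T.toFunctor) : Prop where
  /-- `ι` is a map of pointed endofunctors. -/
  unit : η ≫ ι = T.η
  /-- Freeness: each map of pointed endofunctors from `F` to a monad extends uniquely along `ι` to
  a monad morphism. -/
  free : ∀ (S : Monad E) (σ : F ⟶ S.toFunctor), η ≫ σ = S.η →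
    ∃! θ : T ⟶ S, ι ≫ θ.toNatTrans = σ
  /-- Algebraic freeness: restriction along `ι` is an isomorphism from the category of algebras of
  the monad `T` to the category of algebras of the pointed endofunctor `F`. -/
  full : (restrictAlgebra ι unit).Full
  faithful : (restrictAlgebra ι unit).Faithful
  bijective : Function.Bijective (restrictAlgebra ι unit).obj

end Free

end FreeMonadSequence

-- The free algebra is built by transfinite iteration, arranged so that all connecting maps stay in
-- `M`. The stages are partial algebras: an object `V`, a part `j : G ⟶ F V` in `M` through which
-- the unit factors, and an action `a : G ⟶ V` that is the identity on generators. A step makes the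
-- action defined on all of `F V` by adjoining its values: `V' = F V ⊔_G V`. The new domain is `G' =
-- V' ⊔_V F V`, and `G' ⟶ F V'` is the Leibniz map of the unit, hence again in `M`. At limits one
-- takes colimits of `V` and `G`. The maps `F V_k ⟶ G_{k+1}` interleave the chains `F V_k` and
-- `G_k`. As `F` preserves the colimit of the `κ`-chain, `j` becomes invertible after `κ` steps and
-- the action is total (`isIso_j_of_isColimit`, `exists_stage`).
--
-- The sequence is run in the configuration of endofunctors of the category, starting at the
-- identity, so that the functor `T` and its action come out at once. Facts about `T` are proved by
-- the induction principle `StageClosed`: what holds at the start and passes to steps and to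
-- colimits of chains holds for the limit.
--
-- The universal property is proved for every stage after application of any functor `P` that
-- preserves the relevant colimits (`IsStage.hasExtensions`). So `P (T X)` is the free algebra on `P
-- X` for the target endofunctor (`existsUnique_extension`). With `P` the identity this gives the
-- monad, its freeness and its algebras. With `P` a morphism of configurations it gives the
-- isomorphism `γ`, whose coherence laws follow from uniqueness.
--
-- Preservation of colimits passes through the stages because their colimits are pointwise. For `f :
-- X ⟶ Y` in `M`, running the sequence from the partial algebra on `Y ⊔_X T X` gives another
-- construction of `T Y`, which exhibits `T f` as a composite of maps in `M`.
--
-- For cartesian units the invariant is `IsCartesian`: the unit is cartesian, and an element acting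
-- as a generator is that generator. Steps are handled by van Kampen pushouts. Colimits of chains
-- are not assumed to be stable under pullback. The substitute is `isIso_of_isPullback_chain`, which
-- compares doubles `A ⊔_S A` and uses that the map out of a colimit induced by maps in `M` is in
-- `M`, hence a monomorphism.

universe v₁ u₁ v₂ u₂

namespace FreeMonadSequence

/-! ### Transfinite iteration of a successor operation on a category with colimits of chains -/

section Iteration

variable {C : Type u} [Category.{v} C]

/-- Chains of shape a limit ordinal `≤ κ` of maps in `W` have colimits, with coprojections
in `W`. -/
structure HasChainColimits (W : MorphismProperty C) (κ : Cardinal.{w}) : Prop where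
  hasColimit : ∀ (J : Type w) [LinearOrder J] [WellFoundedLT J] [Nonempty J] [NoMaxOrder J],
    Ordinal.type (α := J) (· < ·) ≤ κ.ord → ∀ D : J ⥤ C, IsChain W D → HasColimit D
  coprojection_mem : ∀ (J : Type w) [LinearOrder J] [WellFoundedLT J] [Nonempty J] [NoMaxOrder J],
    Ordinal.type (α := J) (· < ·) ≤ κ.ord → ∀ D : J ⥤ C, IsChain W D →
      ∀ (c : Cocone D), IsColimit c → ∀ j, W (c.ι.app j)

/-- The restriction of a chain to a proper initial segment is a chain. -/
theorem IsChain.restrict {W : MorphismProperty C} {J : Type w} [LinearOrder J]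
    {D : J ⥤ C} (hD : IsChain W D) (m : J) :
    IsChain W ((Set.principalSegIio m).monotone.functor ⋙ D) where
  continuous := by
    have := hD.continuous
    exact inferInstanceAs
      (((Set.principalSegIio m : Set.Iio m ≤i J).monotone.functor) ⋙ D).IsWellOrderContinuous
  succ_mem a b h :=
    hD.succ_mem _ _ ((Set.principalSegIio m : Set.Iio m ≤i J).apply_covBy_apply_iff.2 h)

theorem type_Iio_le {J : Type w} [LinearOrder J] [WellFoundedLT J] (m : J) :
    Ordinal.type (α := Set.Iio m) (· < ·) ≤ Ordinal.type (α := J) (· < ·) :=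
  Ordinal.type_le_iff.2 ⟨(Set.principalSegIio m : Set.Iio m <i J)⟩

/-- A full embedding in a category with all colimits of size `w` that preserves colimits. -/
noncomputable def coembedding (C : Type u) [Category.{v} C] :
    C ⥤ (Cᵒᵖᵒᵖ ⥤ Type (max w v))ᵒᵖ :=
  (uliftYoneda.{w} (C := Cᵒᵖ)).rightOp

instance (C : Type u) [Category.{v} C] : (coembedding.{w} C).Full :=
  inferInstanceAs (uliftYoneda.{w} (C := Cᵒᵖ)).rightOp.Full

instance (C : Type u) [Category.{v} C] : (coembedding.{w} C).Faithful :=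
  inferInstanceAs (uliftYoneda.{w} (C := Cᵒᵖ)).rightOp.Faithful

instance (C : Type u) [Category.{v} C] {J : Type w₁} [Category.{w₂} J] (D : J ⥤ C) :
    PreservesColimit D (coembedding.{w} C) :=
  preservesColimit_rightOp _ _

variable (A₀ : C) (S : C → C) (s : ∀ A, A ⟶ S A)

open Classical in
/-- The successor structure on the free completion extending `S` on the objects of `C`. -/
noncomputable def extendedSuccStruct :
    SmallObject.SuccStruct (Cᵒᵖᵒᵖ ⥤ Type (max w v))ᵒᵖ where
  X₀ := (coembedding.{w} C).obj A₀
  -- Off the essential image the successor is trivial. `iteration_representedIn` shows that no stage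
  -- of the iteration leaves the essential image.
  succ X := if h : (coembedding.{w} C).essImage X then (coembedding.{w} C).obj (S h.witness) else X
  toSucc X := if h : (coembedding.{w} C).essImage X then
      h.getIso.inv ≫ (coembedding.{w} C).map (s h.witness) ≫ eqToHom (by rw [dif_pos h])
    else eqToHom (by rw [dif_neg h])

/-- `S` is only a function on objects, not invariant under isomorphism, so the successor map is
described through one particular representative `B` of `X`. -/
theorem extendedSuccStruct_spec (X : (Cᵒᵖᵒᵖ ⥤ Type (max w v))ᵒᵖ)
    (h : (coembedding.{w} C).essImage X) :
    ∃ (B : C) (e : (coembedding.{w} C).obj B ≅ X)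
      (e' : (coembedding.{w} C).obj (S B) ≅ (extendedSuccStruct.{w} A₀ S s).succ X),
      e.hom ≫ (extendedSuccStruct.{w} A₀ S s).toSucc X =
        (coembedding.{w} C).map (s B) ≫ e'.hom :=
  ⟨h.witness, h.getIso, eqToIso (by simp [extendedSuccStruct, dif_pos h]), by
    simp only [extendedSuccStruct, dif_pos h, Iso.hom_inv_id_assoc]
    rfl⟩

/-- `f` corresponds to a map in `W` under any representation of its ends by objects of `C`. -/
def RepresentedIn (W : MorphismProperty C) {X Y : (Cᵒᵖᵒᵖ ⥤ Type (max w v))ᵒᵖ} (f : X ⟶ Y) : Prop :=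
  ∀ (A B : C) (a : (coembedding.{w} C).obj A ≅ X) (b : (coembedding.{w} C).obj B ≅ Y),
    W ((coembedding.{w} C).preimage (a.hom ≫ f ≫ b.inv))

variable {W : MorphismProperty C}

/-- One representation suffices: any two differ by isomorphisms, which lift along the fully faithful
embedding. -/
theorem RepresentedIn.mk [W.RespectsIso] {X Y : (Cᵒᵖᵒᵖ ⥤ Type (max w v))ᵒᵖ} {f : X ⟶ Y}
    {A B : C} (a : (coembedding.{w} C).obj A ≅ X) (b : (coembedding.{w} C).obj B ≅ Y)
    (g : A ⟶ B) (hg : W g) (h : a.hom ≫ f = (coembedding.{w} C).map g ≫ b.hom) :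
    RepresentedIn W f := by
  intro A' B' a' b'
  refine (W.arrow_mk_iso_iff (Arrow.isoMk ((coembedding.{w} C).preimageIso (a ≪≫ a'.symm))
    ((coembedding.{w} C).preimageIso (b ≪≫ b'.symm)) ?_)).1 hg
  apply (coembedding.{w} C).map_injective
  simp [reassoc_of% h]

theorem RepresentedIn.comp [W.IsMultiplicative] {X Y Z : (Cᵒᵖᵒᵖ ⥤ Type (max w v))ᵒᵖ} {f : X ⟶ Y}
    {g : Y ⟶ Z} (hf : RepresentedIn W f) (hg : RepresentedIn W g)
    (hY : (coembedding.{w} C).essImage Y) : RepresentedIn W (f ≫ g) := by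
  intro A B a b
  have := W.comp_mem _ _ (hf A _ a hY.getIso) (hg _ B hY.getIso b)
  rw [← Functor.preimage_comp] at this
  simpa using this

theorem RepresentedIn.id [W.IsMultiplicative] [W.RespectsIso]
    {X : (Cᵒᵖᵒᵖ ⥤ Type (max w v))ᵒᵖ} (hX : (coembedding.{w} C).essImage X) :
    RepresentedIn W (𝟙 X) :=
  RepresentedIn.mk hX.getIso hX.getIso (𝟙 _) (W.id_mem _) (by simp)

/-- Fully faithful functors reflect colimits, so continuity descends to `C`. -/
theorem isChain_of_comp_coembedding {J : Type w} [LinearOrder J]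
    {D : J ⥤ C} {I : J ⥤ (Cᵒᵖᵒᵖ ⥤ Type (max w v))ᵒᵖ} (e : D ⋙ coembedding.{w} C ≅ I)
    [I.IsWellOrderContinuous]
    (hI : ∀ (i j : J) (h : i ≤ j), RepresentedIn W (I.map (homOfLE h))) : IsChain W D where
  continuous := ⟨fun m hm => by
    have : (D ⋙ coembedding.{w} C).IsWellOrderContinuous :=
      Functor.isWellOrderContinuous_of_iso e.symm
    exact ⟨isColimitOfReflects (coembedding.{w} C)
      ((D ⋙ coembedding.{w} C).isColimitOfIsWellOrderContinuous m hm)⟩⟩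
  succ_mem i j h := by
    have := hI i j h.le _ _ (e.app i) (e.app j)
    convert this
    apply (coembedding.{w} C).map_injective
    simp

variable {κ : Cardinal.{w}} [W.IsMultiplicative] [W.RespectsIso]
  (J : Type w) [LinearOrder J] [OrderBot J] [SuccOrder J] [WellFoundedLT J] [NoMaxOrder J]

/-- Both claims go in one transfinite induction: at a limit, the earlier stages must already form a
chain in `W` inside `C` for their colimit to exist there. -/
theorem iteration_representedIn (hW : HasChainColimits W κ) (hs : ∀ A, W (s A))
    (hJ : Ordinal.type (α := J) (· < ·) ≤ κ.ord) (j : J) :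
    (coembedding.{w} C).essImage
        (((extendedSuccStruct.{w} A₀ S s).iterationFunctor J).obj j) ∧
      ∀ (i : J) (h : i ≤ j), RepresentedIn W
        (((extendedSuccStruct.{w} A₀ S s).iterationFunctor J).map (homOfLE h)) := by
  set Φ := extendedSuccStruct.{w} A₀ S s
  set I := Φ.iterationFunctor J
  induction j using SuccOrder.limitRecOn with
  | isMin j hj =>
    obtain rfl := hj.eq_bot
    have h0 : (coembedding.{w} C).essImage (I.obj ⊥) :=
      ⟨A₀, ⟨(Φ.iterationFunctorObjBotIso J).symm⟩⟩
    refine ⟨h0, fun i h => ?_⟩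
    obtain rfl : i = ⊥ := le_bot_iff.1 h
    convert RepresentedIn.id (W := W) h0
    exact I.map_id _
  | succ j hj ih =>
    obtain ⟨B, e, e', hB⟩ := extendedSuccStruct_spec A₀ S s (I.obj j) ih.1
    have h1 : (coembedding.{w} C).essImage (I.obj (Order.succ j)) :=
      ⟨S B, ⟨e' ≪≫ (Φ.iterationFunctorObjSuccIso j hj).symm⟩⟩
    have h2 : RepresentedIn W (I.map (homOfLE (Order.le_succ j))) := by
      refine RepresentedIn.mk e (e' ≪≫ (Φ.iterationFunctorObjSuccIso j hj).symm) (s B) (hs B) ?_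
      rw [Φ.iterationFunctor_map_succ j hj, reassoc_of% hB]
      simp [Φ]
    refine ⟨h1, fun i h => ?_⟩
    obtain rfl | h := h.eq_or_lt
    · convert RepresentedIn.id (W := W) h1
      exact I.map_id _
    · have h' := Order.lt_succ_iff.1 h
      have := (ih.2 i h').comp h2 ih.1
      rwa [← Functor.map_comp] at this
  | isSuccLimit m hm ih =>
    have hne : Nonempty (Set.Iio m) := by
      obtain ⟨a, ha⟩ := not_isMin_iff.1 hm.1
      exact ⟨⟨a, ha⟩⟩
    have hmax : NoMaxOrder (Set.Iio m) := hm.2.noMaxOrder_Iio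
    let I' := (Set.principalSegIio m).monotone.functor ⋙ I
    have hI' : I'.IsWellOrderContinuous := inferInstanceAs
      (((Set.principalSegIio m : Set.Iio m ≤i J).monotone.functor) ⋙ I).IsWellOrderContinuous
    let D := Functor.essImage.liftFunctor I' (coembedding.{w} C) (fun j => (ih j.1 j.2).1)
    let e : D ⋙ coembedding.{w} C ≅ I' :=
      Functor.essImage.liftFunctorCompIso I' (coembedding.{w} C) (fun j => (ih j.1 j.2).1)
    have hD : IsChain W D := isChain_of_comp_coembedding e
      (fun i j h => (ih j.1 j.2).2 i.1 h)
    have hle := (type_Iio_le m).trans hJ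
    have := hW.hasColimit _ hle D hD
    let c := colimit.cocone D
    let hc : IsColimit c := colimit.isColimit D
    -- The embedding preserves the colimit formed in `C`, so this colimit represents the limit stage
    -- of the iteration.
    let hc' := isColimitOfPreserves (coembedding.{w} C) hc
    let hI := I.isColimitOfIsWellOrderContinuous m hm
    let f : (coembedding.{w} C).obj c.pt ≅ I.obj m := hc'.coconePointsIsoOfNatIso hI e
    have h1 : (coembedding.{w} C).essImage (I.obj m) := ⟨_, ⟨f⟩⟩
    refine ⟨h1, fun i h => ?_⟩
    obtain rfl | h := h.eq_or_lt
    · convert RepresentedIn.id (W := W) h1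
      exact I.map_id _
    · refine RepresentedIn.mk (e.app ⟨i, h⟩) f (c.ι.app ⟨i, h⟩)
        (hW.coprojection_mem _ hle D hD c hc ⟨i, h⟩) ?_
      have := hc'.comp_coconePointsIsoOfNatIso_hom hI e ⟨i, h⟩
      exact this.symm

/-- The transfinite iteration of `s : A ⟶ S A` along `J`, starting at `A₀`. -/
theorem exists_iteration (hW : HasChainColimits W κ) (hs : ∀ A, W (s A))
    (hJ : Ordinal.type (α := J) (· < ·) ≤ κ.ord) :
    ∃ D : J ⥤ C, IsChain W D ∧ Nonempty (A₀ ≅ D.obj ⊥) ∧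
      ∀ j : J, ∃ (B : C) (e : B ≅ D.obj j) (e' : S B ≅ D.obj (Order.succ j)),
        e.hom ≫ D.map (homOfLE (Order.le_succ j)) = s B ≫ e'.hom := by
  set Φ := extendedSuccStruct.{w} A₀ S s with hΦ
  set I := Φ.iterationFunctor J with hI
  have H := iteration_representedIn A₀ S s J hW hs hJ
  let D := Functor.essImage.liftFunctor I (coembedding.{w} C) (fun j => (H j).1)
  let ε : D ⋙ coembedding.{w} C ≅ I :=
    Functor.essImage.liftFunctorCompIso I (coembedding.{w} C) (fun j => (H j).1)
  refine ⟨D, isChain_of_comp_coembedding ε (fun i j h => (H j).2 i h),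
    ⟨(coembedding.{w} C).preimageIso ((Φ.iterationFunctorObjBotIso J).symm ≪≫ (ε.app ⊥).symm)⟩,
    fun j => ?_⟩
  obtain ⟨B, e, e', hB⟩ := extendedSuccStruct_spec A₀ S s (I.obj j) (H j).1
  refine ⟨B, (coembedding.{w} C).preimageIso (e ≪≫ (ε.app j).symm),
    (coembedding.{w} C).preimageIso (e' ≪≫ (Φ.iterationFunctorObjSuccIso j (not_isMax j)).symm ≪≫
      (ε.app _).symm), ?_⟩
  apply (coembedding.{w} C).map_injective
  have h2 := ε.inv.naturality (homOfLE (Order.le_succ j))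
  have h3 : I.map (homOfLE (Order.le_succ j)) = _ := Φ.iterationFunctor_map_succ j (not_isMax j)
  simp only [Functor.comp_map] at h2
  simp only [Functor.map_comp, Functor.preimageIso_hom, Functor.map_preimage, Iso.trans_hom,
    Iso.symm_hom, Iso.app_inv, Category.assoc]
  rw [← h2, h3, ← reassoc_of% hB, Category.assoc]

end Iteration

end FreeMonadSequence

namespace FreeMonadSequence

/-! ### Functors that send chains to chains -/

section ChainComp

variable {C : Type u₁} [Category.{v₁} C] {E : Type u} [Category.{v} E]
  {W : MorphismProperty C} {M : MorphismProperty E} {κ : Cardinal.{w}}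

/-- If the functors `Φ k` preserve the colimits of those diagrams that become chains under all
`Φ k`, then they map chains to chains. -/
theorem IsChain.comp_of_preserves {ι : Type*} (Φ : ι → C ⥤ E)
    (hW : ∀ (k : ι) ⦃X Y : C⦄ (f : X ⟶ Y), W f → M ((Φ k).map f))
    (hΦ : ∀ (J : Type w) [LinearOrder J] [WellFoundedLT J] [Nonempty J] [NoMaxOrder J],
      Ordinal.type (α := J) (· < ·) ≤ κ.ord → ∀ D : J ⥤ C, (∀ k, IsChain M (D ⋙ Φ k)) →
        ∀ k, PreservesColimit D (Φ k))
    (J : Type w) [LinearOrder J] [WellFoundedLT J]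
    (hJ : Ordinal.type (α := J) (· < ·) ≤ κ.ord) (D : J ⥤ C) (hD : IsChain W D) (k : ι) :
    IsChain M (D ⋙ Φ k) := by
  -- The induction is on the length and lets `J` vary: continuity at `m` needs preservation for the
  -- restriction to `Set.Iio m`, which is strictly shorter.
  obtain ⟨o, ho⟩ : ∃ o, o = Ordinal.type (α := J) (· < ·) := ⟨_, rfl⟩
  induction o using WellFoundedLT.induction generalizing J k with
  | ind o ih =>
    refine ⟨⟨fun m hm => ?_⟩, fun i j h => hW k _ (hD.succ_mem i j h)⟩
    have hne : Nonempty (Set.Iio m) := by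
      obtain ⟨a, ha⟩ := not_isMin_iff.1 hm.1
      exact ⟨⟨a, ha⟩⟩
    have hmax : NoMaxOrder (Set.Iio m) := hm.2.noMaxOrder_Iio
    have hlt : Ordinal.type (α := Set.Iio m) (· < ·) < o := by
      rw [ho]
      exact Ordinal.type_lt_iff.2 ⟨(Set.principalSegIio m : Set.Iio m <i J)⟩
    have hle := (type_Iio_le m).trans hJ
    have hpres := hΦ (Set.Iio m) hle _
      (fun k => ih _ hlt (Set.Iio m) hle _ (hD.restrict m) k rfl) k
    have := hD.continuous
    exact ⟨isColimitOfPreserves (Φ k) (D.isColimitOfIsWellOrderContinuous m hm)⟩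

end ChainComp

/-! ### Partial algebras -/

variable {κ : Cardinal.{w}}

/-- A partial algebra for the pointed endofunctor `c.F`: an object `V` with an action `a` defined
on a part `G` of `F V` that contains the image of the unit. -/
structure PartialAlg (c : ConfMnd.{w, v, u} κ) where
  V : c.E
  G : c.E
  i : V ⟶ G
  j : G ⟶ c.F.obj V
  a : G ⟶ V
  i_j : i ≫ j = c.η.app V
  i_a : i ≫ a = 𝟙 V
  mem : c.M j

attribute [simp] PartialAlg.i_j PartialAlg.i_a

namespace PartialAlg

variable {c : ConfMnd.{w, v, u} κ}

/-- Maps of partial algebras. -/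
@[ext]
structure Hom (A B : PartialAlg c) where
  v : A.V ⟶ B.V
  g : A.G ⟶ B.G
  i_g : A.i ≫ g = v ≫ B.i := by cat_disch
  j_F : A.j ≫ c.F.map v = g ≫ B.j := by cat_disch
  a_v : A.a ≫ v = g ≫ B.a := by cat_disch

instance : Category (PartialAlg c) where
  Hom := Hom
  id A := { v := 𝟙 _, g := 𝟙 _ }
  comp f g :=
    { v := f.v ≫ g.v
      g := f.g ≫ g.g
      i_g := by rw [reassoc_of% f.i_g, g.i_g, Category.assoc]
      j_F := by rw [Functor.map_comp, reassoc_of% f.j_F, g.j_F, Category.assoc]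
      a_v := by rw [reassoc_of% f.a_v, g.a_v, Category.assoc] }

@[ext]
theorem hom_ext {A B : PartialAlg c} {f g : A ⟶ B} (h₁ : f.v = g.v) (h₂ : f.g = g.g) : f = g :=
  Hom.ext h₁ h₂

@[simp] theorem id_v (A : PartialAlg c) : Hom.v (𝟙 A) = 𝟙 _ := rfl
@[simp] theorem id_g (A : PartialAlg c) : Hom.g (𝟙 A) = 𝟙 _ := rfl
@[simp] theorem comp_v {A B D : PartialAlg c} (f : A ⟶ B) (g : B ⟶ D) :
    (f ≫ g).v = f.v ≫ g.v := rfl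
@[simp] theorem comp_g {A B D : PartialAlg c} (f : A ⟶ B) (g : B ⟶ D) :
    (f ≫ g).g = f.g ≫ g.g := rfl

variable (c) in
/-- The underlying object. -/
def forgetV : PartialAlg c ⥤ c.E where
  obj A := A.V
  map f := f.v

variable (c) in
/-- The domain of the action. -/
def forgetG : PartialAlg c ⥤ c.E where
  obj A := A.G
  map f := f.g

variable (c) in
/-- The maps of partial algebras whose two components are in `M`. -/
def W : MorphismProperty (PartialAlg c) := fun _ _ f => c.M f.v ∧ c.M f.g

instance _root_.FreeMonadSequence.ConfMnd.isMultiplicative : c.M.IsMultiplicative :=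
  c.hasCompositions.isMultiplicative

instance _root_.FreeMonadSequence.ConfMnd.isStableUnderCobaseChange :
    c.M.IsStableUnderCobaseChange :=
  c.hasPushouts.stable

instance : (W c).IsMultiplicative where
  id_mem _ := ⟨c.M.id_mem _, c.M.id_mem _⟩
  comp_mem _ _ hf hg := ⟨c.M.comp_mem _ _ hf.1 hg.1, c.M.comp_mem _ _ hf.2 hg.2⟩

instance : (W c).RespectsIso :=
  MorphismProperty.RespectsIso.of_respects_arrow_iso _ fun _ _ e h =>
    ⟨(c.M.arrow_mk_iso_iff ((forgetV c).mapArrow.mapIso e)).1 h.1,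
      (c.M.arrow_mk_iso_iff ((forgetG c).mapArrow.mapIso e)).1 h.2⟩

/-! ### Colimits of chains of partial algebras -/

section Colimits

variable {J : Type w} [LinearOrder J] [WellFoundedLT J] [Nonempty J] [NoMaxOrder J]

/-- The colimit of a chain of partial algebras is computed on underlying objects. -/
theorem exists_chainCocone (hJ : Ordinal.type (α := J) (· < ·) ≤ κ.ord) (D : J ⥤ PartialAlg c)
    (hV : IsChain c.M (D ⋙ forgetV c)) (hG : IsChain c.M (D ⋙ forgetG c))
    {V G : c.E} (v : ∀ k, (D.obj k).V ⟶ V) (g : ∀ k, (D.obj k).G ⟶ G)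
    (hv : ∀ {k l : J} (f : k ⟶ l), (D.map f).v ≫ v l = v k)
    (hg : ∀ {k l : J} (f : k ⟶ l), (D.map f).g ≫ g l = g k)
    (lV : IsColimit (Cocone.mk (F := D ⋙ forgetV c) V
      { app := v, naturality := fun _ _ f => (hv f).trans (Category.comp_id _).symm }))
    (lG : IsColimit (Cocone.mk (F := D ⋙ forgetG c) G
      { app := g, naturality := fun _ _ f => (hg f).trans (Category.comp_id _).symm })) :
    ∃ (s : Cocone D), Nonempty (IsColimit s) ∧ Nonempty (IsColimit ((forgetV c).mapCocone s)) ∧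
      Nonempty (IsColimit ((forgetG c).mapCocone s)) := by
  have eV : ∀ {X : c.E} {x y : V ⟶ X}, (∀ k, v k ≫ x = v k ≫ y) → x = y :=
    fun h => lV.hom_ext h
  have eG : ∀ {X : c.E} {x y : G ⟶ X}, (∀ k, g k ≫ x = g k ≫ y) → x = y :=
    fun h => lG.hom_ext h
  have dV : ∀ {X : c.E} (x : ∀ k, (D.obj k).V ⟶ X)
      (_ : ∀ {k l : J} (f : k ⟶ l), (D.map f).v ≫ x l = x k),
      ∃ y : V ⟶ X, ∀ k, v k ≫ y = x k := fun {X} x hx =>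
    ⟨lV.desc (Cocone.mk X
      { app := x, naturality := fun _ _ f => (hx f).trans (Category.comp_id _).symm }),
      fun k => lV.fac _ k⟩
  have dG : ∀ {X : c.E} (x : ∀ k, (D.obj k).G ⟶ X)
      (_ : ∀ {k l : J} (f : k ⟶ l), (D.map f).g ≫ x l = x k),
      ∃ y : G ⟶ X, ∀ k, g k ≫ y = x k := fun {X} x hx =>
    ⟨lG.desc (Cocone.mk X
      { app := x, naturality := fun _ _ f => (hx f).trans (Category.comp_id _).symm }),
      fun k => lG.fac _ k⟩
  obtain ⟨i, hi⟩ := dV (fun k => (D.obj k).i ≫ g k) (fun f => by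
    rw [← reassoc_of% (D.map f).i_g, hg])
  have hj' : ∀ {k l : J} (f : k ⟶ l), (D.map f).g ≫ (D.obj l).j ≫ c.F.map (v l) =
      (D.obj k).j ≫ c.F.map (v k) := fun f => by
    rw [← reassoc_of% (D.map f).j_F, ← Functor.map_comp, hv]
  obtain ⟨a, ha⟩ := dG (fun k => (D.obj k).a ≫ v k) (fun f => by
    rw [← reassoc_of% (D.map f).a_v, hv])
  let t : Cocone (D ⋙ forgetG c) := Cocone.mk (c.F.obj V)
    { app := fun k => (D.obj k).j ≫ c.F.map (v k)
      naturality := fun _ _ f => (hj' f).trans (Category.comp_id _).symm }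
  -- `F` need not preserve this colimit. Still `j` is in `M`, being induced by the cocone of the
  -- maps `j_k ≫ F (v k)`, which are in `M`.
  obtain ⟨j, hj, hjM⟩ : ∃ j : G ⟶ c.F.obj V, (∀ k, g k ≫ j = (D.obj k).j ≫ c.F.map (v k)) ∧ c.M j :=
    ⟨lG.desc t, fun k => lG.fac t k, c.hasCompositions.desc_mem J hJ _ hG _ lG t fun k =>
      c.M.comp_mem _ _ (D.obj k).mem
        (c.map_mem _ (c.hasCompositions.coprojection_mem J hJ _ hV _ lV k))⟩
  let Z : PartialAlg c :=
    { V := V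
      G := G
      i := i
      j := j
      a := a
      i_j := eV fun k => by
        have := c.η.naturality (v k)
        simp only [Functor.id_map] at this
        rw [reassoc_of% hi, hj, reassoc_of% (D.obj k).i_j, this]
      i_a := eV fun k => by
        rw [reassoc_of% hi, ha, reassoc_of% (D.obj k).i_a, Category.comp_id]
      mem := hjM }
  let x : ∀ k, D.obj k ⟶ Z := fun k =>
    { v := v k
      g := g k
      i_g := (hi k).symm
      j_F := (hj k).symm
      a_v := (ha k).symm }
  let s : Cocone D :=
    { pt := Z
      ι := { app := x
             naturality := fun k l f =>
              (hom_ext (hv f) (hg f) : D.map f ≫ x l = x k).trans (Category.comp_id _).symm } }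
  refine ⟨s, ⟨IsColimit.ofExistsUnique fun t => ?_⟩, ⟨lV⟩, ⟨lG⟩⟩
  obtain ⟨y, hy⟩ : ∃ y : ∀ k, D.obj k ⟶ t.pt, ∀ k, t.ι.app k = y k := ⟨_, fun k => rfl⟩
  have hy' : ∀ {k l : J} (f : k ⟶ l), D.map f ≫ y l = y k := fun f => by
    rw [← hy, ← hy]
    exact t.w f
  obtain ⟨y₁, h₁⟩ := dV (fun k => (y k).v) (fun f => congrArg Hom.v (hy' f))
  obtain ⟨y₂, h₂⟩ := dG (fun k => (y k).g) (fun f => congrArg Hom.g (hy' f))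
  let d : Z ⟶ t.pt :=
    { v := y₁
      g := y₂
      i_g := eV fun k => by
        change v k ≫ i ≫ y₂ = _
        rw [reassoc_of% hi, h₂, reassoc_of% h₁, (y k).i_g]
      j_F := eG fun k => by
        change g k ≫ j ≫ c.F.map y₁ = _
        rw [reassoc_of% hj, ← Functor.map_comp, h₁, reassoc_of% h₂, (y k).j_F]
      a_v := eG fun k => by
        change g k ≫ a ≫ y₁ = _
        rw [reassoc_of% ha, h₁, reassoc_of% h₂, (y k).a_v] }
  refine ⟨d, fun k => ?_, fun d' hd' => hom_ext (eV fun k => ?_) (eG fun k => ?_)⟩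
  · rw [hy]
    exact hom_ext (h₁ k) (h₂ k)
  · refine Eq.trans ?_ (h₁ k).symm
    rw [← hy, ← hd']
    rfl
  · refine Eq.trans ?_ (h₂ k).symm
    rw [← hy, ← hd']
    rfl

end Colimits

theorem hasColimit_and_preserves {J : Type w} [LinearOrder J] [WellFoundedLT J] [Nonempty J]
    [NoMaxOrder J] (hJ : Ordinal.type (α := J) (· < ·) ≤ κ.ord) (D : J ⥤ PartialAlg c)
    (hV : IsChain c.M (D ⋙ forgetV c)) (hG : IsChain c.M (D ⋙ forgetG c)) :
    HasColimit D ∧ PreservesColimit D (forgetV c) ∧ PreservesColimit D (forgetG c) := by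
  have := c.hasCompositions.hasColimit J hJ _ hV
  have := c.hasCompositions.hasColimit J hJ _ hG
  obtain ⟨s, ⟨l⟩, ⟨lV⟩, ⟨lG⟩⟩ := exists_chainCocone hJ D hV hG
    (colimit.ι (D ⋙ forgetV c)) (colimit.ι (D ⋙ forgetG c))
    (fun f => colimit.w (D ⋙ forgetV c) f) (fun f => colimit.w (D ⋙ forgetG c) f)
    (colimit.isColimit (D ⋙ forgetV c)) (colimit.isColimit (D ⋙ forgetG c))
  exact ⟨⟨⟨⟨_, l⟩⟩⟩, preservesColimit_of_preserves_colimit_cocone l lV,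
    preservesColimit_of_preserves_colimit_cocone l lG⟩

/-- The two forgetful functors must be treated together: a colimit of partial algebras is known to
be computed componentwise only when both underlying diagrams are chains. -/
theorem isChain_forget {J : Type w} [LinearOrder J] [WellFoundedLT J]
    (hJ : Ordinal.type (α := J) (· < ·) ≤ κ.ord) {D : J ⥤ PartialAlg c} (hD : IsChain (W c) D) :
    IsChain c.M (D ⋙ forgetV c) ∧ IsChain c.M (D ⋙ forgetG c) := by
  have h := IsChain.comp_of_preserves (W := W c) (M := c.M) (κ := κ)
    (fun b : Bool => bif b then forgetV c else forgetG c)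
    (by rintro (_ | _) X Y f hf; exacts [hf.2, hf.1])
    (by
      intro J _ _ _ _ hJ D hD
      obtain ⟨-, h₁, h₂⟩ := hasColimit_and_preserves hJ D (hD true) (hD false)
      rintro (_ | _)
      exacts [h₂, h₁]) J hJ D hD
  exact ⟨h true, h false⟩

theorem hasChainColimits : HasChainColimits (W c) κ where
  hasColimit J _ _ _ _ hJ D hD := by
    obtain ⟨hV, hG⟩ := isChain_forget hJ hD
    exact (hasColimit_and_preserves hJ D hV hG).1
  coprojection_mem J _ _ _ _ hJ D hD s hs j := by
    obtain ⟨hV, hG⟩ := isChain_forget hJ hD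
    obtain ⟨-, _, _⟩ := hasColimit_and_preserves hJ D hV hG
    exact ⟨c.hasCompositions.coprojection_mem J hJ _ hV _ (isColimitOfPreserves (forgetV c) hs) j,
      c.hasCompositions.coprojection_mem J hJ _ hG _ (isColimitOfPreserves (forgetG c) hs) j⟩

/-! #### The step -/

section Step

/-- `s : A ⟶ B` exhibits `B` as obtained from `A` by freely adjoining the values of the action
on `F V`. -/
structure Step {A B : PartialAlg c} (s : A ⟶ B) where
  /-- The action of `F V`. -/
  σ : c.F.obj A.V ⟶ B.V
  /-- The inclusion of `F V` in the domain of the action. -/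
  ρ : c.F.obj A.V ⟶ B.G
  isPushout_V : IsPushout A.j A.a σ s.v
  isPushout_G : IsPushout s.v (c.η.app A.V) B.i ρ
  ρ_j : ρ ≫ B.j = c.F.map s.v
  ρ_a : ρ ≫ B.a = σ
  j_ρ : A.j ≫ ρ = s.g

/-- Take `V' = F V ⊔_G V` and `G' = V' ⊔_V F V`. The new action is the identity on `V'` and `σ` on
`F V`; these agree on `V` since `i ≫ j = η` and `i ≫ a = 𝟙`. The new `j` is a Leibniz map. -/
theorem exists_step (A : PartialAlg c) : ∃ (B : PartialAlg c) (s : A ⟶ B), Nonempty (Step s) := by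
  have := c.hasPushouts.hasPushout A.j A.a A.mem
  obtain ⟨V, σ, v, hV⟩ : ∃ (V : c.E) (σ : c.F.obj A.V ⟶ V) (v : A.V ⟶ V), IsPushout A.j A.a σ v :=
    ⟨_, _, _, IsPushout.of_hasPushout _ _⟩
  have hv : c.M v := c.M.of_isPushout hV.flip A.mem
  have hσ : c.η.app A.V ≫ σ = v := by
    rw [← A.i_j, Category.assoc, hV.w, reassoc_of% A.i_a]
  have := c.hasPushouts.hasPushout v (c.η.app A.V) hv
  obtain ⟨G, i, ρ, hG⟩ : ∃ (G : c.E) (i : V ⟶ G) (ρ : c.F.obj A.V ⟶ G),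
    IsPushout v (c.η.app A.V) i ρ := ⟨_, _, _, IsPushout.of_hasPushout _ _⟩
  let B : PartialAlg c :=
    { V := V
      G := G
      i := i
      j := hG.desc (c.η.app V) (c.F.map v) (c.η.naturality v)
      a := hG.desc (𝟙 _) σ (by rw [hσ, Category.comp_id])
      i_j := by simp
      i_a := by simp
      mem := c.leibnizClosed _ hv _ _ _ }
  let s : A ⟶ B :=
    { v := v
      g := A.j ≫ ρ
      i_g := by
        rw [reassoc_of% A.i_j]
        exact hG.w.symm
      j_F := by simp [B]
      a_v := by simpa [B] using hV.w.symm }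
  exact ⟨B, s, ⟨⟨σ, ρ, hV, hG, by simp [B, s], by simp [B], rfl⟩⟩⟩

variable {A B : PartialAlg c} {s : A ⟶ B}

/-- The first component is a pushout of `A.j`; the second is `A.j` followed by a pushout of the
first. -/
theorem Step.mem (h : Step s) : W c s := by
  have hv : c.M s.v := c.M.of_isPushout h.isPushout_V.flip A.mem
  refine ⟨hv, ?_⟩
  rw [← h.j_ρ]
  exact c.M.comp_mem _ _ A.mem (c.M.of_isPushout h.isPushout_G.flip hv)

/-- A step is determined up to isomorphism. -/
def Step.ofIso (h : Step s) {A' B' : PartialAlg c} {s' : A' ⟶ B'} (e : A ≅ A') (e' : B ≅ B')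
    (w : e.hom ≫ s' = s ≫ e'.hom) : Step s' :=
  have wv : e.hom.v ≫ s'.v = s.v ≫ e'.hom.v := congrArg Hom.v w
  have wg : e.hom.g ≫ s'.g = s.g ≫ e'.hom.g := congrArg Hom.g w
  have c₁ : e.inv.v ≫ e.hom.v = 𝟙 _ := congrArg Hom.v e.inv_hom_id
  have c₂ : e.hom.v ≫ e.inv.v = 𝟙 _ := congrArg Hom.v e.hom_inv_id
  have c₃ : e.inv.g ≫ e.hom.g = 𝟙 _ := congrArg Hom.g e.inv_hom_id
  have c₄ : c.F.map e.hom.v ≫ c.F.map e.inv.v = 𝟙 _ := by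
    rw [← Functor.map_comp, c₂, c.F.map_id]
  have c₅ : ∀ {X : c.E} (x : c.F.obj A.V ⟶ X),
      x = c.F.map e.hom.v ≫ c.F.map e.inv.v ≫ x := fun x => by rw [reassoc_of% c₄]
  { σ := c.F.map e.inv.v ≫ h.σ ≫ e'.hom.v
    ρ := c.F.map e.inv.v ≫ h.ρ ≫ e'.hom.g
    isPushout_V := IsPushout.of_iso h.isPushout_V ((forgetG c).mapIso e)
      (c.F.mapIso ((forgetV c).mapIso e)) ((forgetV c).mapIso e) ((forgetV c).mapIso e')
      e.hom.j_F e.hom.a_v (c₅ _) wv.symm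
    isPushout_G := IsPushout.of_iso h.isPushout_G ((forgetV c).mapIso e)
      ((forgetV c).mapIso e') (c.F.mapIso ((forgetV c).mapIso e)) ((forgetG c).mapIso e')
      wv.symm (c.η.naturality e.hom.v).symm e'.hom.i_g (c₅ _)
    ρ_j := by
      rw [Category.assoc, Category.assoc, ← e'.hom.j_F, reassoc_of% h.ρ_j, ← Functor.map_comp,
        ← wv, ← Functor.map_comp, reassoc_of% c₁]
    ρ_a := by rw [Category.assoc, Category.assoc, ← e'.hom.a_v, reassoc_of% h.ρ_a]
    j_ρ := by
      rw [reassoc_of% e.inv.j_F, reassoc_of% h.j_ρ, ← wg, reassoc_of% c₃] }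

end Step

/-! #### The induction principle for the free algebra sequence -/

/-- A property of partial algebras under `A₀` that holds for all stages of the free algebra
sequence starting at `A₀`. -/
structure StageClosed {A₀ : PartialAlg c} (Q : ∀ B : PartialAlg c, (A₀ ⟶ B) → Prop) : Prop where
  start : ∀ {B : PartialAlg c} (f : A₀ ⟶ B), IsIso f → Q B f
  step : ∀ {B B' : PartialAlg c} (f : A₀ ⟶ B) (s : B ⟶ B'), Step s → Q B f → Q B' (f ≫ s)
  colimit : ∀ (J : Type w) [LinearOrder J] [WellFoundedLT J] [Nonempty J] [NoMaxOrder J],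
    Ordinal.type (α := J) (· < ·) ≤ κ.ord → ∀ D : J ⥤ PartialAlg c,
      IsChain c.M (D ⋙ forgetV c) → IsChain c.M (D ⋙ forgetG c) →
      ∀ (Z : PartialAlg c) (x : D ⟶ (Functor.const J).obj Z),
      IsColimit ((forgetV c).mapCocone ⟨Z, x⟩) → IsColimit ((forgetG c).mapCocone ⟨Z, x⟩) →
      ∀ f : ∀ j, A₀ ⟶ D.obj j, (∀ {i j : J} (u : i ⟶ j), f i ≫ D.map u = f j) →
        (∀ j, Q (D.obj j) (f j)) → ∀ e : A₀ ⟶ Z, (∀ j, f j ≫ x.app j = e) → Q Z e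

/-- If the successor maps of a chain of shape `κ` are steps, then `j` is invertible for the
colimit. -/
theorem isIso_j_of_isColimit {J : Type w} [LinearOrder J]
    [WellFoundedLT J] [NoMaxOrder J] [SuccOrder J]
    (hJ : Ordinal.type (α := J) (· < ·) = κ.ord) {D : J ⥤ PartialAlg c}
    (hV : IsChain c.M (D ⋙ forgetV c)) {s : Cocone D}
    (lV : IsColimit ((forgetV c).mapCocone s)) (lG : IsColimit ((forgetG c).mapCocone s))
    (h : ∀ j : J, Step (D.map (homOfLE (Order.le_succ j)))) : IsIso s.pt.j := by
  have hpres := c.preservesTransfiniteComposition J hJ _ hV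
  have lF := isColimitOfPreserves c.F lV
  obtain ⟨x, hx⟩ : ∃ x : ∀ k, D.obj k ⟶ s.pt, ∀ k, s.ι.app k = x k := ⟨_, fun k => rfl⟩
  have hx' : ∀ {k l : J} (f : k ⟶ l), D.map f ≫ x l = x k := fun f => by
    rw [← hx, ← hx]
    exact s.w f
  have hxv : ∀ {k l : J} (f : k ⟶ l), (D.map f).v ≫ (x l).v = (x k).v :=
    fun f => congrArg Hom.v (hx' f)
  have hxg : ∀ {k l : J} (f : k ⟶ l), (D.map f).g ≫ (x l).g = (x k).g :=
    fun f => congrArg Hom.g (hx' f)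
  have eG : ∀ {X : c.E} {a b : s.pt.G ⟶ X}, (∀ k, (x k).g ≫ a = (x k).g ≫ b) → a = b :=
    fun h => lG.hom_ext fun k => by
      have := h k
      rw [← hx] at this
      exact this
  have eF : ∀ {X : c.E} {a b : c.F.obj s.pt.V ⟶ X},
      (∀ k, c.F.map (x k).v ≫ a = c.F.map (x k).v ≫ b) → a = b :=
    fun h => lF.hom_ext fun k => by
      have := h k
      rw [← hx] at this
      exact this
  -- Naturality of `ρ_k : F V_k ⟶ G_{k+1}` in `k`. For `i < j`, factor through `i + 1` and use `ρ_j`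
  -- and `j_ρ`: `ρ` followed by `j`, and `j` followed by `ρ`, are the connecting maps.
  have nat : ∀ (i j : J) (f : i ⟶ j), c.F.map (D.map f).v ≫ (h j).ρ =
      (h i).ρ ≫ (D.map (homOfLE (Order.succ_le_succ (leOfHom f)))).g := by
    intro i j f
    obtain hij | hij := (leOfHom f).eq_or_lt
    · subst hij
      obtain rfl : f = 𝟙 _ := Subsingleton.elim _ _
      have e : homOfLE (Order.succ_le_succ (leOfHom (𝟙 i))) = 𝟙 _ := rfl
      rw [e, D.map_id, D.map_id, id_v, id_g, c.F.map_id, Category.id_comp, Category.comp_id]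
    have e₁ : D.map f =
        D.map (homOfLE (Order.le_succ i)) ≫ D.map (homOfLE (Order.succ_le_of_lt hij)) := by
      rw [← Functor.map_comp]
      rfl
    have e₂ : D.map (homOfLE (Order.succ_le_succ (leOfHom f))) =
        D.map (homOfLE (Order.succ_le_of_lt hij)) ≫ D.map (homOfLE (Order.le_succ j)) := by
      rw [← Functor.map_comp]
      rfl
    rw [e₁, e₂, comp_v, comp_g, Functor.map_comp, ← (h i).ρ_j, Category.assoc, Category.assoc,
      reassoc_of% (D.map (homOfLE (Order.succ_le_of_lt hij))).j_F, (h j).j_ρ]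
  -- The inverse of `j`: since `F` preserves the colimit, it may be defined on each `F V_k`, by
  -- passing to `G_{k+1}` and then to the colimit.
  obtain ⟨d, hd⟩ : ∃ d : c.F.obj s.pt.V ⟶ s.pt.G,
      ∀ k, c.F.map (x k).v ≫ d = (h k).ρ ≫ (x (Order.succ k)).g := by
    let t : Cocone ((D ⋙ forgetV c) ⋙ c.F) := Cocone.mk s.pt.G
      { app := fun k => (h k).ρ ≫ (x (Order.succ k)).g
        naturality := fun k l f => by
          have : c.F.map (D.map f).v ≫ (h l).ρ ≫ (x (Order.succ l)).g =
              (h k).ρ ≫ (x (Order.succ k)).g := by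
            rw [reassoc_of% nat k l f, hxg]
          exact this.trans (Category.comp_id _).symm }
    refine ⟨lF.desc t, fun k => ?_⟩
    rw [← hx]
    exact lF.fac t k
  refine ⟨d, eG fun k => ?_, eF fun k => ?_⟩
  · rw [← reassoc_of% (x k).j_F, hd, reassoc_of% (h k).j_ρ, hxg, Category.comp_id]
  · rw [reassoc_of% hd, ← (x (Order.succ k)).j_F, reassoc_of% (h k).ρ_j, ← Functor.map_comp, hxv,
      Category.comp_id]

/-- The free algebra sequence starting at `A₀` converges after `κ` steps. -/
theorem exists_stage (hκ : Cardinal.aleph0 ≤ κ) (A₀ : PartialAlg c) :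
    ∃ (Z : PartialAlg c) (e : A₀ ⟶ Z), IsIso Z.j ∧
      ∀ Q : ∀ B : PartialAlg c, (A₀ ⟶ B) → Prop, StageClosed Q → Q Z e := by
  let J := κ.ord.ToType
  have : NoMaxOrder J := Cardinal.noMaxOrder hκ
  have hJ : Ordinal.type (α := J) (· < ·) = κ.ord := Ordinal.type_toType _
  have : Nonempty J := by
    rw [← Ordinal.type_ne_zero_iff_nonempty (r := ((· < ·) : J → J → Prop)), hJ, Ne,
      Cardinal.ord_eq_zero]
    exact (Cardinal.aleph0_pos.trans_le hκ).ne'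
  let _ : OrderBot J := WellFoundedLT.toOrderBot J
  let _ : SuccOrder J := SuccOrder.ofLinearWellFoundedLT J
  choose S s hs using exists_step (c := c)
  obtain ⟨D, hD, ⟨e₀⟩, hsucc⟩ := exists_iteration A₀ S s J hasChainColimits
    (fun A => (hs A).some.mem) hJ.le
  -- The iteration yields each successor map only up to isomorphism with a chosen step.
  have hstep : ∀ j : J, Step (D.map (homOfLE (Order.le_succ j))) := fun j => by
    choose B e e' he using hsucc j
    exact (hs B).some.ofIso e e' he
  obtain ⟨hV, hG⟩ := isChain_forget hJ.le hD
  obtain ⟨hcol, _, _⟩ := hasColimit_and_preserves hJ.le D hV hG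
  let lV := isColimitOfPreserves (forgetV c) (colimit.isColimit D)
  let lG := isColimitOfPreserves (forgetG c) (colimit.isColimit D)
  refine ⟨colimit D, e₀.hom ≫ colimit.ι D ⊥, isIso_j_of_isColimit hJ hV lV lG hstep,
    fun Q hQ => ?_⟩
  have hcomp : ∀ {i j : J} (u : i ⟶ j),
      (e₀.hom ≫ D.map (homOfLE bot_le)) ≫ D.map u = e₀.hom ≫ D.map (homOfLE bot_le) := fun u => by
    rw [Category.assoc, ← Functor.map_comp]
    rfl
  have key : ∀ j, Q (D.obj j) (e₀.hom ≫ D.map (homOfLE bot_le)) := by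
    intro j
    induction j using SuccOrder.limitRecOn with
    | isMin j hj =>
      obtain rfl := hj.eq_bot
      have e : homOfLE (bot_le : (⊥ : J) ≤ ⊥) = 𝟙 _ := rfl
      refine hQ.start _ ?_
      rw [e, D.map_id]
      infer_instance
    | succ j hj ih =>
      have h := hQ.step _ _ (hstep j) ih
      rwa [hcomp] at h
    | isSuccLimit m hm ih =>
      have hne : Nonempty (Set.Iio m) := by
        obtain ⟨a, ha⟩ := not_isMin_iff.1 hm.1
        exact ⟨⟨a, ha⟩⟩
      have hmax : NoMaxOrder (Set.Iio m) := hm.2.noMaxOrder_Iio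
      have := hV.continuous
      have := hG.continuous
      exact hQ.colimit (Set.Iio m) ((type_Iio_le m).trans hJ.le)
        ((Set.principalSegIio m).monotone.functor ⋙ D) (hV.restrict m) (hG.restrict m) (D.obj m)
        ((Set.principalSegIio m).cocone D).ι
        ((D ⋙ forgetV c).isColimitOfIsWellOrderContinuous m hm)
        ((D ⋙ forgetG c).isColimitOfIsWellOrderContinuous m hm)
        (fun j => e₀.hom ≫ D.map (homOfLE bot_le)) (fun u => hcomp _)
        (fun j => ih j.1 j.2) _ (fun j => hcomp _)
  -- The limit clause is used once more, for the whole chain of length `κ`.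
  refine hQ.colimit J hJ.le D hV hG (colimit D) (colimit.cocone D).ι lV lG
      (fun j => e₀.hom ≫ D.map (homOfLE bot_le)) hcomp key _ (fun j => ?_)
  rw [Category.assoc]
  exact congrArg _ (colimit.w D _)

end PartialAlg

end FreeMonadSequence

namespace FreeMonadSequence

variable {κ : Cardinal.{w}}

theorem noMaxOrder_and_nonempty (hκ : Cardinal.aleph0 ≤ κ) {J : Type w} [LinearOrder J]
    [WellFoundedLT J] (hJ : Ordinal.type (α := J) (· < ·) = κ.ord) :
    NoMaxOrder J ∧ Nonempty J := by
  refine ⟨Ordinal.isSuccPrelimit_type_lt_iff.1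
    (hJ ▸ (Cardinal.isSuccLimit_ord hκ).isSuccPrelimit), ?_⟩
  rw [← Ordinal.type_ne_zero_iff_nonempty (r := ((· < ·) : J → J → Prop)), hJ, Ne,
    Cardinal.ord_eq_zero]
  exact (Cardinal.aleph0_pos.trans_le hκ).ne'

/-! ### Universal property of the free algebra sequence -/

/-- A functor `P` preserving the relevant colimits of the configuration `c`, together with the
structure of a map of pointed endofunctors. The target is not required to be a configuration. -/
structure Realization (c : ConfMnd.{w, v, u} κ) {E₂ : Type u₂} [Category.{v₂} E₂]
    {F₂ : E₂ ⥤ E₂} (η₂ : 𝟭 E₂ ⟶ F₂) where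
  P : c.E ⥤ E₂
  φ : c.F ⋙ P ≅ P ⋙ F₂
  unit : ∀ X, P.map (c.η.app X) ≫ φ.hom.app X = η₂.app (P.obj X)
  preservesPushouts : ∀ ⦃A B C : c.E⦄ (f : A ⟶ C) (g : A ⟶ B), c.M f →
    PreservesColimit (span f g) P
  preservesChains : ∀ (J : Type w) [LinearOrder J] [WellFoundedLT J] [Nonempty J] [NoMaxOrder J],
    Ordinal.type (α := J) (· < ·) ≤ κ.ord → ∀ D : J ⥤ c.E, IsChain c.M D → PreservesColimit D P

namespace PartialAlg

variable {c : ConfMnd.{w, v, u} κ}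

/-- The partial algebra `Z` under `A₀` satisfies all properties of the stages of the free algebra
sequence starting at `A₀`. -/
def IsStage {A₀ Z : PartialAlg c} (e : A₀ ⟶ Z) : Prop :=
  ∀ Q : ∀ B : PartialAlg c, (A₀ ⟶ B) → Prop, StageClosed Q → Q Z e

theorem stageClosed_W (A₀ : PartialAlg c) : StageClosed (fun B (e : A₀ ⟶ B) => W c e) := by
  refine ⟨?_, ?_, ?_⟩
  · intro B f hf
    exact (W c).of_isIso f
  · intro B B' f s hs hf
    exact (W c).comp_mem _ _ hf hs.mem
  · intro J _ _ hne _ hJ D hV hG Z x lV lG f hf hQ e he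
    let j := Classical.arbitrary J
    rw [← he j]
    exact (W c).comp_mem _ _ (hQ j)
      ⟨c.hasCompositions.coprojection_mem J hJ _ hV _ lV j,
        c.hasCompositions.coprojection_mem J hJ _ hG _ lG j⟩

theorem IsStage.mem {A₀ Z : PartialAlg c} {e : A₀ ⟶ Z} (he : IsStage e) : W c e :=
  he _ (stageClosed_W A₀)

variable {E₂ : Type u₂} [Category.{v₂} E₂] {F₂ : E₂ ⥤ E₂} {η₂ : 𝟭 E₂ ⟶ F₂} (R : Realization c η₂)

/-- `f` is compatible with the partial action on `A` and the action `b` on `B`. -/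
def IsAlgMap (A : PartialAlg c) {B : E₂} (b : F₂.obj B ⟶ B) (f : R.P.obj A.V ⟶ B) : Prop :=
  R.P.map A.j ≫ R.φ.hom.app A.V ≫ F₂.map f ≫ b = R.P.map A.a ≫ f

variable {R}

theorem IsAlgMap.comp {A A' : PartialAlg c} {B : E₂} {b : F₂.obj B ⟶ B} {f : R.P.obj A'.V ⟶ B}
    (hf : A'.IsAlgMap R b f) (e : A ⟶ A') : A.IsAlgMap R b (R.P.map e.v ≫ f) := by
  unfold IsAlgMap at *
  have nat := R.φ.hom.naturality e.v
  simp only [Functor.comp_map] at nat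
  rw [← R.P.map_comp_assoc, e.a_v, R.P.map_comp_assoc, ← hf, ← R.P.map_comp_assoc e.g,
    ← e.j_F, F₂.map_comp, R.P.map_comp, Category.assoc, Category.assoc, reassoc_of% nat]

variable (R)

/-- The universal property of the stages of the free algebra sequence. -/
def HasExtensions {A₀ Z : PartialAlg c} (e : A₀ ⟶ Z) : Prop :=
  ∀ {B : E₂} (b : F₂.obj B ⟶ B), η₂.app B ≫ b = 𝟙 B → ∀ f₀ : R.P.obj A₀.V ⟶ B,
    A₀.IsAlgMap R b f₀ → ∃! f : R.P.obj Z.V ⟶ B, Z.IsAlgMap R b f ∧ R.P.map e.v ≫ f = f₀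

theorem HasExtensions.comp {A₀ A₁ A₂ : PartialAlg c} {e₁ : A₀ ⟶ A₁} {e₂ : A₁ ⟶ A₂}
    (h₁ : HasExtensions R e₁) (h₂ : HasExtensions R e₂) : HasExtensions R (e₁ ≫ e₂) := by
  intro B b hb f₀ hf₀
  obtain ⟨f₁, ⟨hf₁, h₁₀⟩, u₁⟩ := h₁ b hb f₀ hf₀
  obtain ⟨f₂, ⟨hf₂, h₂₁⟩, u₂⟩ := h₂ b hb f₁ hf₁
  refine ⟨f₂, ⟨hf₂, ?_⟩, fun g ⟨hg, hg₀⟩ => u₂ g ⟨hg, u₁ _ ⟨hg.comp e₂, ?_⟩⟩⟩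
  · rw [comp_v, Functor.map_comp, Category.assoc, h₂₁, h₁₀]
  · rw [← hg₀, comp_v, Functor.map_comp, Category.assoc]

theorem hasExtensions_of_isIso {A₀ A₁ : PartialAlg c} (e : A₀ ⟶ A₁) [IsIso e] :
    HasExtensions R e := by
  have h₁ : e.v ≫ (inv e).v = 𝟙 _ := congrArg Hom.v (IsIso.hom_inv_id e)
  have h₂ : (inv e).v ≫ e.v = 𝟙 _ := congrArg Hom.v (IsIso.inv_hom_id e)
  intro B b hb f₀ hf₀
  refine ⟨R.P.map (inv e).v ≫ f₀, ⟨hf₀.comp (inv e), ?_⟩, fun g ⟨_, hg⟩ => ?_⟩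
  · rw [← Functor.map_comp_assoc, h₁, R.P.map_id, Category.id_comp]
  · rw [← hg, ← Functor.map_comp_assoc, h₂, R.P.map_id, Category.id_comp]

/-- A compatible map on `V' = F V ⊔_G V` is forced on `V` by `f` and on `F V` by the action of `b`;
the two prescriptions agree on `G` exactly because `f` is compatible with the partial action. -/
theorem Step.hasExtensions {A A' : PartialAlg c} {s : A ⟶ A'} (h : Step s) :
    HasExtensions R s := by
  intro B b hb f hf
  have hv : c.M s.v := h.mem.1
  have := R.preservesPushouts _ A.a A.mem
  have := R.preservesPushouts _ (c.η.app A.V) hv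
  have hV := h.isPushout_V.map R.P
  have hG := h.isPushout_G.map R.P
  have nat := R.φ.hom.naturality s.v
  simp only [Functor.comp_map] at nat
  have hf' : R.P.map A.j ≫ (R.φ.hom.app A.V ≫ F₂.map f ≫ b) = R.P.map A.a ≫ f := hf
  -- Compatibility is tested on the pushout `G' = V' ⊔_V F V`. On `V'` it is automatic because `b`
  -- is unital, so only the condition on `F V` remains.
  have aux : ∀ g : R.P.obj A'.V ⟶ B, R.P.map s.v ≫ g = f →
      (A'.IsAlgMap R b g ↔ R.P.map h.σ ≫ g = R.φ.hom.app A.V ≫ F₂.map f ≫ b) := by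
    intro g hg
    have e₁ : R.P.map h.ρ ≫ R.P.map A'.j ≫ R.φ.hom.app A'.V ≫ F₂.map g ≫ b =
        R.φ.hom.app A.V ≫ F₂.map f ≫ b := by
      rw [← Functor.map_comp_assoc, h.ρ_j, reassoc_of% nat, ← Functor.map_comp_assoc, hg]
    have e₂ : R.P.map h.ρ ≫ R.P.map A'.a ≫ g = R.P.map h.σ ≫ g := by
      rw [← Functor.map_comp_assoc, h.ρ_a]
    refine ⟨fun hA => by rw [← e₂, ← e₁, hA], fun hA => hG.hom_ext ?_ ?_⟩
    · have n₂ := η₂.naturality g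
      simp only [Functor.id_map] at n₂
      rw [← Functor.map_comp_assoc, A'.i_j, reassoc_of% R.unit, ← reassoc_of% n₂, hb,
        Category.comp_id, ← Functor.map_comp_assoc, A'.i_a, R.P.map_id, Category.id_comp]
    · rw [e₁, e₂, hA]
  refine ⟨hV.desc _ f hf', ⟨(aux _ (hV.inr_desc _ _ _)).2 (hV.inl_desc _ _ _),
    hV.inr_desc _ _ _⟩, fun g ⟨hg, hg₀⟩ => hV.hom_ext ?_ ?_⟩
  · rw [(aux g hg₀).1 hg, hV.inl_desc]
  · rw [hg₀, hV.inr_desc]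

/-- At a colimit the extensions over the stages form a cocone by their uniqueness. Compatibility of
the induced map is checked on the stages of `G`, whose colimit is preserved too. -/
theorem IsStage.hasExtensions {A₀ Z : PartialAlg c} {e : A₀ ⟶ Z} (he : IsStage e) :
    HasExtensions R e := by
  refine he (fun _ e => HasExtensions R e) ⟨?_, ?_, ?_⟩
  · intro B f _
    exact hasExtensions_of_isIso R f
  · intro B B' f s hs hf
    exact HasExtensions.comp R hf (hs.hasExtensions R)
  · intro J _ _ hne _ hJ D hV hG Z x lV lG f hf hQ e he B b hb f₀ hf₀
    have := R.preservesChains J hJ _ hV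
    have := R.preservesChains J hJ _ hG
    have lV' := isColimitOfPreserves R.P lV
    have lG' := isColimitOfPreserves R.P lG
    obtain ⟨y, hy⟩ : ∃ y : ∀ k, D.obj k ⟶ Z, ∀ k, x.app k = y k := ⟨_, fun k => rfl⟩
    have eV : ∀ {X : E₂} {a b : R.P.obj Z.V ⟶ X},
        (∀ k, R.P.map (y k).v ≫ a = R.P.map (y k).v ≫ b) → a = b :=
      fun h => lV'.hom_ext fun k => by
        have := h k
        rw [← hy] at this
        exact this
    have eG : ∀ {X : E₂} {a b : R.P.obj Z.G ⟶ X},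
        (∀ k, R.P.map (y k).g ≫ a = R.P.map (y k).g ≫ b) → a = b :=
      fun h => lG'.hom_ext fun k => by
        have := h k
        rw [← hy] at this
        exact this
    choose g hg hu using fun j => hQ j b hb f₀ hf₀
    -- The restriction of the extension at stage `j` is an extension at stage `i`.
    have compat : ∀ {i j : J} (t : i ⟶ j), R.P.map (D.map t).v ≫ g j = g i := fun {i j} t => by
      refine hu i _ ⟨(hg j).1.comp _, ?_⟩
      rw [← Functor.map_comp_assoc, ← comp_v, hf]
      exact (hg j).2
    obtain ⟨d, hd⟩ : ∃ d : R.P.obj Z.V ⟶ B, ∀ k, R.P.map (y k).v ≫ d = g k := by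
      let t : Cocone ((D ⋙ forgetV c) ⋙ R.P) := Cocone.mk B
        { app := g, naturality := fun k l f => (compat f).trans (Category.comp_id _).symm }
      refine ⟨lV'.desc t, fun k => ?_⟩
      rw [← hy]
      exact lV'.fac t k
    have he' : ∀ j, f j ≫ y j = e := fun j => by rw [← hy]; exact he j
    refine ⟨d, ⟨eG fun k => ?_, ?_⟩, fun d' hd' => eV fun k => ?_⟩
    · have h₁ := (hg k).1
      unfold IsAlgMap at h₁
      have nat := R.φ.hom.naturality (y k).v
      simp only [Functor.comp_map] at nat
      rw [← Functor.map_comp_assoc, ← (y k).j_F, Functor.map_comp_assoc, reassoc_of% nat,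
        ← Functor.map_comp_assoc F₂, hd, h₁, ← Functor.map_comp_assoc, ← (y k).a_v,
        Functor.map_comp_assoc, hd]
    · obtain ⟨j⟩ := hne
      rw [← he' j, comp_v, Functor.map_comp_assoc, hd]
      exact (hg j).2
    · rw [hd]
      refine hu k _ ⟨hd'.1.comp _, ?_⟩
      rw [← Functor.map_comp_assoc, ← comp_v, he']
      exact hd'.2

end PartialAlg

/-! ### The configuration of endofunctors -/

namespace ConfMnd

variable (c : ConfMnd.{w, v, u} κ) (K : Type u₁) [Category.{v₁} K]

/-- A colimit of functors is pointwise when the pointwise colimits exist; hence the chain hypothesis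
at every `k`. -/
theorem preservesColimit_evaluation {J : Type w} [LinearOrder J] [WellFoundedLT J] [Nonempty J]
    [NoMaxOrder J] (hJ : Ordinal.type (α := J) (· < ·) ≤ κ.ord) (D : J ⥤ K ⥤ c.E)
    (hD : ∀ k, IsChain c.M (D ⋙ (evaluation K c.E).obj k)) :
    HasColimit D ∧ ∀ k, PreservesColimit D ((evaluation K c.E).obj k) := by
  have : ∀ k, HasColimit (D.flip.obj k) := fun k => c.hasCompositions.hasColimit J hJ _ (hD k)
  exact ⟨inferInstance, inferInstance⟩

variable {K}

/-- Continuity in the functor category does not by itself give pointwise continuity. It does by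
induction on the length, since shorter chains already have pointwise colimits. -/
theorem isChain_evaluation {J : Type w} [LinearOrder J] [WellFoundedLT J]
    (hJ : Ordinal.type (α := J) (· < ·) ≤ κ.ord) {D : J ⥤ K ⥤ c.E}
    (hD : IsChain (c.M.functorCategory K) D) (k : K) :
    IsChain c.M (D ⋙ (evaluation K c.E).obj k) :=
  IsChain.comp_of_preserves (fun k => (evaluation K c.E).obj k) (fun k _ _ _ hf => hf k)
    (fun _ _ _ _ _ hJ D hD => (c.preservesColimit_evaluation K hJ D hD).2) J hJ D hD k

theorem hasPushout_functor {A B C : K ⥤ c.E} (f : A ⟶ C) (g : A ⟶ B)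
    (hf : c.M.functorCategory K f) :
    HasPushout f g ∧ ∀ k, PreservesColimit (span f g) ((evaluation K c.E).obj k) := by
  have : ∀ k, HasColimit ((span f g).flip.obj k) := fun k => by
    have : HasPushout (((evaluation K c.E).obj k).map f) (((evaluation K c.E).obj k).map g) :=
      c.hasPushouts.hasPushout (f.app k) (g.app k) (hf k)
    exact hasColimit_of_iso (spanCompIso ((evaluation K c.E).obj k) f g)
  exact ⟨inferInstanceAs (HasColimit (span f g)), inferInstance⟩

theorem isPushout_app {A B C D : K ⥤ c.E} {f : A ⟶ C} {g : A ⟶ B} {l : C ⟶ D} {r : B ⟶ D}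
    (h : IsPushout f g l r) (hf : c.M.functorCategory K f) (k : K) :
    IsPushout (f.app k) (g.app k) (l.app k) (r.app k) :=
  have := (c.hasPushout_functor f g hf).2 k
  h.map ((evaluation K c.E).obj k)

/-- The configuration of endofunctors of `c.E`, with the endofunctor of postcomposition
with `c.F`. -/
@[reducible]
def endofunctors (hκ : Cardinal.aleph0 ≤ κ) : ConfMnd.{w, max u v, max u v} κ where
  E := c.E ⥤ c.E
  M := c.M.functorCategory c.E
  F := (Functor.whiskeringRight c.E c.E c.E).obj c.F
  η := { app := fun G => Functor.whiskerLeft G c.η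
         naturality := fun _ _ f => NatTrans.ext (funext fun X => c.η.naturality (f.app X)) }
  hasCompositions :=
    { isMultiplicative :=
        { id_mem := fun _ _ => c.M.id_mem _
          comp_mem := fun _ _ hf hg X => c.M.comp_mem _ _ (hf X) (hg X) }
      hasColimit := fun J _ _ _ _ hJ D hD =>
        (c.preservesColimit_evaluation _ hJ D (c.isChain_evaluation hJ hD)).1
      coprojection_mem := fun J _ _ _ _ hJ D hD s hs j X => by
        have hD' := c.isChain_evaluation hJ hD
        have := (c.preservesColimit_evaluation _ hJ D hD').2 X
        exact c.hasCompositions.coprojection_mem J hJ _ (hD' X) _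
          (isColimitOfPreserves ((evaluation c.E c.E).obj X) hs) j
      desc_mem := fun J _ _ _ _ hJ D hD s hs t ht X => by
        have hD' := c.isChain_evaluation hJ hD
        have := (c.preservesColimit_evaluation _ hJ D hD').2 X
        have l := isColimitOfPreserves ((evaluation c.E c.E).obj X) hs
        have h := c.hasCompositions.desc_mem J hJ _ (hD' X) _ l
          (((evaluation c.E c.E).obj X).mapCocone t) (fun j => ht j X)
        have e : (hs.desc t).app X = l.desc (((evaluation c.E c.E).obj X).mapCocone t) :=
          l.hom_ext fun j =>
            (congrArg (fun y => NatTrans.app y X) (hs.fac t j)).trans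
              (l.fac (((evaluation c.E c.E).obj X).mapCocone t) j).symm
        rw [e]
        exact h }
  hasPushouts :=
    { hasPushout := fun f g hf => (c.hasPushout_functor f g hf).1
      stable := ⟨fun {A A' B B' f g f' g'} h hg X => by
        exact c.M.of_isPushout (c.isPushout_app h.flip hg X).flip (hg X)⟩ }
  unit_mem G X := c.unit_mem _
  leibnizClosed X Y D f hf l r h k := by
    have h' := c.isPushout_app h hf k
    have e : ∀ z : D ⟶ Y ⋙ c.F, l ≫ z = Functor.whiskerLeft Y c.η →
        r ≫ z = Functor.whiskerRight f c.F → c.M (z.app k) := by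
      intro z h₁ h₂
      have h₃ : z.app k = h'.desc (c.η.app _) (c.F.map (f.app k)) (c.η.naturality _) :=
        h'.hom_ext
          ((congrArg (fun y => NatTrans.app y k) h₁).trans (h'.inl_desc _ _ _).symm)
          ((congrArg (fun y => NatTrans.app y k) h₂).trans (h'.inr_desc _ _ _).symm)
      rw [h₃]
      exact c.leibnizClosed _ (hf k) _ _ h'
    exact e _ (h.inl_desc _ _ _) (h.inr_desc _ _ _)
  map_mem f hf X := c.map_mem _ (hf X)
  preservesTransfiniteComposition J _ _ hJ D hD := by
    constructor
    intro s hs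
    refine ⟨evaluationJointlyReflectsColimits _ fun X => ?_⟩
    obtain ⟨_, _⟩ := noMaxOrder_and_nonempty hκ hJ
    have hD' := c.isChain_evaluation hJ.le hD
    have := (c.preservesColimit_evaluation _ hJ.le D hD').2 X
    have := c.preservesTransfiniteComposition J hJ _ (hD' X)
    exact isColimitOfPreserves c.F (isColimitOfPreserves ((evaluation c.E c.E).obj X) hs)

end ConfMnd

end FreeMonadSequence

namespace FreeMonadSequence

/-! ### The monad of free algebras -/

variable {E : Type u} [Category.{v} E] {F : E ⥤ E} {η : 𝟭 E ⟶ F}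

/-- A functorial choice of free algebras for the pointed endofunctor `(F, η)`. -/
structure FreeAlgebras (η : 𝟭 E ⟶ F) where
  T : E ⥤ E
  α : ∀ X, F.obj (T.obj X) ⟶ T.obj X
  e : ∀ X, X ⟶ T.obj X
  α_naturality : ∀ {X Y : E} (f : X ⟶ Y), F.map (T.map f) ≫ α Y = α X ≫ T.map f
  e_naturality : ∀ {X Y : E} (f : X ⟶ Y), f ≫ e Y = e X ≫ T.map f
  unit : ∀ X, η.app (T.obj X) ≫ α X = 𝟙 (T.obj X)
  existsUnique : ∀ {X B : E} (b : F.obj B ⟶ B), η.app B ≫ b = 𝟙 B → ∀ f : X ⟶ B,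
    ∃! g : T.obj X ⟶ B, F.map g ≫ b = α X ≫ g ∧ e X ≫ g = f

namespace FreeAlgebras

variable (Φ : FreeAlgebras η)

section

variable {X B : E} (b : F.obj B ⟶ B) (hb : η.app B ≫ b = 𝟙 B) (f : X ⟶ B)

/-- The extension of a map to the free algebra. -/
noncomputable def lift : Φ.T.obj X ⟶ B := (Φ.existsUnique b hb f).choose

theorem lift_alg : F.map (Φ.lift b hb f) ≫ b = Φ.α X ≫ Φ.lift b hb f :=
  (Φ.existsUnique b hb f).choose_spec.1.1

theorem e_lift : Φ.e X ≫ Φ.lift b hb f = f :=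
  (Φ.existsUnique b hb f).choose_spec.1.2

theorem hom_ext (hb : η.app B ≫ b = 𝟙 B) {g h : Φ.T.obj X ⟶ B} (hg : F.map g ≫ b = Φ.α X ≫ g)
    (hh : F.map h ≫ b = Φ.α X ≫ h) (w : Φ.e X ≫ g = Φ.e X ≫ h) : g = h :=
  (Φ.existsUnique b hb (Φ.e X ≫ h)).unique ⟨hg, w⟩ ⟨hh, rfl⟩

end

/-- The multiplication of the monad of free algebras. -/
noncomputable def mul (X : E) : Φ.T.obj (Φ.T.obj X) ⟶ Φ.T.obj X :=
  Φ.lift (Φ.α X) (Φ.unit X) (𝟙 _)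

theorem mul_alg (X : E) : F.map (Φ.mul X) ≫ Φ.α X = Φ.α (Φ.T.obj X) ≫ Φ.mul X :=
  Φ.lift_alg _ _ _

theorem e_mul (X : E) : Φ.e (Φ.T.obj X) ≫ Φ.mul X = 𝟙 _ :=
  Φ.e_lift _ _ _

/-- A composite of algebra maps is an algebra map. -/
theorem alg_comp {A B D : E} {a : F.obj A ⟶ A} {b : F.obj B ⟶ B} {d : F.obj D ⟶ D}
    {f : A ⟶ B} {g : B ⟶ D} (hf : F.map f ≫ b = a ≫ f) (hg : F.map g ≫ d = b ≫ g) :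
    F.map (f ≫ g) ≫ d = a ≫ f ≫ g := by
  rw [F.map_comp, Category.assoc, hg, reassoc_of% hf]

theorem mul_naturality {X Y : E} (f : X ⟶ Y) :
    Φ.T.map (Φ.T.map f) ≫ Φ.mul Y = Φ.mul X ≫ Φ.T.map f :=
  Φ.hom_ext (Φ.α Y) (Φ.unit Y)
    (alg_comp (Φ.α_naturality (Φ.T.map f)) (Φ.mul_alg Y))
    (alg_comp (Φ.mul_alg X) (Φ.α_naturality f)) (by
      rw [← reassoc_of% Φ.e_naturality (Φ.T.map f), e_mul, reassoc_of% Φ.e_mul,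
        Category.comp_id])

/-- Both sides are algebra maps out of a free algebra and agree on generators. For `A = T X` this is
associativity; for general `A` it turns an algebra of `F` into one of the monad. -/
theorem mul_str {A : E} {s : F.obj A ⟶ A} (hs : η.app A ≫ s = 𝟙 A) {a : Φ.T.obj A ⟶ A}
    (ha : F.map a ≫ s = Φ.α A ≫ a) (he : Φ.e A ≫ a = 𝟙 A) :
    Φ.mul A ≫ a = Φ.T.map a ≫ a :=
  Φ.hom_ext s hs (alg_comp (Φ.mul_alg A) ha) (alg_comp (Φ.α_naturality a) ha) (by
    rw [← reassoc_of% Φ.e_naturality a, he, reassoc_of% Φ.e_mul, Category.comp_id])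

theorem map_e_mul (X : E) : Φ.T.map (Φ.e X) ≫ Φ.mul X = 𝟙 _ :=
  Φ.hom_ext (Φ.α X) (Φ.unit X) (alg_comp (Φ.α_naturality (Φ.e X)) (Φ.mul_alg X))
    (by simp) (by rw [← reassoc_of% Φ.e_naturality (Φ.e X), e_mul])

/-- The monad of free algebras. -/
noncomputable def monad : Monad E where
  toFunctor := Φ.T
  η := { app := Φ.e, naturality := fun _ _ f => Φ.e_naturality f }
  μ := { app := Φ.mul, naturality := fun _ _ f => Φ.mul_naturality f }
  assoc X := (Φ.mul_str (Φ.unit X) (Φ.mul_alg X) (Φ.e_mul X)).symm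
  left_unit X := Φ.e_mul X
  right_unit X := Φ.map_e_mul X

/-- The components of the universal map to the monad of free algebras. -/
def ιApp (X : E) : F.obj X ⟶ Φ.T.obj X := F.map (Φ.e X) ≫ Φ.α X

theorem ιApp_naturality {X Y : E} (f : X ⟶ Y) :
    F.map f ≫ Φ.ιApp Y = Φ.ιApp X ≫ Φ.T.map f := by
  rw [ιApp, ιApp, Category.assoc, ← α_naturality, ← Functor.map_comp_assoc, e_naturality,
    Functor.map_comp_assoc]

/-- The universal map to the monad of free algebras. -/
noncomputable def ι : F ⟶ Φ.monad.toFunctor where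
  app := Φ.ιApp
  naturality _ _ f := Φ.ιApp_naturality f

theorem unit_ιApp (X : E) : η.app X ≫ Φ.ιApp X = Φ.e X := by
  have := η.naturality (Φ.e X)
  simp only [Functor.id_map] at this
  rw [ιApp, ← reassoc_of% this, Φ.unit, Category.comp_id]

theorem η_ι : η ≫ Φ.ι = Φ.monad.η :=
  NatTrans.ext (funext fun X => Φ.unit_ιApp X)

/-- The free action is recovered from the monad and `ι`. This makes structure maps of monad
algebras, and monad maps compatible with `ι`, into algebra maps for `F`. -/
theorem ιApp_mul (X : E) : Φ.ιApp (Φ.T.obj X) ≫ Φ.mul X = Φ.α X := by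
  rw [ιApp, Category.assoc, ← mul_alg, ← Functor.map_comp_assoc, e_mul]
  simp

/-- The restriction of an extended map. -/
theorem ιApp_comp {X B : E} {b : F.obj B ⟶ B} {g : Φ.T.obj X ⟶ B}
    (hg : F.map g ≫ b = Φ.α X ≫ g) : Φ.ιApp X ≫ g = F.map (Φ.e X ≫ g) ≫ b := by
  rw [ιApp, Category.assoc, ← hg, ← Functor.map_comp_assoc]

section

variable {Φ} {A : E} {a : Φ.T.obj A ⟶ A}

/-- The structure map of an algebra of the monad is a map of algebras of `F`. -/
theorem str_alg (hm : Φ.mul A ≫ a = Φ.T.map a ≫ a) :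
    F.map a ≫ Φ.ιApp A ≫ a = Φ.α A ≫ a := by
  rw [reassoc_of% Φ.ιApp_naturality a, ← hm, reassoc_of% Φ.ιApp_mul]

theorem str_unit (he : Φ.e A ≫ a = 𝟙 A) : η.app A ≫ Φ.ιApp A ≫ a = 𝟙 A :=
  (Category.assoc _ _ _).symm.trans ((congrArg (· ≫ a) (Φ.unit_ιApp A)).trans he)

/-- Both sides are algebra maps for `F` out of `T A` that restrict to `g` on generators. -/
theorem map_str {B : E} {b : Φ.T.obj B ⟶ B}
    (he : Φ.e A ≫ a = 𝟙 A) (hm : Φ.mul A ≫ a = Φ.T.map a ≫ a)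
    (he' : Φ.e B ≫ b = 𝟙 B) (hm' : Φ.mul B ≫ b = Φ.T.map b ≫ b)
    {g : A ⟶ B} (hg : F.map g ≫ Φ.ιApp B ≫ b = (Φ.ιApp A ≫ a) ≫ g) :
    Φ.T.map g ≫ b = a ≫ g := by
  refine Φ.hom_ext (Φ.ιApp B ≫ b) (str_unit he')
    (alg_comp (Φ.α_naturality g) (str_alg hm')) (alg_comp (str_alg hm) hg) ?_
  rw [← reassoc_of% Φ.e_naturality g, reassoc_of% he, he', Category.comp_id]

end

theorem full : (restrictAlgebra Φ.ι Φ.η_ι).Full where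
  map_surjective {A B} g :=
    ⟨⟨g.hom.f, map_str A.unit A.assoc B.unit B.assoc g.hom.h⟩, rfl⟩

theorem faithful : (restrictAlgebra Φ.ι Φ.η_ι).Faithful where
  map_injective {A B} f g h := by
    ext
    exact congrArg (fun x => x.hom.f) h

/-- A monad structure on `A` is the unique algebra map `T A ⟶ A` extending the identity, so it is
determined by its restriction along `ι`; conversely, every action of `F` yields such a map. -/
theorem bijective : Function.Bijective (restrictAlgebra Φ.ι Φ.η_ι).obj := by
  constructor
  · intro A B h
    have h' : (⟨A.A, Φ.ιApp A.A ≫ A.a⟩ : Endofunctor.Algebra F) = ⟨B.A, Φ.ιApp B.A ≫ B.a⟩ :=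
      congrArg ObjectProperty.FullSubcategory.obj h
    obtain ⟨A, a, hA, hA'⟩ := A
    obtain ⟨B, b, hB, hB'⟩ := B
    dsimp only at h'
    rw [Endofunctor.Algebra.mk.injEq] at h'
    obtain ⟨rfl, h'⟩ := h'
    replace h' := eq_of_heq h'
    change Φ.e A ≫ a = 𝟙 A at hA
    change Φ.e A ≫ b = 𝟙 A at hB
    obtain rfl : a = b := Φ.hom_ext (Φ.ιApp A ≫ a) (str_unit hA) (str_alg hA')
      (by rw [h']; exact str_alg hB') (by rw [hA, hB])
    rfl
  · rintro ⟨⟨A, s⟩, hs⟩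
    dsimp only at hs
    let a : Φ.T.obj A ⟶ A := Φ.lift s hs (𝟙 A)
    have ha : F.map a ≫ s = Φ.α A ≫ a := Φ.lift_alg s hs _
    have he : Φ.e A ≫ a = 𝟙 A := Φ.e_lift s hs _
    refine ⟨{ A := A, a := a, unit := he, assoc := Φ.mul_str hs ha he }, ?_⟩
    have h : Φ.ιApp A ≫ a = s := by
      rw [Φ.ιApp_comp ha, he]
      simp
    change (⟨⟨A, Φ.ιApp A ≫ a⟩, _⟩ : PointedAlgebra η) = _
    congr 2

/-- The data of a monad map extending a map of pointed endofunctors. -/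
theorem exists_monadHom_app (S : E ⥤ E) (e : ∀ X, X ⟶ S.obj X)
    (m : ∀ X, S.obj (S.obj X) ⟶ S.obj X) (σ : ∀ X, F.obj X ⟶ S.obj X)
    (e_nat : ∀ {X Y : E} (f : X ⟶ Y), f ≫ e Y = e X ≫ S.map f)
    (m_nat : ∀ {X Y : E} (f : X ⟶ Y), S.map (S.map f) ≫ m Y = m X ≫ S.map f)
    (σ_nat : ∀ {X Y : E} (f : X ⟶ Y), F.map f ≫ σ Y = σ X ≫ S.map f)
    (assoc : ∀ X, S.map (m X) ≫ m X = m (S.obj X) ≫ m X)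
    (left_unit : ∀ X, e (S.obj X) ≫ m X = 𝟙 _) (right_unit : ∀ X, S.map (e X) ≫ m X = 𝟙 _)
    (hσ : ∀ X, η.app X ≫ σ X = e X) :
    ∃ t : ∀ X, Φ.T.obj X ⟶ S.obj X,
      ((∀ {X Y : E} (f : X ⟶ Y), Φ.T.map f ≫ t Y = t X ≫ S.map f) ∧
        (∀ X, Φ.e X ≫ t X = e X) ∧
        (∀ X, Φ.mul X ≫ t X = (Φ.T.map (t X) ≫ t (S.obj X)) ≫ m X) ∧
        (∀ X, Φ.ιApp X ≫ t X = σ X)) ∧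
      ∀ t' : ∀ X, Φ.T.obj X ⟶ S.obj X, (∀ X, Φ.e X ≫ t' X = e X) →
        (∀ X, Φ.mul X ≫ t' X = (Φ.T.map (t' X) ≫ t' (S.obj X)) ≫ m X) →
        (∀ X, Φ.ιApp X ≫ t' X = σ X) → t' = t := by
  have hS : ∀ X, η.app (S.obj X) ≫ σ (S.obj X) ≫ m X = 𝟙 _ := fun X =>
    (Category.assoc _ _ _).symm.trans ((congrArg (· ≫ m X) (hσ _)).trans (left_unit X))
  have S_alg : ∀ {X Y : E} (f : X ⟶ Y), F.map (S.map f) ≫ σ (S.obj Y) ≫ m Y =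
      (σ (S.obj X) ≫ m X) ≫ S.map f := fun {X Y} f => by
    rw [reassoc_of% σ_nat, m_nat, Category.assoc]
  have S_mul : ∀ X : E, F.map (m X) ≫ σ (S.obj X) ≫ m X =
      (σ (S.obj (S.obj X)) ≫ m (S.obj X)) ≫ m X := fun X => by
    rw [reassoc_of% σ_nat, assoc, Category.assoc]
  -- `S X` is an algebra for `F` via `σ` followed by the multiplication; the monad map is the
  -- extension of the unit of `S`.
  let t : ∀ X, Φ.T.obj X ⟶ S.obj X := fun X => Φ.lift _ (hS X) (e X)
  have t_alg : ∀ X, F.map (t X) ≫ σ (S.obj X) ≫ m X = Φ.α X ≫ t X :=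
    fun X => Φ.lift_alg _ _ _
  have e_t : ∀ X, Φ.e X ≫ t X = e X := fun X => Φ.e_lift _ _ _
  refine ⟨t, ⟨fun {X Y} f => ?_, e_t, fun X => ?_, fun X => ?_⟩, fun t' he hm hι => ?_⟩
  · refine Φ.hom_ext _ (hS Y) (alg_comp (Φ.α_naturality f) (t_alg Y))
      (alg_comp (t_alg X) (S_alg f)) ?_
    rw [← reassoc_of% Φ.e_naturality, e_t, reassoc_of% e_t, e_nat]
  · rw [Category.assoc]
    refine Φ.hom_ext _ (hS X) (alg_comp (Φ.mul_alg X) (t_alg X))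
      (alg_comp (Φ.α_naturality (t X)) (alg_comp (t_alg _) (S_mul X))) ?_
    rw [reassoc_of% Φ.e_mul, ← reassoc_of% Φ.e_naturality (t X), reassoc_of% e_t, left_unit,
      Category.comp_id]
  · rw [Φ.ιApp_comp (t_alg X), e_t, reassoc_of% σ_nat, right_unit, Category.comp_id]
  · funext X
    refine Φ.hom_ext _ (hS X) ?_ (t_alg X) ((he X).trans (e_t X).symm)
    rw [← Φ.ιApp_mul, Category.assoc, hm, ← hι, Category.assoc, Category.assoc,
      reassoc_of% Φ.ιApp_naturality (t' X)]

theorem existsUnique_monadHom (S : Monad E) (σ : F ⟶ S.toFunctor) (hσ : η ≫ σ = S.η) :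
    ∃! θ : Φ.monad ⟶ S, Φ.ι ≫ θ.toNatTrans = σ := by
  obtain ⟨t, ⟨h₁, h₂, h₃, h₄⟩, h₅⟩ := Φ.exists_monadHom_app S.toFunctor (fun X => S.η.app X)
    (fun X => S.μ.app X) (fun X => σ.app X) (fun f => S.η.naturality f)
    (fun f => S.μ.naturality f) (fun f => σ.naturality f) S.assoc S.left_unit S.right_unit
    (fun X => congrArg (fun y => NatTrans.app y X) hσ)
  refine ⟨{ app := t, naturality := fun _ _ f => h₁ f, app_η := h₂, app_μ := h₃ },
    NatTrans.ext (funext h₄), fun θ' hθ' => ?_⟩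
  ext X
  exact congrFun (h₅ (fun X => θ'.app X) θ'.app_η θ'.app_μ
    (fun X => congrArg (fun y => NatTrans.app y X) hθ')) X

theorem isFreeAndAlgebraicallyFree : IsFreeAndAlgebraicallyFree η Φ.monad Φ.ι where
  unit := Φ.η_ι
  free := Φ.existsUnique_monadHom
  full := Φ.full
  faithful := Φ.faithful
  bijective := Φ.bijective

end FreeAlgebras

end FreeMonadSequence

namespace FreeMonadSequence

variable {κ : Cardinal.{w}}

/-! ### The free monad of a configuration -/

namespace ConfMnd

variable (c : ConfMnd.{w, v, u} κ) (hκ : Cardinal.aleph0 ≤ κ)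

/-- The identity functor with the trivial partial action. -/
def start : PartialAlg (c.endofunctors hκ) where
  V := 𝟭 c.E
  G := 𝟭 c.E
  i := 𝟙 (𝟭 c.E)
  j := (c.endofunctors hκ).η.app (𝟭 c.E)
  a := 𝟙 (𝟭 c.E)
  i_j := Category.id_comp _
  i_a := Category.id_comp _
  mem := (c.endofunctors hκ).unit_mem _

/-- The limit of the free algebra sequence starting at the identity functor. -/
noncomputable def free : PartialAlg (c.endofunctors hκ) :=
  (PartialAlg.exists_stage hκ (c.start hκ)).choose

/-- The map from the start of the free algebra sequence to its limit. -/
noncomputable def toFree : c.start hκ ⟶ c.free hκ :=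
  (PartialAlg.exists_stage hκ (c.start hκ)).choose_spec.choose

theorem isIso_free_j : IsIso (c.free hκ).j :=
  (PartialAlg.exists_stage hκ (c.start hκ)).choose_spec.choose_spec.1

theorem isStage_toFree : PartialAlg.IsStage (c.toFree hκ) :=
  (PartialAlg.exists_stage hκ (c.start hκ)).choose_spec.choose_spec.2

/-- The free algebra functor. -/
noncomputable abbrev freeFunctor : c.E ⥤ c.E := (c.free hκ).V

/-- The action on free algebras. -/
noncomputable def freeAct : c.freeFunctor hκ ⋙ c.F ⟶ c.freeFunctor hκ :=
  have := c.isIso_free_j hκ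
  inv (c.free hκ).j ≫ (c.free hκ).a

/-- The inclusion of generators in free algebras. -/
noncomputable def freeUnit : 𝟭 c.E ⟶ c.freeFunctor hκ := (c.toFree hκ).v

theorem freeUnit_mem (X : c.E) : c.M ((c.freeUnit hκ).app X) :=
  (c.isStage_toFree hκ).mem.1 X

theorem j_freeAct (X : c.E) :
    NatTrans.app (c.free hκ).j X ≫ (c.freeAct hκ).app X = NatTrans.app (c.free hκ).a X := by
  have := c.isIso_free_j hκ
  have h : (c.free hκ).j ≫ c.freeAct hκ = (c.free hκ).a := IsIso.hom_inv_id_assoc _ _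
  exact congrArg (fun y => NatTrans.app y X) h

theorem isIso_free_j_app (X : c.E) : IsIso (NatTrans.app (c.free hκ).j X) :=
  have := c.isIso_free_j hκ
  inferInstanceAs (IsIso (((evaluation c.E c.E).obj X).map (c.free hκ).j))

theorem unit_freeAct (X : c.E) :
    c.η.app ((c.freeFunctor hκ).obj X) ≫ (c.freeAct hκ).app X = 𝟙 _ := by
  have h₁ : NatTrans.app (c.free hκ).i X ≫ NatTrans.app (c.free hκ).j X =
      c.η.app ((c.freeFunctor hκ).obj X) :=
    congrArg (fun y => NatTrans.app y X) (c.free hκ).i_j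
  have h₂ : NatTrans.app (c.free hκ).i X ≫ NatTrans.app (c.free hκ).a X = 𝟙 _ :=
    congrArg (fun y => NatTrans.app y X) (c.free hκ).i_a
  rw [← h₁, Category.assoc, j_freeAct]
  exact h₂

variable {c}

/-- Evaluation at `X` followed by a morphism of configurations. -/
def evaluationRealization {d : ConfMnd.{w, v, u} κ} (P : Hom c d) (X : c.E) :
    Realization (c.endofunctors hκ) d.η where
  P := (evaluation c.E c.E).obj X ⋙ P.P
  φ := NatIso.ofComponents (fun G => P.φ.app (G.obj X))
    (fun f => P.φ.hom.naturality (NatTrans.app f X))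
  unit G := P.unit _
  preservesPushouts A B C f g hf := by
    have := (c.hasPushout_functor f g hf).2 X
    have : PreservesColimit (span (((evaluation c.E c.E).obj X).map f)
        (((evaluation c.E c.E).obj X).map g)) P.P :=
      P.preservesPushouts (NatTrans.app f X) (NatTrans.app g X) (hf X)
    have : PreservesColimit (span f g ⋙ (evaluation c.E c.E).obj X) P.P :=
      preservesColimit_of_iso_diagram P.P (spanCompIso ((evaluation c.E c.E).obj X) f g).symm
    exact comp_preservesColimit _ _
  preservesChains J _ _ _ _ hJ D hD := by
    have hD' := c.isChain_evaluation hJ hD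
    have := (c.preservesColimit_evaluation _ hJ D hD').2 X
    have := P.preservesCompositions J hJ _ (hD' X)
    exact comp_preservesColimit _ _

variable (c) in
-- Thus `P (T X)`, with the action transported along `φ`, is the free `d.F`-algebra on `P X`. The
-- proof evaluates the sequence of endofunctors at `X` and then applies `P`.
theorem existsUnique_extension {d : ConfMnd.{w, v, u} κ} (P : Hom c d) (X : c.E) {B : d.E}
    (b : d.F.obj B ⟶ B) (hb : d.η.app B ≫ b = 𝟙 B) (f₀ : P.P.obj X ⟶ B) :
    ∃! f : P.P.obj ((c.freeFunctor hκ).obj X) ⟶ B,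
      P.φ.hom.app ((c.freeFunctor hκ).obj X) ≫ d.F.map f ≫ b =
        P.P.map ((c.freeAct hκ).app X) ≫ f ∧ P.P.map ((c.freeUnit hκ).app X) ≫ f = f₀ := by
  -- At the starting stage the action is defined on generators only, so every map is compatible with
  -- it.
  have h₀ : P.P.map (c.η.app X) ≫ P.φ.hom.app X ≫ d.F.map f₀ ≫ b = P.P.map (𝟙 X) ≫ f₀ := by
    have n := d.η.naturality f₀
    simp only [Functor.id_map] at n
    have := P.unit X
    rw [reassoc_of% this, ← reassoc_of% n, hb, Category.comp_id, P.P.map_id, Category.id_comp]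
  obtain ⟨f, ⟨hf, hf₀⟩, hu⟩ :=
    (c.isStage_toFree hκ).hasExtensions (evaluationRealization hκ P X) b hb f₀ h₀
  have := c.isIso_free_j_app hκ X
  -- Since `j` is invertible, compatibility with the partial action is compatibility with the total
  -- one.
  have key : ∀ g : P.P.obj ((c.freeFunctor hκ).obj X) ⟶ B,
      (c.free hκ).IsAlgMap (evaluationRealization hκ P X) b g ↔
      P.φ.hom.app ((c.freeFunctor hκ).obj X) ≫ d.F.map g ≫ b =
        P.P.map ((c.freeAct hκ).app X) ≫ g := by
    intro g
    rw [← cancel_epi (P.P.map (NatTrans.app (c.free hκ).j X)), ← P.P.map_comp_assoc, j_freeAct]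
    rfl
  exact ⟨f, ⟨(key f).1 hf, hf₀⟩, fun g hg => hu g ⟨(key g).2 hg.1, hg.2⟩⟩

variable (c)

/-- The free algebras of a configuration. -/
@[reducible]
noncomputable def freeAlgebras : FreeAlgebras c.η where
  T := c.freeFunctor hκ
  α X := (c.freeAct hκ).app X
  e X := (c.freeUnit hκ).app X
  α_naturality f := (c.freeAct hκ).naturality f
  e_naturality f := (c.freeUnit hκ).naturality f
  unit := c.unit_freeAct hκ
  existsUnique {X B} b hb f := by
    obtain ⟨g, ⟨h₁, h₂⟩, h₃⟩ := c.existsUnique_extension hκ (Hom.id c) X b hb f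
    refine ⟨g, ⟨(Category.id_comp _).symm.trans h₁, h₂⟩, fun g' hg' =>
      h₃ g' ⟨(Category.id_comp _).trans hg'.1, hg'.2⟩⟩

end ConfMnd

end FreeMonadSequence

namespace FreeMonadSequence

variable {κ : Cardinal.{w}}

/-! ### Functoriality of the free monad -/

namespace ConfMnd

variable {c d : ConfMnd.{w, v, u} κ}

namespace Hom

/-- `f` is a map of algebras over the morphism `P` of configurations. -/
def IsAlgMap (P : Hom c d) {A : c.E} (a : c.F.obj A ⟶ A) {B : d.E} (b : d.F.obj B ⟶ B)
    (f : P.P.obj A ⟶ B) : Prop :=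
  P.φ.hom.app A ≫ d.F.map f ≫ b = P.P.map a ≫ f

variable {P : Hom c d}

theorem IsAlgMap.precomp {A A' : c.E} {a : c.F.obj A ⟶ A} {a' : c.F.obj A' ⟶ A'} {B : d.E}
    {b : d.F.obj B ⟶ B} {f : P.P.obj A ⟶ B} (hf : P.IsAlgMap a b f) {g : A' ⟶ A}
    (hg : c.F.map g ≫ a = a' ≫ g) : P.IsAlgMap a' b (P.P.map g ≫ f) := by
  unfold IsAlgMap at *
  have nat := P.φ.hom.naturality g
  simp only [Functor.comp_map] at nat
  rw [← P.P.map_comp_assoc, ← hg, P.P.map_comp_assoc, ← hf, reassoc_of% nat, d.F.map_comp,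
    Category.assoc]

theorem IsAlgMap.postcomp {A : c.E} {a : c.F.obj A ⟶ A} {B B' : d.E} {b : d.F.obj B ⟶ B}
    {b' : d.F.obj B' ⟶ B'} {f : P.P.obj A ⟶ B} (hf : P.IsAlgMap a b f) {g : B ⟶ B'}
    (hg : d.F.map g ≫ b' = b ≫ g) : P.IsAlgMap a b' (f ≫ g) := by
  unfold IsAlgMap at *
  rw [← reassoc_of% hf, ← hg, d.F.map_comp, Category.assoc]

theorem IsAlgMap.comp {e : ConfMnd.{w, v, u} κ} {Q : Hom d e} {A : c.E} {a : c.F.obj A ⟶ A}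
    {B : d.E} {b : d.F.obj B ⟶ B} {f : P.P.obj A ⟶ B} (hf : P.IsAlgMap a b f) {D : e.E}
    {x : e.F.obj D ⟶ D} {g : Q.P.obj B ⟶ D} (hg : Q.IsAlgMap b x g) :
    (P.comp Q).IsAlgMap a x (Q.P.map f ≫ g) := by
  unfold IsAlgMap at *
  have nat := Q.φ.hom.naturality f
  simp only [Functor.comp_map] at nat
  change (Q.P.map (P.φ.hom.app A) ≫ Q.φ.hom.app (P.P.obj A)) ≫ e.F.map (Q.P.map f ≫ g) ≫ x =
    Q.P.map (P.P.map a) ≫ Q.P.map f ≫ g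
  rw [← Q.P.map_comp_assoc, ← hf, Q.P.map_comp_assoc, Q.P.map_comp_assoc, ← hg,
    Category.assoc, e.F.map_comp_assoc, reassoc_of% nat]

theorem isAlgMap_id {A : c.E} {a : c.F.obj A ⟶ A} : (Hom.id c).IsAlgMap a a (𝟙 A) := by
  change 𝟙 (c.F.obj A) ≫ c.F.map (𝟙 A) ≫ a = a ≫ 𝟙 A
  simp

variable (P) (hκ : Cardinal.aleph0 ≤ κ) (X : c.E)

/-- Naturality of `γ`, its compatibility with multiplications, and functoriality in `P` all reduce
to this uniqueness. -/
theorem hom_ext {B : d.E} {b : d.F.obj B ⟶ B} (hb : d.η.app B ≫ b = 𝟙 B)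
    {f g : P.P.obj ((c.freeFunctor hκ).obj X) ⟶ B}
    (hf : P.IsAlgMap ((c.freeAct hκ).app X) b f) (hg : P.IsAlgMap ((c.freeAct hκ).app X) b g)
    (w : P.P.map ((c.freeUnit hκ).app X) ≫ f = P.P.map ((c.freeUnit hκ).app X) ≫ g) : f = g :=
  (c.existsUnique_extension hκ P X b hb _).unique ⟨hf, w⟩ ⟨hg, rfl⟩

/-- The comparison of free algebras. -/
noncomputable def γApp : P.P.obj ((c.freeFunctor hκ).obj X) ⟶ (d.freeFunctor hκ).obj (P.P.obj X) :=
  (c.existsUnique_extension hκ P X _ (d.unit_freeAct hκ _)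
    ((d.freeUnit hκ).app (P.P.obj X))).choose

theorem γApp_alg :
    P.IsAlgMap ((c.freeAct hκ).app X) ((d.freeAct hκ).app (P.P.obj X)) (P.γApp hκ X) :=
  (c.existsUnique_extension hκ P X _ (d.unit_freeAct hκ _)
    ((d.freeUnit hκ).app (P.P.obj X))).choose_spec.1.1

theorem unit_γApp : P.P.map ((c.freeUnit hκ).app X) ≫ P.γApp hκ X =
    (d.freeUnit hκ).app (P.P.obj X) :=
  (c.existsUnique_extension hκ P X _ (d.unit_freeAct hκ _)
    ((d.freeUnit hκ).app (P.P.obj X))).choose_spec.1.2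

/-- Source and target are both free algebras on `P X`: the source by the universal property relative
to `P`, the target by that of the free algebras of `d`. -/
theorem exists_inverse_γApp : ∃ g : (d.freeFunctor hκ).obj (P.P.obj X) ⟶
    P.P.obj ((c.freeFunctor hκ).obj X), P.γApp hκ X ≫ g = 𝟙 _ ∧ g ≫ P.γApp hκ X = 𝟙 _ := by
  -- The action of `d.F` on `P (T X)`, available because `φ` is invertible.
  let b : d.F.obj (P.P.obj ((c.freeFunctor hκ).obj X)) ⟶ P.P.obj ((c.freeFunctor hκ).obj X) :=
    P.φ.inv.app ((c.freeFunctor hκ).obj X) ≫ P.P.map ((c.freeAct hκ).app X)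
  have φ_b : P.φ.hom.app ((c.freeFunctor hκ).obj X) ≫ b = P.P.map ((c.freeAct hκ).app X) :=
    P.φ.hom_inv_id_app_assoc _ _
  have hb : d.η.app _ ≫ b = 𝟙 (P.P.obj ((c.freeFunctor hκ).obj X)) := by
    have h := P.unit ((c.freeFunctor hκ).obj X)
    have h' : P.P.map (c.η.app ((c.freeFunctor hκ).obj X)) ≫
        P.P.map ((c.freeAct hκ).app X) = 𝟙 _ := by
      rw [← P.P.map_comp, unit_freeAct]
      exact P.P.map_id _
    rw [← φ_b, reassoc_of% h] at h'
    exact h'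
  obtain ⟨g, ⟨hg, hg'⟩, -⟩ := (d.freeAlgebras hκ).existsUnique b hb
    (P.P.map ((c.freeUnit hκ).app X))
  refine ⟨g, P.hom_ext hκ X hb ((P.γApp_alg hκ X).postcomp hg) ?_ ?_,
    (d.freeAlgebras hκ).hom_ext _ (d.unit_freeAct hκ _) ?_ ?_ ?_⟩
  · unfold IsAlgMap
    simpa using φ_b
  · rw [← Category.assoc, unit_γApp, Category.comp_id]
    exact hg'
  · refine FreeAlgebras.alg_comp hg ?_
    rw [← cancel_epi (P.φ.hom.app _), reassoc_of% φ_b]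
    exact P.γApp_alg hκ X
  · simp
  · rw [reassoc_of% hg', unit_γApp, Category.comp_id]

theorem γApp_naturality {X Y : c.E} (f : X ⟶ Y) :
    P.P.map ((c.freeFunctor hκ).map f) ≫ P.γApp hκ Y =
      P.γApp hκ X ≫ (d.freeFunctor hκ).map (P.P.map f) := by
  refine P.hom_ext hκ X (d.unit_freeAct hκ _)
    ((P.γApp_alg hκ Y).precomp ((c.freeAct hκ).naturality f))
    ((P.γApp_alg hκ X).postcomp ((d.freeAct hκ).naturality _)) ?_
  have h₁ := (c.freeUnit hκ).naturality f
  have h₂ := (d.freeUnit hκ).naturality (P.P.map f)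
  simp only [Functor.id_map] at h₁ h₂
  rw [← P.P.map_comp_assoc, ← h₁, P.P.map_comp_assoc, unit_γApp, ← Category.assoc, unit_γApp, h₂]

theorem mul_γApp : P.P.map ((c.freeAlgebras hκ).mul X) ≫ P.γApp hκ X =
    P.γApp hκ ((c.freeFunctor hκ).obj X) ≫ (d.freeFunctor hκ).map (P.γApp hκ X) ≫
      (d.freeAlgebras hκ).mul (P.P.obj X) := by
  refine P.hom_ext hκ _ (d.unit_freeAct hκ _)
    ((P.γApp_alg hκ X).precomp ((c.freeAlgebras hκ).mul_alg X))
    ((P.γApp_alg hκ _).postcomp (FreeAlgebras.alg_comp ((d.freeAct hκ).naturality _)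
      ((d.freeAlgebras hκ).mul_alg _))) ?_
  have h₁ : (c.freeUnit hκ).app ((c.freeFunctor hκ).obj X) ≫ (c.freeAlgebras hκ).mul X = 𝟙 _ :=
    (c.freeAlgebras hκ).e_mul X
  have h₂ : (d.freeUnit hκ).app ((d.freeFunctor hκ).obj (P.P.obj X)) ≫
      (d.freeAlgebras hκ).mul (P.P.obj X) = 𝟙 _ := (d.freeAlgebras hκ).e_mul _
  have h₃ := (d.freeUnit hκ).naturality (P.γApp hκ X)
  simp only [Functor.id_map] at h₃
  have h₄ := P.unit_γApp hκ ((c.freeFunctor hκ).obj X)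
  refine Eq.trans (b := P.γApp hκ X) ?_ ?_
  · refine (P.P.map_comp_assoc _ _ _).symm.trans ?_
    rw [h₁]
    exact (congrArg (· ≫ P.γApp hκ X) (P.P.map_id _)).trans (Category.id_comp _)
  · rw [reassoc_of% h₄, ← reassoc_of% h₃, h₂]
    exact (Category.comp_id _).symm

/-- The strong map of free monads induced by a morphism of configurations. -/
noncomputable def strongMonadMap :
    StrongMonadMap (c.freeAlgebras hκ).monad (d.freeAlgebras hκ).monad P.P where
  γ := NatIso.ofComponents (fun X => ⟨P.γApp hκ X, (P.exists_inverse_γApp hκ X).choose,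
    (P.exists_inverse_γApp hκ X).choose_spec.1, (P.exists_inverse_γApp hκ X).choose_spec.2⟩)
    (fun f => P.γApp_naturality hκ f)
  unit X := P.unit_γApp hκ X
  mul X := P.mul_γApp hκ X

theorem γApp_id : (Hom.id c).γApp hκ X = 𝟙 _ :=
  (Hom.id c).hom_ext hκ X (c.unit_freeAct hκ _) ((Hom.id c).γApp_alg hκ X) isAlgMap_id
    (((Hom.id c).unit_γApp hκ X).trans (Category.comp_id _).symm)

theorem γApp_comp {e : ConfMnd.{w, v, u} κ} (Q : Hom d e) :
    (P.comp Q).γApp hκ X = Q.P.map (P.γApp hκ X) ≫ Q.γApp hκ (P.P.obj X) :=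
  (P.comp Q).hom_ext hκ X (e.unit_freeAct hκ _) ((P.comp Q).γApp_alg hκ X)
    ((P.γApp_alg hκ X).comp (Q.γApp_alg hκ _)) (by
      refine ((P.comp Q).unit_γApp hκ X).trans ?_
      have h : (P.comp Q).P.map ((c.freeUnit hκ).app X) =
        Q.P.map (P.P.map ((c.freeUnit hκ).app X)) := rfl
      have h' := Q.P.map_comp_assoc (P.P.map ((c.freeUnit hκ).app X)) (P.γApp hκ X)
        (Q.γApp hκ (P.P.obj X))
      rw [unit_γApp, unit_γApp] at h'
      exact h')

theorem ι_γApp : P.P.map ((c.freeAlgebras hκ).ιApp X) ≫ P.γApp hκ X =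
    P.φ.hom.app X ≫ (d.freeAlgebras hκ).ιApp (P.P.obj X) := by
  have h : P.φ.hom.app ((c.freeFunctor hκ).obj X) ≫ d.F.map (P.γApp hκ X) ≫
      (d.freeAct hκ).app (P.P.obj X) = P.P.map ((c.freeAct hκ).app X) ≫ P.γApp hκ X :=
    P.γApp_alg hκ X
  have nat := P.φ.hom.naturality ((c.freeUnit hκ).app X)
  simp only [Functor.comp_map, Functor.id_obj] at nat
  change P.P.map (c.F.map ((c.freeUnit hκ).app X) ≫ (c.freeAct hκ).app X) ≫ P.γApp hκ X =
    P.φ.hom.app X ≫ d.F.map ((d.freeUnit hκ).app (P.P.obj X)) ≫ (d.freeAct hκ).app (P.P.obj X)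
  rw [P.P.map_comp_assoc, ← h, reassoc_of% nat, ← d.F.map_comp_assoc]
  have := P.unit_γApp hκ X
  simp only [Functor.id_obj] at this
  rw [this]

end Hom

end ConfMnd

/-- The lift to monads given by free monads. -/
noncomputable def freeMonadLift (hκ : Cardinal.aleph0 ≤ κ) : MonadLift.{w, v, u} κ where
  T c := (c.freeAlgebras hκ).monad
  str P := ConfMnd.Hom.strongMonadMap P hκ
  map_id _ := MndS.Hom.ext rfl (heq_of_eq (StrongMonadMap.ext
    (Iso.ext (NatTrans.ext (funext fun X => ConfMnd.Hom.γApp_id hκ X)))))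
  map_comp P Q := MndS.Hom.ext rfl (heq_of_eq (StrongMonadMap.ext
    (Iso.ext (NatTrans.ext (funext fun X => ConfMnd.Hom.γApp_comp P hκ X Q)))))

end FreeMonadSequence

namespace FreeMonadSequence

variable {κ : Cardinal.{w}}

/-! ### The free monad preserves the class of maps -/

/-- The identity functor as a realization. -/
def Realization.id (c : ConfMnd.{w, v, u} κ) : Realization c c.η where
  P := 𝟭 c.E
  φ := Iso.refl c.F
  unit _ := Category.comp_id _
  preservesPushouts _ _ _ _ _ _ := inferInstance
  preservesChains _ _ _ _ _ _ _ _ := inferInstance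

variable {c : ConfMnd.{w, v, u} κ}

theorem PartialAlg.IsStage.existsUnique {A Z : PartialAlg c} {e : A ⟶ Z} (he : IsStage e)
    {B : c.E} (b : c.F.obj B ⟶ B) (hb : c.η.app B ≫ b = 𝟙 B) (f₀ : A.V ⟶ B)
    (hf₀ : A.j ≫ c.F.map f₀ ≫ b = A.a ≫ f₀) :
    ∃! f : Z.V ⟶ B, Z.j ≫ c.F.map f ≫ b = Z.a ≫ f ∧ e.v ≫ f = f₀ := by
  have key : ∀ (A : PartialAlg c) (f : A.V ⟶ B),
      A.IsAlgMap (Realization.id c) b f ↔ A.j ≫ c.F.map f ≫ b = A.a ≫ f := fun A f => by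
    change A.j ≫ 𝟙 _ ≫ c.F.map f ≫ b = A.a ≫ f ↔ _
    rw [Category.id_comp]
  obtain ⟨f, ⟨h₁, h₂⟩, h₃⟩ := he.hasExtensions (Realization.id c) b hb f₀ ((key A f₀).2 hf₀)
  exact ⟨f, ⟨(key Z f).1 h₁, h₂⟩, fun g hg => h₃ g ⟨(key Z g).2 hg.1, hg.2⟩⟩

/-- The partial algebra obtained from an algebra by extension along a map in `M`. -/
theorem PartialAlg.exists_extension {T V : c.E} {α : c.F.obj T ⟶ T} (hα : c.η.app T ≫ α = 𝟙 T)
    {r : T ⟶ V} (hr : c.M r) : ∃ (A : PartialAlg c) (e : A.V = V) (ρ : c.F.obj T ⟶ A.G),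
      IsPushout r (c.η.app T) (eqToHom e.symm ≫ A.i) ρ ∧
        ρ ≫ A.j = c.F.map (r ≫ eqToHom e.symm) ∧ ρ ≫ A.a = α ≫ r ≫ eqToHom e.symm := by
  have := c.hasPushouts.hasPushout r (c.η.app T) hr
  obtain ⟨G, i, ρ, hG⟩ : ∃ (G : c.E) (i : V ⟶ G) (ρ : c.F.obj T ⟶ G),
    IsPushout r (c.η.app T) i ρ := ⟨_, _, _, IsPushout.of_hasPushout _ _⟩
  have w : r ≫ 𝟙 V = c.η.app T ≫ α ≫ r :=
    (Category.comp_id _).trans (((Category.id_comp r).symm.trans (congrArg (· ≫ r) hα.symm)).trans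
      (Category.assoc _ _ _))
  refine ⟨{ V := V
            G := G
            i := i
            j := hG.desc (c.η.app V) (c.F.map r) (c.η.naturality r)
            a := hG.desc (𝟙 _) (α ≫ r) w
            i_j := by simp
            i_a := by simp
            mem := c.leibnizClosed _ hr _ _ _ }, rfl, ρ, ?_, ?_, ?_⟩
  · simpa using hG
  · simp
  · simp

namespace ConfMnd

variable (hκ : Cardinal.aleph0 ≤ κ)

/-- `T Y` is also obtained from `Y ⊔_X T X` by letting `F` act on the part `T X` as it already does
and completing freely. Then `T f` is, up to isomorphism, the pushout `r` of `f` followed by the map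
from the start of this sequence to its limit, both in `M`. -/
theorem freeFunctor_map_mem {X Y : c.E} (f : X ⟶ Y) (hf : c.M f) :
    c.M ((c.freeFunctor hκ).map f) := by
  let Φ := c.freeAlgebras hκ
  have hpo := c.hasPushouts.hasPushout f (Φ.e X) hf
  obtain ⟨V, l, r, hV⟩ : ∃ (V : c.E) (l : Y ⟶ V) (r : Φ.T.obj X ⟶ V),
    IsPushout f (Φ.e X) l r := ⟨_, _, _, IsPushout.of_hasPushout _ _⟩
  have hr : c.M r := c.M.of_isPushout hV.flip hf
  obtain ⟨A, rfl, ρ, hG, hj, ha⟩ := PartialAlg.exists_extension (Φ.unit X) hr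
  simp only [eqToHom_refl, Category.id_comp, Category.comp_id] at hG hj ha
  obtain ⟨Z, e, hZ, he⟩ := PartialAlg.exists_stage hκ A
  replace he : PartialAlg.IsStage e := he
  -- The domain of the action is a pushout of `A.V` and `F (T X)`. Compatibility is automatic on the
  -- first part by unitality and says on the second that `r ≫ f₀` is an algebra map.
  have alg : ∀ {B : c.E} (b : c.F.obj B ⟶ B), c.η.app B ≫ b = 𝟙 B → ∀ f₀ : A.V ⟶ B,
      c.F.map (r ≫ f₀) ≫ b = Φ.α X ≫ r ≫ f₀ → A.j ≫ c.F.map f₀ ≫ b = A.a ≫ f₀ := by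
    intro B b hb f₀ h
    refine hG.hom_ext ?_ ?_
    · have n := c.η.naturality f₀
      simp only [Functor.id_map] at n
      rw [reassoc_of% A.i_j, reassoc_of% A.i_a, ← reassoc_of% n, hb]
      exact Category.comp_id _
    · rw [reassoc_of% hj, reassoc_of% ha, ← c.F.map_comp_assoc, h]
  -- The total action on the limit of the sequence. What follows shows that the limit has the
  -- universal property of `T Y`: `h` and `g` come from the two universal properties and are
  -- mutually inverse by uniqueness.
  obtain ⟨z, hz⟩ : ∃ z : c.F.obj Z.V ⟶ Z.V, Z.j ≫ z = Z.a := ⟨inv Z.j ≫ Z.a, by simp⟩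
  have hz' : c.η.app Z.V ≫ z = 𝟙 Z.V := by
    have := Z.i_a
    rw [← hz, reassoc_of% Z.i_j] at this
    exact this
  have hez : A.j ≫ c.F.map e.v ≫ z = A.a ≫ e.v := by
    rw [reassoc_of% e.j_F, hz, e.a_v]
  have hrz : c.F.map (r ≫ e.v) ≫ z = Φ.α X ≫ r ≫ e.v := by
    have := congrArg (ρ ≫ ·) hez
    rw [reassoc_of% hj, reassoc_of% ha] at this
    rw [c.F.map_comp, Category.assoc, this]
  obtain ⟨f₀, hl, hr₀⟩ : ∃ f₀ : A.V ⟶ Φ.T.obj Y, l ≫ f₀ = Φ.e Y ∧ r ≫ f₀ = Φ.T.map f :=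
    ⟨hV.desc _ _ (Φ.e_naturality f), hV.inl_desc _ _ _, hV.inr_desc _ _ _⟩
  obtain ⟨h, ⟨h₁, h₂⟩, -⟩ := he.existsUnique (Φ.α Y) (Φ.unit Y) f₀
    (alg _ (Φ.unit Y) _ (by rw [hr₀, Φ.α_naturality]))
  replace h₁ : c.F.map h ≫ Φ.α Y = z ≫ h := by
    rw [← cancel_epi Z.j, h₁, reassoc_of% hz]
  obtain ⟨g, ⟨g₁, g₂⟩, -⟩ := Φ.existsUnique z hz' (l ≫ e.v)
  have hfg : Φ.T.map f ≫ g = r ≫ e.v := by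
    refine Φ.hom_ext z hz' (FreeAlgebras.alg_comp (Φ.α_naturality f) g₁) hrz ?_
    rw [← reassoc_of% Φ.e_naturality f, g₂, reassoc_of% hV.w]
  have hg : h ≫ g = 𝟙 _ := by
    refine (he.existsUnique z hz' e.v hez).unique ⟨?_, ?_⟩ ⟨by simp [hz], by simp⟩
    · rw [FreeAlgebras.alg_comp h₁ g₁, reassoc_of% hz]
    · rw [reassoc_of% h₂]
      refine hV.hom_ext ?_ ?_
      · rw [reassoc_of% hl, g₂]
      · rw [reassoc_of% hr₀, hfg]
  have gh : g ≫ h = 𝟙 _ := by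
    refine Φ.hom_ext _ (Φ.unit Y) (FreeAlgebras.alg_comp g₁ h₁) (by simp) ?_
    rw [reassoc_of% g₂, h₂, hl, Category.comp_id]
  have : IsIso h := ⟨g, hg, gh⟩
  have hT : Φ.T.map f = (r ≫ e.v) ≫ h := by
    rw [← hr₀, Category.assoc, h₂]
  change c.M (Φ.T.map f)
  rw [hT]
  exact (c.M.cancel_right_of_respectsIso _ _).2 (c.M.comp_mem _ _ hr he.mem.1)

end ConfMnd

/-! ### Preservation of colimits -/

/-- A pointwise colimit of functors preserving the colimit of `D` preserves it. -/
theorem preservesColimit_of_pointwise {C : Type u₁} [Category.{v₁} C] {E : Type u₂}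
    [Category.{v₂} E] {I : Type*} [Category* I] {K : I ⥤ C ⥤ E} {s : Cocone K}
    (hs : ∀ X, Nonempty (IsColimit (((evaluation C E).obj X).mapCocone s)))
    {J : Type w₁} [Category.{w₂} J] (D : J ⥤ C) (hK : ∀ i, PreservesColimit D (K.obj i)) :
    PreservesColimit D s.pt := by
  constructor
  intro t ht
  obtain ⟨x, hx⟩ : ∃ x : ∀ i, K.obj i ⟶ s.pt, ∀ i, s.ι.app i = x i := ⟨_, fun _ => rfl⟩
  have hxw : ∀ {i i' : I} (f : i ⟶ i'), K.map f ≫ x i' = x i := fun f => by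
    rw [← hx, ← hx]
    exact s.w f
  have hxw' : ∀ {i i' : I} (f : i ⟶ i') (X : C), (K.map f).app X ≫ (x i').app X = (x i).app X :=
    fun f X => congrArg (fun y => NatTrans.app y X) (hxw f)
  have eX : ∀ {X : C} {Y : E} {a b : s.pt.obj X ⟶ Y},
      (∀ i, (x i).app X ≫ a = (x i).app X ≫ b) → a = b := fun {X Y a b} h =>
    (hs X).some.hom_ext fun i => by
      have := h i
      rw [← hx] at this
      exact this
  have dX : ∀ {X : C} {Y : E} (y : ∀ i, (K.obj i).obj X ⟶ Y)
      (_ : ∀ {i i' : I} (f : i ⟶ i'), (K.map f).app X ≫ y i' = y i),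
      ∃ d : s.pt.obj X ⟶ Y, ∀ i, (x i).app X ≫ d = y i := fun {X Y} y hy => by
    refine ⟨(hs X).some.desc (Cocone.mk Y
      { app := y, naturality := fun _ _ f => (hy f).trans (Category.comp_id _).symm }),
      fun i => ?_⟩
    rw [← hx]
    exact (hs X).some.fac _ i
  obtain ⟨y, hy⟩ : ∃ y : ∀ j, D.obj j ⟶ t.pt, ∀ j, t.ι.app j = y j := ⟨_, fun _ => rfl⟩
  have hyw : ∀ {j j' : J} (f : j ⟶ j'), D.map f ≫ y j' = y j := fun f => by
    rw [← hy, ← hy]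
    exact t.w f
  have eK : ∀ {i : I} {Y : E} {a b : (K.obj i).obj t.pt ⟶ Y},
      (∀ j, (K.obj i).map (y j) ≫ a = (K.obj i).map (y j) ≫ b) → a = b := fun {i Y a b} h =>
    (isColimitOfPreserves (K.obj i) ht).hom_ext fun j => by
      have := h j
      rw [← hy] at this
      exact this
  have dK : ∀ {i : I} {Y : E} (z : ∀ j, (K.obj i).obj (D.obj j) ⟶ Y)
      (_ : ∀ {j j' : J} (f : j ⟶ j'), (K.obj i).map (D.map f) ≫ z j' = z j),
      ∃ d : (K.obj i).obj t.pt ⟶ Y, ∀ j, (K.obj i).map (y j) ≫ d = z j := fun {i Y} z hz => by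
    refine ⟨(isColimitOfPreserves (K.obj i) ht).desc (Cocone.mk Y
      { app := z, naturality := fun _ _ f => (hz f).trans (Category.comp_id _).symm }),
      fun j => ?_⟩
    rw [← hy]
    exact (isColimitOfPreserves (K.obj i) ht).fac _ j
  refine ⟨IsColimit.ofExistsUnique fun q => ?_⟩
  obtain ⟨z, hz⟩ : ∃ z : ∀ j, s.pt.obj (D.obj j) ⟶ q.pt, ∀ j, q.ι.app j = z j :=
    ⟨_, fun _ => rfl⟩
  have hzw : ∀ {j j' : J} (f : j ⟶ j'), s.pt.map (D.map f) ≫ z j' = z j := fun f => by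
    rw [← hz, ← hz]
    exact q.w f
  -- Interchange of colimits: the cocone is first extended over the colimit of `D` for each `K i`,
  -- and the results are then glued over `i`.
  choose d hd using fun i => dK (i := i) (fun j => (x i).app (D.obj j) ≫ z j) (fun f => by
    rw [(x i).naturality_assoc, hzw])
  obtain ⟨d', hd'⟩ := dX d (fun {i i'} f => eK fun j => by
    rw [(K.map f).naturality_assoc, hd, hd, reassoc_of% hxw'])
  have fac : ∀ j, s.pt.map (y j) ≫ d' = z j := fun j => eX fun i => by
    rw [← (x i).naturality_assoc, hd', hd]
  refine ⟨d', fun j => ?_, fun d'' hd'' => eX fun i => eK fun j => ?_⟩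
  · rw [hz]
    refine Eq.trans ?_ (fac j)
    rw [← hy]
    rfl
  · have := hd'' j
    rw [hz] at this
    replace this : s.pt.map (y j) ≫ d'' = z j := by
      rw [← hy]
      exact this
    rw [(x i).naturality_assoc, (x i).naturality_assoc, this, fac]

theorem preservesColimit_of_isPushout {C : Type u₁} [Category.{v₁} C] {E : Type u₂}
    [Category.{v₂} E] {A B B' S : C ⥤ E} {f : A ⟶ B} {g : A ⟶ B'} {l : B ⟶ S} {r : B' ⟶ S}
    (h : IsPushout f g l r) (hX : ∀ X, PreservesColimit (span f g) ((evaluation C E).obj X))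
    {J : Type w₁} [Category.{w₂} J] (D : J ⥤ C) [PreservesColimit D A] [PreservesColimit D B]
    [PreservesColimit D B'] : PreservesColimit D S :=
  preservesColimit_of_pointwise (s := h.cocone)
    (fun X => ⟨isColimitOfPreserves ((evaluation C E).obj X) h.isColimit⟩) D (by
      rintro (_ | _ | _) <;> assumption)

namespace ConfMnd

variable (hκ : Cardinal.aleph0 ≤ κ)

/-- The free algebra functor preserves the colimits of a class of diagrams that is closed under
postcomposition with endofunctors if `F` does. -/
theorem preservesColimit_freeFunctor (Ξ : ∀ (J : Type w₁) [Category.{w₂} J], (J ⥤ c.E) → Prop)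
    (hΞ : ∀ (J : Type w₁) [Category.{w₂} J] (D : J ⥤ c.E), Ξ J D → ∀ H : c.E ⥤ c.E, Ξ J (D ⋙ H))
    (hF : ∀ (J : Type w₁) [Category.{w₂} J] (D : J ⥤ c.E), Ξ J D → PreservesColimit D c.F)
    {J : Type w₁} [Category.{w₂} J] (D : J ⥤ c.E) (hD : Ξ J D) :
    PreservesColimit D (c.freeFunctor hκ) := by
  suffices h : ∀ (K : c.E ⥤ c.E), K = (c.free hκ).V → PreservesColimit D K from h _ rfl
  have key := c.isStage_toFree hκ (fun B _ => ∀ V G : c.E ⥤ c.E, V = B.V → G = B.G →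
    PreservesColimit D V ∧ PreservesColimit D G) ⟨?_, ?_, ?_⟩
  · rintro K rfl
    exact (key _ _ rfl rfl).1
  · rintro B f hf _ _ rfl rfl
    have aux : ∀ V : c.E ⥤ c.E, (𝟭 c.E ≅ V) → PreservesColimit D V :=
      fun _ e => preservesColimit_of_natIso D e
    exact ⟨aux _ ((PartialAlg.forgetV (c.endofunctors hκ)).mapIso (asIso f)),
      aux _ ((PartialAlg.forgetG (c.endofunctors hκ)).mapIso (asIso f))⟩
  · rintro B B' f s hs h V' G' hV' hG'
    obtain ⟨V, hV⟩ : ∃ V : c.E ⥤ c.E, V = B.V := ⟨_, rfl⟩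
    obtain ⟨G, hG⟩ : ∃ G : c.E ⥤ c.E, G = B.G := ⟨_, rfl⟩
    obtain ⟨_, _⟩ := h V G hV hG
    -- Closure of `Ξ` under postcomposition is needed here: `F` must preserve the colimit of `D ⋙
    -- V`.
    have := hF J _ (hΞ J D hD V)
    have : PreservesColimit D (V ⋙ c.F) := comp_preservesColimit _ _
    subst hV hG hV' hG'
    have : PreservesColimit D ((c.endofunctors hκ).F.obj B.V) := this
    have h₁ : PreservesColimit D B'.V := preservesColimit_of_isPushout hs.isPushout_V
      (c.hasPushout_functor _ _ B.mem).2 D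
    exact ⟨h₁, preservesColimit_of_isPushout hs.isPushout_G
      (c.hasPushout_functor _ _ hs.mem.1).2 D⟩
  · rintro I _ _ _ _ hI K hV hG Z x lV lG f hf h e he _ _ rfl rfl
    have hV' := c.isChain_evaluation hI hV
    have hG' := c.isChain_evaluation hI hG
    have := (c.preservesColimit_evaluation _ hI _ hV').2
    have := (c.preservesColimit_evaluation _ hI _ hG').2
    exact ⟨preservesColimit_of_pointwise
        (fun X => ⟨isColimitOfPreserves ((evaluation c.E c.E).obj X) lV⟩) D
        (fun i => (h i _ _ rfl rfl).1),
      preservesColimit_of_pointwise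
        (fun X => ⟨isColimitOfPreserves ((evaluation c.E c.E).obj X) lG⟩) D
        (fun i => (h i _ _ rfl rfl).2)⟩

end ConfMnd

end FreeMonadSequence

namespace FreeMonadSequence

variable {κ : Cardinal.{w}}

/-! ### Cartesian units -/

/-! ### Pullbacks and monomorphisms -/

section Pullback

variable {E : Type u} [Category.{v} E]

/-- A part of an object is its own inverse image along a monomorphism. -/
theorem isPullback_comp_mono {Y A B : E} (q : Y ⟶ A) (s : A ⟶ B) [Mono s] :
    IsPullback q (𝟙 Y) s (q ≫ s) :=
  IsPullback.of_isLimit' ⟨by simp⟩ (PullbackCone.IsLimit.mk _ (fun t => t.snd)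
    (fun t => by rw [← cancel_mono s, t.condition, Category.assoc])
    (fun t => Category.comp_id _) (fun t m _ h => (Category.comp_id m).symm.trans h))

theorem isPullback_paste {S Y A B T : E} {p : S ⟶ A} {f : S ⟶ Y} {d : A ⟶ B} {q : Y ⟶ B}
    {d' : B ⟶ T} {q' : Y ⟶ T} (h : IsPullback p f d q) (h' : IsPullback q (𝟙 Y) d' q') :
    IsPullback p f (d ≫ d') q' := by
  simpa using (h.flip.paste_horiz h'.flip).flip

theorem isPullback_of_mono {S Y A B A' B' : E} {p : S ⟶ A} {f : S ⟶ Y} {d : A ⟶ B} {q : Y ⟶ B}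
    {d' : A' ⟶ B'} {j : A ⟶ A'} {j' : B ⟶ B'} [Mono j] [Mono j'] (w : j ≫ d' = d ≫ j')
    (h : IsPullback (p ≫ j) f d' (q ≫ j')) : IsPullback p f d q := by
  have hw : p ≫ d = f ≫ q := by
    rw [← cancel_mono j', Category.assoc, ← w, ← Category.assoc, h.w, Category.assoc]
  have ht : ∀ t : PullbackCone d q, (t.fst ≫ j) ≫ d' = t.snd ≫ q ≫ j' := fun t => by
    rw [Category.assoc, w, t.condition_assoc]
  refine IsPullback.of_isLimit' ⟨hw⟩ (PullbackCone.IsLimit.mk _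
    (fun t => h.lift (t.fst ≫ j) t.snd (ht t)) (fun t => ?_) (fun t => h.lift_snd _ _ _)
    (fun t m h₁ h₂ => h.hom_ext ?_ ?_))
  · rw [← cancel_mono j, Category.assoc, h.lift_fst]
  · rw [h.lift_fst, ← h₁, Category.assoc]
  · rw [h.lift_snd, h₂]

end Pullback

/-! ### Inverse images in van Kampen pushouts -/

section VanKampen

variable {E : Type u} [Category.{v} E] {M : MorphismProperty E}

theorem HasVanKampenPushoutsAlong.isVanKampen_isPushout (hvk : HasVanKampenPushoutsAlong M)
    {A B C D : E} {f : A ⟶ B} {g : A ⟶ C} {h : B ⟶ D} {i : C ⟶ D} (H : IsPushout f g h i)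
    (hf : M f) : H.IsVanKampen :=
  (IsPushout.isVanKampen_iff H).2 (hvk.isVanKampen f g hf _ H.isColimit)

/-- Pushouts along maps in `M` are stable under pullback along maps in `M`. -/
theorem HasVanKampenPushoutsAlong.isPullback_of_isPushout (hvk : HasVanKampenPushoutsAlong M)
    (hpb : HasPullbacksAlong M) {A B C D A' B' C' D' T Y : E}
    {f : A ⟶ B} {g : A ⟶ C} {h : B ⟶ D} {i : C ⟶ D} (H : IsPushout f g h i) (hf : M f)
    {f' : A' ⟶ B'} {g' : A' ⟶ C'} {h' : B' ⟶ D'} {i' : C' ⟶ D'} (H' : IsPushout f' g' h' i')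
    {α : A' ⟶ A} {β : B' ⟶ B} {γ : C' ⟶ C} {δ : D' ⟶ D}
    (wf : f' ≫ β = α ≫ f) (wg : g' ≫ γ = α ≫ g) (wh : h' ≫ δ = β ≫ h) (wi : i' ≫ δ = γ ≫ i)
    {d : D ⟶ T} {t : Y ⟶ T} (ht : M t) {r : D' ⟶ Y} (w : δ ≫ d = r ≫ t)
    (hA : IsPullback α (f' ≫ h' ≫ r) (f ≫ h ≫ d) t)
    (hB : IsPullback β (h' ≫ r) (h ≫ d) t) (hC : IsPullback γ (i' ≫ r) (i ≫ d) t) :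
    IsPullback δ r d t := by
  have : HasPullback t d := hpb.hasPullback t d ht
  have := hasPullback_symmetry t d
  obtain ⟨Q, x, y, hQ⟩ : ∃ (Q : E) (x : Q ⟶ D) (y : Q ⟶ Y), IsPullback x y d t :=
    ⟨_, _, _, IsPullback.of_hasPullback d t⟩
  obtain ⟨k, hx, hy⟩ : ∃ k : D' ⟶ Q, k ≫ x = δ ∧ k ≫ y = r :=
    ⟨hQ.lift δ r w, hQ.lift_fst _ _ _, hQ.lift_snd _ _ _⟩
  -- The corners of the primed square are pulled back from those of `H` along `x`, so by the van
  -- Kampen property `Q` is a pushout of the same span as `D'`, and `k` is invertible.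
  have H'' : IsPushout f' g' (h' ≫ k) (i' ≫ k) := by
    refine (hvk.isVanKampen_isPushout H hf f' g' (h' ≫ k) (i' ≫ k) α β γ x ?_ ?_
      ⟨by rw [Category.assoc, hx, wh]⟩ ⟨by rw [Category.assoc, hx, wi]⟩
      ⟨by rw [reassoc_of% H'.w]⟩).2 ⟨?_, ?_⟩
    · exact IsPullback.of_right hA.flip wf hB.flip
    · refine IsPullback.of_right (h₁₂ := i' ≫ r) (h₂₂ := i ≫ d) (v₁₃ := t) ?_ wg hC.flip
      rw [← reassoc_of% H.w, ← reassoc_of% H'.w]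
      exact hA.flip
    · refine IsPullback.of_right (h₁₂ := y) (h₂₂ := d) (v₁₃ := t) ?_ ?_ hQ.flip
      · rw [Category.assoc, hy]
        exact hB.flip
      · rw [Category.assoc, hx, wh]
    · refine IsPullback.of_right (h₁₂ := y) (h₂₂ := d) (v₁₃ := t) ?_ ?_ hQ.flip
      · rw [Category.assoc, hy]
        exact hC.flip
      · rw [Category.assoc, hx, wi]
  have : IsIso k := by
    refine ⟨H''.desc h' i' H'.w, H'.hom_ext ?_ ?_, H''.hom_ext ?_ ?_⟩
    · rw [← Category.assoc, H''.inl_desc, Category.comp_id]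
    · rw [← Category.assoc, H''.inr_desc, Category.comp_id]
    · rw [H''.inl_desc_assoc, Category.comp_id]
    · rw [H''.inr_desc_assoc, Category.comp_id]
  exact IsPullback.of_iso hQ (asIso k).symm (Iso.refl _) (Iso.refl _) (Iso.refl _)
    (by simp [← hx]) (by simp [← hy]) (by simp) (by simp)

/-- If the inverse images of a part of `T` in the three corners of a pushout coincide, then they
coincide with the inverse image in the pushout. -/
theorem HasVanKampenPushoutsAlong.isPullback_of_eq (hvk : HasVanKampenPushoutsAlong M)
    (hpb : HasPullbacksAlong M) {A B C D S T Y : E}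
    {f : A ⟶ B} {g : A ⟶ C} {h : B ⟶ D} {i : C ⟶ D} (H : IsPushout f g h i) (hf : M f)
    {a : S ⟶ A} {d : D ⟶ T} {t : Y ⟶ T} (ht : M t) {r : S ⟶ Y}
    (hA : IsPullback a r (f ≫ h ≫ d) t) (hB : IsPullback (a ≫ f) r (h ≫ d) t)
    (hC : IsPullback (a ≫ g) r (i ≫ d) t) : IsPullback (a ≫ f ≫ h) r d t :=
  -- All inverse images equal `S`, and `S` is the pushout of the constant span on `S`.
  hvk.isPullback_of_isPushout hpb H hf (IsPushout.of_id_fst (f := 𝟙 S))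
    (α := a) (β := a ≫ f) (γ := a ≫ g) (by simp) (by simp) (by simp)
    (by rw [Category.id_comp, H.w, Category.assoc]) ht (by simpa using hA.w)
    (by simpa using hA) (by simpa using hB) (by simpa using hC)

end VanKampen

/-! ### The cartesian invariant at a step -/

section Step

variable {E : Type u} [Category.{v} E] {M : MorphismProperty E}

/-- In a step of the free algebra sequence, an element of `F V` acts as a generator only if it is
the image of that generator under the unit. -/
theorem isPullback_step_σ (hM : M ≤ MorphismProperty.monomorphisms E)
    (hvk : HasVanKampenPushoutsAlong M) {Y V G F V' : E} {j : G ⟶ F} {a : G ⟶ V} {σ : F ⟶ V'}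
    {s : V ⟶ V'} (hV : IsPushout j a σ s) (hj : M j) {i : V ⟶ G} {u : Y ⟶ V}
    (h : IsPullback (u ≫ i) (𝟙 Y) a u) : IsPullback (u ≫ i ≫ j) (𝟙 Y) σ (u ≫ s) := by
  have : Mono j := hM _ hj
  -- A van Kampen pushout along a monomorphism is also a pullback.
  have h' := IsPushout.IsVanKampen.isPullback_of_mono_left (hvk.isVanKampen_isPushout hV hj)
  simpa using h.paste_horiz h'

/-- The inverse image of the generators under `a'` is computed on the corners of `G' = V' ⊔_V F V`:
on `V` because `s` is a monomorphism, on `V'` because `a'` is the identity there, and on `F V` by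
`isPullback_step_σ`. -/
theorem isPullback_step_action (hM : M ≤ MorphismProperty.monomorphisms E)
    (hpb : HasPullbacksAlong M) (hvk : HasVanKampenPushoutsAlong M)
    {Y V G F V' G' : E} {j : G ⟶ F} {a : G ⟶ V} {σ : F ⟶ V'}
    {s : V ⟶ V'} (hV : IsPushout j a σ s) (hj : M j) (hs : M s) {i : V ⟶ G} {u : Y ⟶ V}
    {i' : V' ⟶ G'} {ρ : F ⟶ G'} {a' : G' ⟶ V'} (hG : IsPushout s (i ≫ j) i' ρ)
    (hi' : i' ≫ a' = 𝟙 V') (hρ : ρ ≫ a' = σ) (hus : M (u ≫ s))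
    (h : IsPullback (u ≫ i) (𝟙 Y) a u) :
    IsPullback ((u ≫ s) ≫ i') (𝟙 Y) a' (u ≫ s) := by
  have : Mono s := hM _ hs
  rw [Category.assoc]
  refine hvk.isPullback_of_eq hpb hG hs hus ?_ ?_ ?_
  · rw [hi', Category.comp_id]
    exact isPullback_comp_mono u s
  · rw [hi']
    simpa using IsPullback.of_vert_isIso (fst := u ≫ s) (snd := 𝟙 Y) (f := 𝟙 V') (g := u ≫ s)
      ⟨by simp⟩
  · rw [hρ]
    exact isPullback_step_σ hM hvk hV hj h

/-- The inverse image of the generators in `V₀' = F₀ ⊔_{G₀} V₀` is computed on the three corners.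
The hypothesis `hφ`, a cartesian naturality square of the unit, handles `F₀`; cancelling `j` handles
`G₀`; the earlier stage handles `V₀`. -/
theorem isPullback_step_unit (hM : M ≤ MorphismProperty.monomorphisms E)
    (hpb : HasPullbacksAlong M) (hvk : HasVanKampenPushoutsAlong M)
    {Y V G F V' X V₀ G₀ F₀ V₀' : E} {j : G ⟶ F} {a : G ⟶ V} {σ : F ⟶ V'} {s : V ⟶ V'}
    (hV : IsPushout j a σ s) (hj : M j) (hs : M s) {i : V ⟶ G} {u : Y ⟶ V} (hus : M (u ≫ s))
    {j₀ : G₀ ⟶ F₀} {a₀ : G₀ ⟶ V₀} {σ₀ : F₀ ⟶ V₀'} {s₀ : V₀ ⟶ V₀'}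
    (hV₀ : IsPushout j₀ a₀ σ₀ s₀) (hj₀ : M j₀) {i₀ : V₀ ⟶ G₀} (hia₀ : i₀ ≫ a₀ = 𝟙 V₀)
    {u₀ : X ⟶ V₀} {f : X ⟶ Y} {v : V₀ ⟶ V} {g : G₀ ⟶ G} {φ : F₀ ⟶ F} {v' : V₀' ⟶ V'}
    (hjφ : j₀ ≫ φ = g ≫ j) (hσv : σ₀ ≫ v' = φ ≫ σ)
    (hsv : s₀ ≫ v' = v ≫ s)
    (h : IsPullback (u ≫ i) (𝟙 Y) a u) (hv : IsPullback u₀ f v u)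
    (hφ : IsPullback (i₀ ≫ j₀) v φ (i ≫ j)) :
    IsPullback (u₀ ≫ s₀) f v' (u ≫ s) := by
  have : Mono s := hM _ hs
  have : Mono j := hM _ hj
  have : Mono j₀ := hM _ hj₀
  have h₁ : IsPullback (u₀ ≫ i₀ ≫ j₀) f φ (u ≫ i ≫ j) := (hv.flip.paste_vert hφ.flip).flip
  have h₂ : IsPullback (u₀ ≫ i₀) f g (u ≫ i) :=
    isPullback_of_mono hjφ (by simpa using h₁)
  have h₃ : IsPullback (u₀ ≫ s₀) f v' (u ≫ s) ↔
      IsPullback ((u₀ ≫ i₀) ≫ j₀ ≫ σ₀) f v' (u ≫ s) := by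
    rw [hV₀.w, Category.assoc, reassoc_of% hia₀]
  rw [h₃]
  refine hvk.isPullback_of_eq hpb hV₀ hj₀ hus ?_ ?_ ?_
  · rw [hσv, reassoc_of% hjφ, hV.w]
    exact isPullback_paste h₂ (isPullback_paste h (isPullback_comp_mono u s))
  · rw [hσv, Category.assoc]
    exact isPullback_paste h₁ (isPullback_step_σ hM hvk hV hj h)
  · rw [hsv, Category.assoc, hia₀, Category.comp_id]
    exact isPullback_paste hv (isPullback_comp_mono u s)

end Step

/-! ### The cartesian invariant at colimits of chains, by doubling -/

section Chain

/-- Colimits commute with pushouts. The gluing object `S` does not vary with `j`, so nonemptiness of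
`J` suffices to compare the two copies on `S`. -/
theorem isColimit_double {C : Type u} [Category.{v} C] {J : Type w} [Category* J] [Nonempty J]
    {A D : J ⥤ C} {S : C} {p : ∀ j, S ⟶ A.obj j} {i₁ i₂ : A ⟶ D}
    (hD : ∀ j, IsPushout (p j) (p j) (i₁.app j) (i₂.app j))
    {s : Cocone A} (hs : IsColimit s) {t : Cocone D} {q : S ⟶ s.pt} {l₁ l₂ : s.pt ⟶ t.pt}
    (ht : IsPushout q q l₁ l₂) (hq : ∀ j, p j ≫ s.ι.app j = q)
    (h₁ : ∀ j, s.ι.app j ≫ l₁ = i₁.app j ≫ t.ι.app j)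
    (h₂ : ∀ j, s.ι.app j ≫ l₂ = i₂.app j ≫ t.ι.app j) : Nonempty (IsColimit t) := by
  refine ⟨IsColimit.ofExistsUnique fun y => ?_⟩
  let y₁ : Cocone A := (Cocone.precompose i₁).obj y
  let y₂ : Cocone A := (Cocone.precompose i₂).obj y
  have e₁ : ∀ j, s.ι.app j ≫ hs.desc y₁ = i₁.app j ≫ y.ι.app j := fun j => hs.fac y₁ j
  have e₂ : ∀ j, s.ι.app j ≫ hs.desc y₂ = i₂.app j ≫ y.ι.app j := fun j => hs.fac y₂ j
  have hq' : ∀ {Z : C} (j : J) (z : s.pt ⟶ Z), q ≫ z = p j ≫ s.ι.app j ≫ z := fun j z => by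
    rw [← hq j]
    exact Category.assoc _ _ _
  have w : q ≫ hs.desc y₁ = q ≫ hs.desc y₂ := by
    let j : J := Classical.arbitrary J
    rw [hq' j, hq' j, e₁, e₂, (hD j).w_assoc]
  obtain ⟨d, d₁, d₂⟩ : ∃ d : t.pt ⟶ y.pt, l₁ ≫ d = hs.desc y₁ ∧ l₂ ≫ d = hs.desc y₂ :=
    ⟨ht.desc _ _ w, ht.inl_desc _ _ _, ht.inr_desc _ _ _⟩
  refine ⟨d, fun j => (hD j).hom_ext ?_ ?_, fun d' hd' => ht.hom_ext (hs.hom_ext fun j => ?_)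
    (hs.hom_ext fun j => ?_)⟩
  · rw [← e₁, ← d₁]
    exact (Category.assoc _ _ _).symm.trans ((congrArg (· ≫ d) (h₁ j).symm).trans
      (Category.assoc _ _ _))
  · rw [← e₂, ← d₂]
    exact (Category.assoc _ _ _).symm.trans ((congrArg (· ≫ d) (h₂ j).symm).trans
      (Category.assoc _ _ _))
  · rw [d₁, e₁, ← hd' j]
    exact (Category.assoc _ _ _).symm.trans ((congrArg (· ≫ d') (h₁ j)).trans
      (Category.assoc _ _ _))
  · rw [d₂, e₂, ← hd' j]
    exact (Category.assoc _ _ _).symm.trans ((congrArg (· ≫ d') (h₂ j)).trans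
      (Category.assoc _ _ _))

variable {c : ConfMnd.{w, v, u} κ}

/-- The map `A ⊔_S A ⟶ B ⊔_S B` factors through `B ⊔_S A`, and both factors are pushouts of `a`. -/
theorem double_map_mem {S A B D D' : c.E} {p : S ⟶ A} {a : A ⟶ B} (ha : c.M a) {p' : S ⟶ B}
    (hp : p ≫ a = p') {i₁ i₂ : A ⟶ D} (hD : IsPushout p p i₁ i₂) {j₁ j₂ : B ⟶ D'}
    (hD' : IsPushout p' p' j₁ j₂) {x : D ⟶ D'} (h₁ : i₁ ≫ x = a ≫ j₁)
    (h₂ : i₂ ≫ x = a ≫ j₂) : c.M x := by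
  subst hp
  have := c.hasPushouts.hasPushout a i₁ ha
  obtain ⟨K, n, m, hK⟩ : ∃ (K : c.E) (n : B ⟶ K) (m : D ⟶ K), IsPushout a i₁ n m :=
    ⟨_, _, _, IsPushout.of_hasPushout _ _⟩
  have hm : c.M m := c.M.of_isPushout hK.flip ha
  have hK' : IsPushout (p ≫ a) p n (i₂ ≫ m) := hD.paste_horiz hK
  obtain ⟨y, hn, hy⟩ : ∃ y : K ⟶ D', n ≫ y = j₁ ∧ m ≫ y = x :=
    ⟨hK.desc _ _ h₁.symm, hK.inl_desc _ _ _, hK.inr_desc _ _ _⟩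
  have h : IsPushout a (i₂ ≫ m) j₂ y :=
    IsPushout.of_left (by rw [hn]; exact hD'.flip) (by rw [Category.assoc, hy, h₂]) hK'.flip
  rw [← hy]
  exact c.M.comp_mem _ _ hm (c.M.of_isPushout h.flip ha)

theorem exists_double {J : Type w} [LinearOrder J] [WellFoundedLT J] {A : J ⥤ c.E}
    (hA : IsChain c.M A) {S : c.E} {p : ∀ j, S ⟶ A.obj j}
    (hp : ∀ {i j : J} (f : i ⟶ j), p i ≫ A.map f = p j) (hpM : ∀ j, c.M (p j)) :
    ∃ (D : J ⥤ c.E) (i₁ i₂ : A ⟶ D), (∀ j, IsPushout (p j) (p j) (i₁.app j) (i₂.app j)) ∧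
      IsChain c.M D := by
  have : ∀ j, HasPushout (p j) (p j) := fun j => c.hasPushouts.hasPushout _ _ (hpM j)
  choose D i₁ i₂ hD using fun j => show ∃ (D : c.E) (i₁ i₂ : A.obj j ⟶ D),
    IsPushout (p j) (p j) i₁ i₂ from ⟨_, _, _, IsPushout.of_hasPushout _ _⟩
  choose x h₁ h₂ using fun (i j : J) (f : i ⟶ j) => show ∃ x : D i ⟶ D j,
    i₁ i ≫ x = A.map f ≫ i₁ j ∧ i₂ i ≫ x = A.map f ≫ i₂ j from
    ⟨(hD i).desc _ _ (by rw [reassoc_of% hp, reassoc_of% hp, (hD j).w]), (hD i).inl_desc _ _ _,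
      (hD i).inr_desc _ _ _⟩
  let D : J ⥤ c.E :=
    { obj := D
      map := fun {i j} f => x i j f
      map_id := fun j => (hD j).hom_ext (by simp [h₁]) (by simp [h₂])
      map_comp := fun {i j k} f g => (hD i).hom_ext
        (by rw [h₁, reassoc_of% h₁ i j f, h₁, A.map_comp_assoc])
        (by rw [h₂, reassoc_of% h₂ i j f, h₂, A.map_comp_assoc]) }
  let i₁ : A ⟶ D := { app := i₁, naturality := fun i j f => (h₁ i j f).symm }
  let i₂ : A ⟶ D := { app := i₂, naturality := fun i j f => (h₂ i j f).symm }
  refine ⟨D, i₁, i₂, hD, ⟨⟨fun m hm => ?_⟩, fun i j h => ?_⟩⟩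
  · have := hA.continuous
    have hne : Nonempty (Set.Iio m) := by
      obtain ⟨a, ha⟩ := not_isMin_iff.1 hm.1
      exact ⟨⟨a, ha⟩⟩
    exact isColimit_double (J := Set.Iio m)
      (i₁ := Functor.whiskerLeft (Set.principalSegIio m).monotone.functor i₁)
      (i₂ := Functor.whiskerLeft (Set.principalSegIio m).monotone.functor i₂)
      (fun j => hD j) (A.isColimitOfIsWellOrderContinuous m hm)
      (t := (Set.principalSegIio m).cocone D) (hD m) (fun j => hp _)
      (fun j => i₁.naturality _) (fun j => i₂.naturality _)
  · exact double_map_mem (hA.succ_mem i j h) (hp _) (hD i) (hD j) (i₁.naturality _).symm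
      (i₂.naturality _).symm

/-- If the inverse images of a part `Q` of a transfinite composition in all stages coincide, then
they coincide with `Q`. -/
theorem isIso_of_isPullback_chain (hM : c.M ≤ MorphismProperty.monomorphisms c.E)
    (hpb : HasPullbacksAlong c.M) (hvk : HasVanKampenPushoutsAlong c.M)
    {J : Type w} [LinearOrder J] [WellFoundedLT J] [Nonempty J] [NoMaxOrder J]
    (hJ : Ordinal.type (α := J) (· < ·) ≤ κ.ord) {A : J ⥤ c.E} (hA : IsChain c.M A)
    {A' : c.E} {x : ∀ j, A.obj j ⟶ A'} (hx : ∀ {i j : J} (f : i ⟶ j), A.map f ≫ x j = x i)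
    (l : IsColimit (Cocone.mk A'
      { app := x, naturality := fun _ _ f => (hx f).trans (Category.comp_id _).symm }))
    {Q S : c.E} {k : Q ⟶ A'} (hk : c.M k) {z : S ⟶ Q} {p : ∀ j, S ⟶ A.obj j}
    (hp : ∀ j, IsPullback (p j) z (x j) k) : IsIso z := by
  have := hpb.stable
  have hxM : ∀ j, c.M (x j) := c.hasCompositions.coprojection_mem J hJ _ hA _ l
  have hpM : ∀ j, c.M (p j) := fun j => c.M.of_isPullback (hp j).flip hk
  let o : J := Classical.arbitrary J
  have hz : c.M z := c.M.of_isPullback (hp o) (hxM o)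
  have hp' : ∀ {i j : J} (f : i ⟶ j), p i ≫ A.map f = p j := fun {i j} f => by
    have : Mono (x j) := hM _ (hxM j)
    rw [← cancel_mono (x j), Category.assoc, hx, (hp i).w, (hp j).w]
  obtain ⟨D, i₁, i₂, hD, hDM⟩ := exists_double hA hp' hpM
  have hzk : c.M (z ≫ k) := c.M.comp_mem _ _ hz hk
  have := c.hasPushouts.hasPushout (z ≫ k) (z ≫ k) hzk
  obtain ⟨D', l₁, l₂, hD'⟩ : ∃ (D' : c.E) (l₁ l₂ : A' ⟶ D'),
    IsPushout (z ≫ k) (z ≫ k) l₁ l₂ := ⟨_, _, _, IsPushout.of_hasPushout _ _⟩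
  -- Gluing two copies of `A'` along `Q` and along `S` gives `K` and `D'`. The aim is that the
  -- comparison `t : D' ⟶ K` is a monomorphism, which forces `Q` and `S` to coincide.
  have := c.hasPushouts.hasPushout k k hk
  obtain ⟨K, e₁, e₂, hK⟩ : ∃ (K : c.E) (e₁ e₂ : A' ⟶ K), IsPushout k k e₁ e₂ :=
    ⟨_, _, _, IsPushout.of_hasPushout _ _⟩
  have hd : ∀ {B : c.E} (b₁ b₂ : A' ⟶ B), (z ≫ k) ≫ b₁ = (z ≫ k) ≫ b₂ → ∀ j,
      p j ≫ x j ≫ b₁ = p j ≫ x j ≫ b₂ := fun b₁ b₂ h j => by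
    rw [reassoc_of% (hp j).w, reassoc_of% (hp j).w]
    simpa using h
  choose y y₁ y₂ using fun j : J => show ∃ y : D.obj j ⟶ D', i₁.app j ≫ y = x j ≫ l₁ ∧
    i₂.app j ≫ y = x j ≫ l₂ from
    ⟨(hD j).desc _ _ (hd l₁ l₂ hD'.w j), (hD j).inl_desc _ _ _, (hD j).inr_desc _ _ _⟩
  have hy : ∀ {i j : J} (f : i ⟶ j), D.map f ≫ y j = y i := fun {i j} f => by
    refine (hD i).hom_ext ?_ ?_
    · rw [← i₁.naturality_assoc, y₁, y₁, reassoc_of% hx]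
    · rw [← i₂.naturality_assoc, y₂, y₂, reassoc_of% hx]
  obtain ⟨lD⟩ := isColimit_double hD l (t := Cocone.mk D'
    { app := y, naturality := fun _ _ f => (hy f).trans (Category.comp_id _).symm })
    hD' (fun j => (hp j).w) (fun j => (y₁ j).symm) (fun j => (y₂ j).symm)
  obtain ⟨t, t₁, t₂⟩ : ∃ t : D' ⟶ K, l₁ ≫ t = e₁ ∧ l₂ ≫ t = e₂ :=
    ⟨hD'.desc e₁ e₂ (by rw [Category.assoc, hK.w, Category.assoc]), hD'.inl_desc _ _ _,
      hD'.inr_desc _ _ _⟩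
  obtain ⟨d, d₁, d₂⟩ : ∃ d : K ⟶ A', e₁ ≫ d = 𝟙 _ ∧ e₂ ≫ d = 𝟙 _ :=
    ⟨hK.desc _ _ rfl, hK.inl_desc _ _ _, hK.inr_desc _ _ _⟩
  -- The pullback of `x j` along the fold map `d : K ⟶ A'` is the double of `A_j` along the inverse
  -- image of `Q`, which is `S`. So `D_j ⟶ K` is a pullback of a map in `M`.
  have hyt : ∀ j, c.M (y j ≫ t) := fun j => by
    obtain ⟨r, r₁, r₂⟩ : ∃ r : D.obj j ⟶ A.obj j, i₁.app j ≫ r = 𝟙 _ ∧ i₂.app j ≫ r = 𝟙 _ :=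
      ⟨(hD j).desc _ _ rfl, (hD j).inl_desc _ _ _, (hD j).inr_desc _ _ _⟩
    have h₁ : IsPullback (x j) (𝟙 _) (𝟙 A') (x j) := IsPullback.of_vert_isIso ⟨by simp⟩
    have : IsPullback (y j ≫ t) r d (x j) := by
      refine hvk.isPullback_of_isPushout hpb hK hk (hD j) (α := z) (β := x j) (γ := x j)
        (hp j).w (hp j).w ?_ ?_ (hxM j) ((hD j).hom_ext ?_ ?_) ?_ ?_ ?_
      · rw [reassoc_of% y₁, t₁]
      · rw [reassoc_of% y₂, t₂]
      · rw [Category.assoc, reassoc_of% y₁, reassoc_of% t₁, d₁, reassoc_of% r₁, Category.comp_id]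
      · rw [Category.assoc, reassoc_of% y₂, reassoc_of% t₂, d₂, reassoc_of% r₂, Category.comp_id]
      · rw [r₁, d₁, Category.comp_id, Category.comp_id]
        exact (hp j).flip
      · rw [r₁, d₁]
        exact h₁
      · rw [r₂, d₂]
        exact h₁
    exact c.M.of_isPullback this.flip (hxM j)
  have ht : c.M t := by
    let r : Cocone D := Cocone.mk K
      { app := fun j => y j ≫ t
        naturality := fun _ _ f => (Category.assoc _ _ _).symm.trans
          ((congrArg (· ≫ t) (hy f)).trans (Category.comp_id _).symm) }
    have e : t = lD.desc r := lD.hom_ext fun j => (lD.fac r j).symm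
    rw [e]
    exact c.hasCompositions.desc_mem J hJ D hDM _ lD r hyt
  have : Mono t := hM _ ht
  have : Mono k := hM _ hk
  have : Mono z := hM _ hz
  have : Mono (z ≫ k) := hM _ hzk
  have hpull := IsPushout.IsVanKampen.isPullback_of_mono_left (hvk.isVanKampen_isPushout hD' hzk)
  -- The two copies of `Q` agree in `K`, hence already in `D'`; as `D'` is also a pullback, `k`
  -- factors through `S`.
  have hkl : k ≫ l₁ = k ≫ l₂ := by
    rw [← cancel_mono t, Category.assoc, Category.assoc, t₁, t₂, hK.w]
  refine ⟨hpull.lift k k hkl, ?_, ?_⟩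
  · rw [← cancel_mono (z ≫ k), Category.assoc, hpull.lift_fst, Category.id_comp]
  · rw [← cancel_mono k, Category.assoc, hpull.lift_fst, Category.id_comp]

/-- A map between transfinite compositions is cartesian over parts of them if it is so at each
stage. -/
theorem isPullback_of_chain (hM : c.M ≤ MorphismProperty.monomorphisms c.E)
    (hpb : HasPullbacksAlong c.M) (hvk : HasVanKampenPushoutsAlong c.M)
    {J : Type w} [LinearOrder J] [WellFoundedLT J] [Nonempty J] [NoMaxOrder J]
    (hJ : Ordinal.type (α := J) (· < ·) ≤ κ.ord) {A : J ⥤ c.E} (hA : IsChain c.M A)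
    {A' : c.E} {x : ∀ j, A.obj j ⟶ A'} (hx : ∀ {i j : J} (f : i ⟶ j), A.map f ≫ x j = x i)
    (l : IsColimit (Cocone.mk A'
      { app := x, naturality := fun _ _ f => (hx f).trans (Category.comp_id _).symm }))
    {B : J → c.E} {B' : c.E} {y : ∀ j, B j ⟶ B'} (hy : ∀ j, c.M (y j))
    {d : ∀ j, A.obj j ⟶ B j} {d' : A' ⟶ B'} (hd : ∀ j, x j ≫ d' = d j ≫ y j)
    {S Y : c.E} {r : S ⟶ Y} {p : ∀ j, S ⟶ A.obj j} {q : ∀ j, Y ⟶ B j} {p' : S ⟶ A'} {q' : Y ⟶ B'}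
    (hp : ∀ j, p j ≫ x j = p') (hq : ∀ j, q j ≫ y j = q') (hq' : c.M q')
    (h : ∀ j, IsPullback (p j) r (d j) (q j)) : IsPullback p' r d' q' := by
  have := hpb.stable
  have := hpb.hasPullback q' d' hq'
  have := hasPullback_symmetry q' d'
  obtain ⟨Q, k, n, hQ⟩ : ∃ (Q : c.E) (k : Q ⟶ A') (n : Q ⟶ Y), IsPullback k n d' q' :=
    ⟨_, _, _, IsPullback.of_hasPullback d' q'⟩
  let o : J := Classical.arbitrary J
  have w : p' ≫ d' = r ≫ q' := by
    rw [← hp o, ← hq o, Category.assoc, hd, reassoc_of% (h o).w]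
  obtain ⟨z, hk, hn⟩ : ∃ z : S ⟶ Q, z ≫ k = p' ∧ z ≫ n = r :=
    ⟨hQ.lift _ _ w, hQ.lift_fst _ _ _, hQ.lift_snd _ _ _⟩
  -- The true inverse image `Q` of `q'` restricts to `S` at every stage.
  have : IsIso z := isIso_of_isPullback_chain hM hpb hvk hJ hA hx l (k := k) (z := z) (p := p)
    (c.M.of_isPullback hQ.flip hq') (fun j => by
      have : Mono (y j) := hM _ (hy j)
      have h' : IsPullback (p j) r (x j ≫ d') q' := by
        rw [hd, ← hq j]
        exact isPullback_paste (h j) (isPullback_comp_mono _ _)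
      refine (IsPullback.of_right (h₁₂ := n) (h₂₂ := d') (v₁₃ := q') ?_ ?_ hQ.flip).flip
      · rw [hn]
        exact h'.flip
      · rw [hk, hp])
  exact IsPullback.of_iso hQ (asIso z).symm (Iso.refl _) (Iso.refl _) (Iso.refl _)
    (by simp [← hk]) (by simp [← hn]) (by simp) (by simp)

end Chain

/-! ### The cartesian invariant along the free algebra sequence -/

namespace PartialAlg

variable {c : ConfMnd.{w, v, u} κ} {hκ : Cardinal.aleph0 ≤ κ}

/-- The map `u` from the identity functor to a partial algebra is cartesian, and elements acting
as generators are generators. -/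
structure IsCartesian (B : PartialAlg (c.endofunctors hκ)) (u : ∀ Y : c.E, Y ⟶ B.V.obj Y) :
    Prop where
  mem : ∀ Y, c.M (u Y)
  action : ∀ Y, IsPullback (u Y ≫ NatTrans.app B.i Y) (𝟙 Y) (NatTrans.app B.a Y) (u Y)
  unit : ∀ {X Y : c.E} (f : X ⟶ Y), IsPullback (u X) f (B.V.map f) (u Y)

theorem i_a_app (B : PartialAlg (c.endofunctors hκ)) (Y : c.E) :
    NatTrans.app B.i Y ≫ NatTrans.app B.a Y = 𝟙 (B.V.obj Y) :=
  congrArg (fun y => NatTrans.app y Y) B.i_a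

theorem i_j_app (B : PartialAlg (c.endofunctors hκ)) (Y : c.E) :
    NatTrans.app B.i Y ≫ NatTrans.app B.j Y = c.η.app (B.V.obj Y) :=
  congrArg (fun y => NatTrans.app y Y) B.i_j

theorem isCartesian_of_isIso {B : PartialAlg (c.endofunctors hκ)} {u : ∀ Y : c.E, Y ⟶ B.V.obj Y}
    (hu : ∀ {X Y : c.E} (f : X ⟶ Y), f ≫ u Y = u X ≫ B.V.map f) (h : ∀ Y, IsIso (u Y))
    (hi : ∀ Y, IsIso (NatTrans.app B.i Y)) : IsCartesian B u where
  mem Y := c.M.of_isIso _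
  action Y := IsPullback.of_horiz_isIso ⟨by
    rw [Category.assoc, i_a_app, Category.comp_id, Category.id_comp]⟩
  unit f := IsPullback.of_horiz_isIso ⟨(hu f).symm⟩

theorem IsCartesian.step (hM : c.M ≤ MorphismProperty.monomorphisms c.E)
    (hpb : HasPullbacksAlong c.M) (hvk : HasVanKampenPushoutsAlong c.M)
    (hη : NatTrans.Equifibered c.η) {B B' : PartialAlg (c.endofunctors hκ)} {s : B ⟶ B'}
    (hs : Step s) {u : ∀ Y : c.E, Y ⟶ B.V.obj Y} (hu : IsCartesian B u) :
    IsCartesian B' (fun Y => u Y ≫ NatTrans.app s.v Y) := by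
  have hsM : ∀ Y, c.M (NatTrans.app s.v Y) := hs.mem.1
  have husM : ∀ Y, c.M (u Y ≫ NatTrans.app s.v Y) :=
    fun Y => c.M.comp_mem _ _ (hu.mem Y) (hsM Y)
  have hj : ∀ Y, c.M (NatTrans.app B.j Y) := B.mem
  have hV : ∀ Y, IsPushout (NatTrans.app B.j Y) (NatTrans.app B.a Y) (NatTrans.app hs.σ Y)
    (NatTrans.app s.v Y) := c.isPushout_app hs.isPushout_V B.mem
  have hG : ∀ Y, IsPushout (NatTrans.app s.v Y) (NatTrans.app B.i Y ≫ NatTrans.app B.j Y)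
    (NatTrans.app B'.i Y) (NatTrans.app hs.ρ Y) := fun Y => by
      rw [i_j_app]
      exact c.isPushout_app hs.isPushout_G hs.mem.1 Y
  refine ⟨husM, fun Y => ?_, fun {X Y} f => ?_⟩
  · exact isPullback_step_action hM hpb hvk (hV Y) (hj Y) (hsM Y) (hG Y) (B'.i_a_app Y)
      (congrArg (fun y => NatTrans.app y Y) hs.ρ_a) (husM Y) (hu.action Y)
  · refine isPullback_step_unit hM hpb hvk (hV Y) (hj Y) (hsM Y) (husM Y) (hV X) (hj X)
      (B.i_a_app X) (NatTrans.naturality B.j f).symm (NatTrans.naturality hs.σ f).symm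
      (NatTrans.naturality s.v f).symm (hu.action Y) (hu.unit f) ?_
    rw [i_j_app, i_j_app]
    exact (hη (B.V.map f)).flip

theorem IsCartesian.colimit (hM : c.M ≤ MorphismProperty.monomorphisms c.E)
    (hpb : HasPullbacksAlong c.M) (hvk : HasVanKampenPushoutsAlong c.M)
    {J : Type w} [LinearOrder J] [WellFoundedLT J] [Nonempty J] [NoMaxOrder J]
    (hJ : Ordinal.type (α := J) (· < ·) ≤ κ.ord) {D : J ⥤ PartialAlg (c.endofunctors hκ)}
    (hV : IsChain (c.endofunctors hκ).M (D ⋙ forgetV _))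
    (hG : IsChain (c.endofunctors hκ).M (D ⋙ forgetG _))
    {Z : PartialAlg (c.endofunctors hκ)} {x : D ⟶ (Functor.const J).obj Z}
    (lV : IsColimit ((forgetV _).mapCocone ⟨Z, x⟩)) (lG : IsColimit ((forgetG _).mapCocone ⟨Z, x⟩))
    {u : ∀ (j : J) (Y : c.E), Y ⟶ (D.obj j).V.obj Y} (hu : ∀ j, IsCartesian (D.obj j) (u j))
    {u' : ∀ Y : c.E, Y ⟶ Z.V.obj Y}
    (hu' : ∀ j Y, u j Y ≫ NatTrans.app (Hom.v (x.app j)) Y = u' Y) : IsCartesian Z u' := by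
  obtain ⟨y, hy⟩ : ∃ y : ∀ k, D.obj k ⟶ Z, ∀ k, x.app k = y k := ⟨_, fun k => rfl⟩
  have hyw : ∀ {i j : J} (f : i ⟶ j), D.map f ≫ y j = y i := fun {i j} f => by
    rw [← hy, ← hy]
    exact (x.naturality f).trans (Category.comp_id _)
  have hVX := fun X => c.isChain_evaluation hJ hV X
  have hGX := fun X => c.isChain_evaluation hJ hG X
  have := fun X => (c.preservesColimit_evaluation _ hJ _ hVX).2 X
  have := fun X => (c.preservesColimit_evaluation _ hJ _ hGX).2 X
  have lVX := fun X => isColimitOfPreserves ((evaluation c.E c.E).obj X) lV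
  have lGX := fun X => isColimitOfPreserves ((evaluation c.E c.E).obj X) lG
  have hyu : ∀ j Y, u j Y ≫ NatTrans.app (y j).v Y = u' Y := fun j Y => by
    rw [← hy]
    exact hu' j Y
  have hyv : ∀ (X : c.E) {i j : J} (f : i ⟶ j),
      NatTrans.app (D.map f).v X ≫ NatTrans.app (y j).v X = NatTrans.app (y i).v X :=
    fun X {i j} f => congrArg (fun t => NatTrans.app (Hom.v t) X) (hyw f)
  have hyg : ∀ (X : c.E) {i j : J} (f : i ⟶ j),
      NatTrans.app (D.map f).g X ≫ NatTrans.app (y j).g X = NatTrans.app (y i).g X :=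
    fun X {i j} f => congrArg (fun t => NatTrans.app (Hom.g t) X) (hyw f)
  have lVy : ∀ X, Nonempty (IsColimit (Cocone.mk
      (F := (D ⋙ forgetV _) ⋙ (evaluation c.E c.E).obj X) (Z.V.obj X)
      { app := fun j => NatTrans.app (y j).v X
        naturality := fun _ _ f => (hyv X f).trans (Category.comp_id _).symm })) := fun X => by
    obtain rfl : (fun k => x.app k) = y := funext hy
    exact ⟨lVX X⟩
  have lGy : ∀ X, Nonempty (IsColimit (Cocone.mk
      (F := (D ⋙ forgetG _) ⋙ (evaluation c.E c.E).obj X) (Z.G.obj X)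
      { app := fun j => NatTrans.app (y j).g X
        naturality := fun _ _ f => (hyg X f).trans (Category.comp_id _).symm })) := fun X => by
    obtain rfl : (fun k => x.app k) = y := funext hy
    exact ⟨lGX X⟩
  have hyV : ∀ j X, c.M (NatTrans.app (y j).v X) := fun j X =>
    c.hasCompositions.coprojection_mem J hJ _ (hVX X) _ (lVy X).some j
  have hu'M : ∀ Y, c.M (u' Y) := fun Y => by
    let j := Classical.arbitrary J
    rw [← hyu j Y]
    exact c.M.comp_mem _ _ ((hu j).mem Y) (hyV j Y)
  refine ⟨hu'M, fun Y => ?_, fun {X Y} f => ?_⟩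
  · refine isPullback_of_chain hM hpb hvk hJ (hGX Y) (hyg Y) (lGy Y).some (hyV · Y)
      (d := fun j => NatTrans.app (D.obj j).a Y)
      (fun j => (congrArg (fun t => NatTrans.app t Y) (y j).a_v).symm) (fun j => ?_) (hyu · Y)
      (hu'M Y) (fun j => (hu j).action Y)
    have h : NatTrans.app (D.obj j).i Y ≫ NatTrans.app (y j).g Y =
      NatTrans.app (y j).v Y ≫ NatTrans.app Z.i Y :=
      congrArg (fun t => NatTrans.app t Y) (y j).i_g
    rw [← hyu j Y]
    exact (Category.assoc _ _ _).trans ((congrArg (u j Y ≫ ·) h).trans (Category.assoc _ _ _).symm)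
  · exact isPullback_of_chain hM hpb hvk hJ (hVX X) (hyv X) (lVy X).some (hyV · Y)
      (d := fun j => (D.obj j).V.map f) (fun j => (NatTrans.naturality (y j).v f).symm)
      (hyu · X) (hyu · Y) (hu'M Y) (fun j => (hu j).unit f)

end PartialAlg

namespace ConfMnd

variable {c : ConfMnd.{w, v, u} κ} (hκ : Cardinal.aleph0 ≤ κ)

/-- Cartesianness of the unit is not inductive alone: the step must know that no other element has
been made to act as a generator, which is the `action` clause of `IsCartesian`. -/
theorem equifibered_freeUnit (hM : c.M ≤ MorphismProperty.monomorphisms c.E)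
    (hpb : HasPullbacksAlong c.M) (hvk : HasVanKampenPushoutsAlong c.M)
    (hη : NatTrans.Equifibered c.η) : NatTrans.Equifibered (c.freeUnit hκ) := by
  suffices h : PartialAlg.IsCartesian (c.free hκ) (fun Y => (c.freeUnit hκ).app Y) from
    fun X Y f => (h.unit f).flip
  refine c.isStage_toFree hκ
    (fun B e => PartialAlg.IsCartesian B (fun Y => NatTrans.app e.v Y)) ⟨?_, ?_, ?_⟩
  · intro B f hf
    have h₁ : IsIso f.v := inferInstanceAs (IsIso ((PartialAlg.forgetV _).map f))
    have h₂ : IsIso f.g := inferInstanceAs (IsIso ((PartialAlg.forgetG _).map f))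
    have h₃ : IsIso B.i := by
      have : IsIso (f.v ≫ B.i) := by
        rw [← f.i_g]
        have : IsIso (c.start hκ).i := inferInstanceAs (IsIso (𝟙 (𝟭 c.E)))
        infer_instance
      exact IsIso.of_isIso_comp_left f.v B.i
    exact PartialAlg.isCartesian_of_isIso (fun g => NatTrans.naturality f.v g)
      (fun Y => inferInstanceAs (IsIso (((evaluation c.E c.E).obj Y).map f.v)))
      (fun Y => inferInstanceAs (IsIso (((evaluation c.E c.E).obj Y).map B.i)))
  · intro B B' f s hs h
    exact h.step hM hpb hvk hη hs
  · intro J _ _ _ _ hJ D hV hG Z x lV lG f hf h e he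
    refine PartialAlg.IsCartesian.colimit hM hpb hvk hJ hV hG lV lG h fun j Y => ?_
    rw [← he j]
    rfl

end ConfMnd

end FreeMonadSequence

theorem mainTheorem3 (κ : Cardinal.{w}) (hκ : κ.IsRegular) :
    ∃ (L : FreeMonadSequence.MonadLift.{w, v, u} κ)
      (ι : ∀ c : FreeMonadSequence.ConfMnd.{w, v, u} κ, c.F ⟶ (L.T c).toFunctor),
      -- the lift, with `T c` the free and algebraically-free monad on `c.F`
      L.toFunctor ⋙ FreeMonadSequence.MndS.forget = FreeMonadSequence.ConfMnd.forget κ ∧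
      (∀ c, FreeMonadSequence.IsFreeAndAlgebraicallyFree c.η (L.T c) (ι c)) ∧
      (∀ {c d : FreeMonadSequence.ConfMnd.{w, v, u} κ} (P : c ⟶ d) (X : c.E),
        P.P.map ((ι c).app X) ≫ (L.str P).γ.hom.app X =
          P.φ.hom.app X ≫ (ι d).app (P.P.obj X)) ∧
      -- (i) colimits
      (∀ (c : FreeMonadSequence.ConfMnd.{w, v, u} κ)
        (Ξ : ∀ (J : Type w₁) [Category.{w₂} J], (J ⥤ c.E) → Prop),
        (∀ (J : Type w₁) [Category.{w₂} J] (D : J ⥤ c.E), Ξ J D →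
          ∀ H : c.E ⥤ c.E, Ξ J (D ⋙ H)) →
        (∀ (J : Type w₁) [Category.{w₂} J] (D : J ⥤ c.E), Ξ J D → PreservesColimit D c.F) →
        ∀ (J : Type w₁) [Category.{w₂} J] (D : J ⥤ c.E), Ξ J D →
          PreservesColimit D (L.T c).toFunctor) ∧
      -- (ii) the unit is valued in `M`
      (∀ (c : FreeMonadSequence.ConfMnd.{w, v, u} κ) (X : c.E), c.M ((L.T c).η.app X)) ∧
      -- (iii) `T` preserves `M`
      (∀ (c : FreeMonadSequence.ConfMnd.{w, v, u} κ) {X Y : c.E} (f : X ⟶ Y),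
        c.M f → c.M ((L.T c).map f)) ∧
      -- (iv) cartesian units
      (∀ c : FreeMonadSequence.ConfMnd.{w, v, u} κ,
        c.M ≤ MorphismProperty.monomorphisms c.E →
        FreeMonadSequence.HasPullbacksAlong c.M →
        FreeMonadSequence.HasVanKampenPushoutsAlong c.M →
        NatTrans.Equifibered c.η → NatTrans.Equifibered (L.T c).η) := by
  have h₀ : Cardinal.aleph0 ≤ κ := hκ.aleph0_le
  refine ⟨FreeMonadSequence.freeMonadLift h₀, fun c => (c.freeAlgebras h₀).ι, rfl,
    fun c => (c.freeAlgebras h₀).isFreeAndAlgebraicallyFree,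
    fun P X => FreeMonadSequence.ConfMnd.Hom.ι_γApp P h₀ X,
    fun c Ξ hΞ hF J _ D hD =>
      FreeMonadSequence.ConfMnd.preservesColimit_freeFunctor h₀ Ξ hΞ hF D hD,
    fun c X => c.freeUnit_mem h₀ X,
    fun c X Y f hf => FreeMonadSequence.ConfMnd.freeFunctor_map_mem h₀ f hf,
    fun c hmono hpb hvk hη => FreeMonadSequence.ConfMnd.equifibered_freeUnit h₀ hmono hpb hvk hη⟩
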